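/- Identify $\mathbb{R}^3$ with $\mathfrak{su}_2$ by sending $e_j$ to $-i\sigma_j$ ($\sigma_j$ the Pauli matrices), so that unit vectors have square $-\mathbb{1}$. Let $h(q)=Aq+a$ be an orientation preserving rigid motion of $\mathbb{R}^3$, let $p>0$, and let $\mathcal{M}=\mathcal{M}_h$ be the space of smooth immersions $\gamma\colon\mathbb{R}\to\mathbb{R}^3$ with $\gamma(x+p)=h(\gamma(x))$ for all $x$. Let $\gamma\in\mathcal{M}$, let $\lambda\in\mathbb{C}\setminus\mathbb{R}$, fix $x_0\in\mathbb{R}$, and let $F\colon\mathbb{R}\to\mathbf{SL}_2(\mathbb{C})$ be the solution of $dF=F\,\lambda\,d\gamma$, $F(x_0)=\mathbb{1}$. Let $U\in\mathbf{SU}_2$ be a lift of $A$, that is $Aw=UwU^{-1}$ for $w\in\mathfrak{su}_2$, and let $\tilde A(x)=F(x)^{-1}F(x+p)\,U$. This is the monodromy matrix, with base point $x$, of the curve $FF^*$ in hyperbolic space $H^3$ (the hermitian $2\times2$-matrices of determinant one and positive trace), and it acts on $H^3$ by $q\mapsto \tilde A(x)\,q\,\tilde A(x)^*$. The sphere at infinity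 of $H^3$ is identified with $S^2\subset\mathbb{R}^3$ by the stereographic projection $q\mapsto i\,\frac{\operatorname{tr}(q)\mathbb{1}-2q}{2+\operatorname{tr}q}$ onto the unit ball. Assume $\tilde A(x_0)\neq\pm\mathbb{1}$. Then there are continuous maps $S_\pm\colon\mathbb{R}\to S^2$ such that, for every $x$, the set of fixed points of $\tilde A(x)$ on the sphere at infinity is $\{S_+(x),S_-(x)\}$ (where $S_+=S_-$ is allowed: this is the case of a parabolic $\tilde A$). For every such pair $S_\pm$, the curves $$\eta_\pm=\gamma+\frac{\Im\lambda}{|\lambda|^2}\,S_\pm$$ have the following properties. 1. $\eta_\pm$ is a Darboux transform of $\gamma$ with parameter $\lambda$, which means that $\eta_\pm=\gamma+\frac{\Im\lambda}{|\lambda|^2}S$ for a field $S$ of unit vectors with $S'=-2\,\Re(\lambda)\,T\times S-2\,\Im(\lambda)\,S\times(T\times S)$. Here $(\,)'$ is the derivative with respect to the arclength of $\gamma$, and $T=\gamma'$. 2. $\eta_\pm\in\mathcal{M}$: it is a smooth immersion with the same monodromy $h$ as $\gamma$. 3. $|\eta_\pm(x)-\gamma(x)|=|\Im\lambda|/|\lambda|^2$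 for all $x$, and $\eta_\pm$ induces the same arclength on $\mathbb{R}$ as $\gamma$, that is $|d\eta_\pm|=|d\gamma|$. 4. $E_k(\eta_\pm)=E_k(\gamma)$ for all $k\ge-2$. The Hamiltonians are defined as follows, with $I=[x_0,x_0+p]$ and $dx=|d\gamma|$. * Let $v$ be a unit vector with $Av=v$ and $o$ a point with $h(o)\in o+\mathbb{R}v$ (so $o+\mathbb{R}v$ is an axis of $h$). Then $E_{-2}(\gamma)=\frac12\int_I|(\gamma-o)-(\gamma-o,v)v|^2\,(d\gamma,v)$ and $E_{-1}(\gamma)=\frac12\int_I((\gamma-o)\times d\gamma,v)$. The equalities hold for every such pair $(o,v)$. * $E_0=0$, and $E_1(\gamma)=\int_I dx$ is the length. * $E_2(\gamma)\in\mathbb{R}/2\pi\mathbb{Z}$ is the total torsion, the angle $\alpha$ with $A\,\xi(x_0)=\cos\alpha\;\xi(x_0+p)+\sin\alpha\;T(x_0+p)\times\xi(x_0+p)$ for a unit normal field $\xi$ along $\gamma$ that is parallel in the normal bundle. * Let $Y_0=T$ and $Y_{k+1}=T\times Y_k'-\frac12\sum_{i=1}^{k}(Y_i,Y_{k+1-i})\,T$.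 For $k\ge3$, $E_k(\gamma)$ is the coefficient of $z^{k-2}$ in $$\frac12\int_I\Big(\sum_{i\ge1}(Y_i,Y_1)z^i\Big)\Big(1+\sum_{l\ge2}\tfrac12(T,Y_l)z^l\Big)^{-1}dx ,$$ for instance $E_3=\frac12\int_I|\gamma''|^2dx$ and $E_4=-\frac12\int_I\det(\gamma',\gamma'',\gamma''')\,dx$. -/

import Mathlib

open scoped Matrix ContDiff

noncomputable section

/-- Euclidean three-space. -/
abbrev E3 : Type := EuclideanSpace ℝ (Fin 3)

/-- The vector product of Euclidean three-space. -/
def cross (u v : E3) : E3 := WithLp.toLp 2 (crossProduct (WithLp.ofLp u) (WithLp.ofLp v))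

/-- The space of curves with monodromy `h`: smooth immersions `γ : ℝ → ℝ³` with
`γ (x + p) = h (γ x)`. The parameter line is `ℝ` and the translation is `x ↦ x + p`. -/
def curvesWithMonodromy (p : ℝ) (h : E3 ≃ᵃⁱ[ℝ] E3) : Set (ℝ → E3) :=
  {γ | ContDiff ℝ ∞ γ ∧ (∀ x, deriv γ x ≠ 0) ∧ ∀ x, γ (x + p) = h (γ x)}

/-- The rigid motion `h` preserves the orientation. -/
def IsOrientationPreserving (h : E3 ≃ᵃⁱ[ℝ] E3) : Prop :=
  LinearMap.det (h.linearIsometryEquiv.toLinearEquiv : E3 →ₗ[ℝ] E3) = 1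

/-! ### Derivatives with respect to arclength, and the hierarchy of vector fields -/

/-- The derivative `f' = df/dx` of `f` with respect to the arclength of `γ`. -/
def arcDeriv (γ f : ℝ → E3) (t : ℝ) : E3 := ‖deriv γ t‖⁻¹ • deriv f t

/-- The unit tangent `T = γ'`. -/
def unitTangent (γ : ℝ → E3) : ℝ → E3 := arcDeriv γ γ

/-- The vector fields `Y_k` along `γ`: `Y_0 = T` and
`Y_{k+1} = T × Y_k' - (1/2) ∑_{i=1}^{k} (Y_i, Y_{k+1-i}) T`. -/
def flowField (γ : ℝ → E3) : ℕ → ℝ → E3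
  | 0 => unitTangent γ
  | k + 1 => fun t =>
      cross (unitTangent γ t) (arcDeriv γ (flowField γ k) t) -
        ((1 / 2 : ℝ) * ∑ i : Fin k,
          inner ℝ (flowField γ ((i : ℕ) + 1) t) (flowField γ (k - (i : ℕ)) t)) • unitTangent γ t
termination_by k => k
decreasing_by all_goals (try have := i.isLt); omega

/-! ### The Hamiltonians -/

/-- `E_{-2}`, the volume functional with respect to the axis `o + ℝ v`, over `[x₀, x₀ + p]`. -/
def volumeFunctional (p x₀ : ℝ) (o v : E3) (γ : ℝ → E3) : ℝ :=
  (1 / 2 : ℝ) * ∫ t in x₀..(x₀ + p),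
    ‖(γ t - o) - (inner ℝ (γ t - o) v : ℝ) • v‖ ^ 2 * inner ℝ (deriv γ t) v

/-- `E_{-1}`, the area functional with respect to the axis `o + ℝ v`, over `[x₀, x₀ + p]`. -/
def areaFunctional (p x₀ : ℝ) (o v : E3) (γ : ℝ → E3) : ℝ :=
  (1 / 2 : ℝ) * ∫ t in x₀..(x₀ + p), inner ℝ (cross (γ t - o) (deriv γ t)) v

/-- The line `o + ℝ v`, with `v` a unit vector, is an (oriented) axis of `h`: the linear part of `h`
fixes `v`, and `h` moves `o` along the line. -/
def IsAxis (h : E3 ≃ᵃⁱ[ℝ] E3) (o v : E3) : Prop :=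
  ‖v‖ = 1 ∧ h.linearIsometryEquiv v = v ∧ ∃ s : ℝ, h o = o + s • v

/-- `E_1`, the length of `γ` over `[x₀, x₀ + p]`. -/
def lengthFunctional (p x₀ : ℝ) (γ : ℝ → E3) : ℝ :=
  ∫ t in x₀..(x₀ + p), ‖deriv γ t‖

/-- A unit normal field along `γ` that is parallel in the normal bundle: its derivative has no
normal component. -/
def IsParallelUnitNormal (γ ξ : ℝ → E3) : Prop :=
  ContDiff ℝ ∞ ξ ∧ (∀ t, ‖ξ t‖ = 1) ∧ (∀ t, inner ℝ (ξ t) (deriv γ t) = (0 : ℝ)) ∧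
    ∀ t, ∃ c : ℝ, deriv ξ t = c • unitTangent γ t

/-- `α` is the angle between the parallel transport in the normal bundle from `x₀` to `x₀ + p` and
the monodromy `h`, the complex structure of the normal bundle being `T × ·`:
`h ξ(x₀) = exp (i α) ξ(x₀ + p)` for a parallel unit normal field `ξ`. -/
def IsTotalTorsion (p x₀ : ℝ) (h : E3 ≃ᵃⁱ[ℝ] E3) (γ : ℝ → E3) (α : Real.Angle) : Prop :=
  ∃ ξ : ℝ → E3, IsParallelUnitNormal γ ξ ∧
    h.linearIsometryEquiv (ξ x₀) =
      α.cos • ξ (x₀ + p) + α.sin • cross (unitTangent γ (x₀ + p)) (ξ (x₀ + p))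

/-- `E_2`, the total torsion, an angle modulo `2π`. For a curve with orientation preserving
monodromy `h` there is exactly one `α` with `IsTotalTorsion p x₀ h γ α`; this is that angle. -/
def totalTorsion (p x₀ : ℝ) (h : E3 ≃ᵃⁱ[ℝ] E3) (γ : ℝ → E3) : Real.Angle :=
  Classical.epsilon (IsTotalTorsion p x₀ h γ)

/-- The density of the generating series of the higher Hamiltonians at `t`, as a power series in
`z = λ⁻¹`:
`(1/2) (∑_{i ≥ 1} (Y_i, Y_1) z^i) / (1 + ∑_{l ≥ 2} (1/2) (T, Y_l) z^l)`. -/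
def hamiltonianDensity (γ : ℝ → E3) (t : ℝ) : PowerSeries ℝ :=
  PowerSeries.C (1 / 2 : ℝ) *
    PowerSeries.mk (fun i => if 1 ≤ i then inner ℝ (flowField γ i t) (flowField γ 1 t) else 0) *
    (1 + PowerSeries.mk (fun l =>
      if 2 ≤ l then (1 / 2 : ℝ) * inner ℝ (unitTangent γ t) (flowField γ l t) else 0))⁻¹

/-- `E_k` for `k ≥ 3`: the integral with respect to arclength over `[x₀, x₀ + p]` of the
coefficient of `z ^ (k - 2)` of the density; for instance
`E_3 = (1/2) ∫ |γ''|² dx` and `E_4 = -(1/2) ∫ det (γ', γ'', γ''') dx`. -/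
def higherHamiltonian (p x₀ : ℝ) (k : ℕ) (γ : ℝ → E3) : ℝ :=
  ∫ t in x₀..(x₀ + p), PowerSeries.coeff (k - 2) (hamiltonianDensity γ t) * ‖deriv γ t‖

/-! ### The associated family for complex spectral parameter -/

/-- The identification of `ℝ³` with `su₂` in which the unit vectors `e₁, e₂, e₃` correspond to
`-i σ₁, -i σ₂, -i σ₃` (`σ_j` the Pauli matrices), so that unit vectors have square `-1`. -/
def su2 (w : E3) : Matrix (Fin 2) (Fin 2) ℂ :=
  !![-(Complex.I * (w 2 : ℂ)), -(Complex.I * (w 0 : ℂ)) - (w 1 : ℂ);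
     -(Complex.I * (w 0 : ℂ)) + (w 1 : ℂ), Complex.I * (w 2 : ℂ)]

/-- `F` is the solution of `dF = F (λ dγ)`, that is `F' = F (λ T)`, with `F (x₀) = 1`. -/
def IsFrame (γ : ℝ → E3) (lam : ℂ) (x₀ : ℝ) (F : ℝ → Matrix (Fin 2) (Fin 2) ℂ) : Prop :=
  F x₀ = 1 ∧ ∀ t i j,
    HasDerivAt (fun s => F s i j) ((F t * (lam • su2 (deriv γ t))) i j) t

/-- `U ∈ SU₂` lifts the rotational part of `h`, which is `X ↦ U X U⁻¹` on `su₂ = ℝ³`. -/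
def IsSpinLift (h : E3 ≃ᵃⁱ[ℝ] E3) (U : Matrix (Fin 2) (Fin 2) ℂ) : Prop :=
  U ∈ Matrix.specialUnitaryGroup (Fin 2) ℂ ∧
    ∀ w : E3, su2 (h.linearIsometryEquiv w) = U * su2 w * Uᴴ

/-- The monodromy matrix, with base point `x`, of the curve `F Fᴴ` in hyperbolic space. It is
`F (x₀ + p) * U` for `x = x₀` if `F x₀ = 1`, and it changes to `(F x)⁻¹ * (F (x₀ + p) * U) * F x`
if the base point moves to `x`. -/
def hypMonodromy (p : ℝ) (F : ℝ → Matrix (Fin 2) (Fin 2) ℂ) (U : Matrix (Fin 2) (Fin 2) ℂ)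
    (x : ℝ) : Matrix (Fin 2) (Fin 2) ℂ :=
  (F x)⁻¹ * F (x + p) * U

/-- The positive semidefinite hermitian matrix of rank one that spans the light ray of the point
`S ∈ S²` at infinity of hyperbolic space (the hermitian matrices of determinant one and positive
trace). The stereographic projection `q ↦ i (tr q - 2 q) / (2 + tr q)` onto the unit ball of
`su₂ = ℝ³` takes `r • lightRay S` to a point that tends to `S` as `r → ∞`. -/
def lightRay (S : E3) : Matrix (Fin 2) (Fin 2) ℂ := 1 + Complex.I • su2 S

/-- The fixed points on the sphere at infinity of the hyperbolic motion `q ↦ B q Bᴴ`. -/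
def fixedPointsAtInfinity (B : Matrix (Fin 2) (Fin 2) ℂ) : Set E3 :=
  {S | ‖S‖ = 1 ∧ ∃ r : ℝ, 0 < r ∧ B * lightRay S * Bᴴ = (r : ℂ) • lightRay S}

/-- `η` is a Darboux transform of `γ` with parameter `λ`: `η = γ + (Im λ / |λ|²) S` for a field `S`
of unit vectors with `S' = -2 Re λ (T × S) - 2 Im λ (S × (T × S))`. -/
def IsDarbouxTransform (lam : ℂ) (γ η : ℝ → E3) : Prop :=
  ∃ S : ℝ → E3, (∀ t, ‖S t‖ = 1) ∧ (∀ t, η t = γ t + (lam.im / ‖lam‖ ^ 2) • S t) ∧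
    ∀ t, HasDerivAt S
      (-(2 * lam.re) • cross (deriv γ t) (S t)
        - (2 * lam.im) • cross (S t) (cross (deriv γ t) (S t))) t

end

/-!
The proof identifies the sphere at infinity of hyperbolic space with the complex projective line. A
spinor `φ` determines the point `hopf φ`, and fixed points at infinity of a hyperbolic motion are
eigenlines of its matrix (`hopf_mem_fixedPointsAtInfinity_iff`). The monodromies with different base
points are conjugate by the frame `F`, so a fixed point at `x` is `hopf (F x)⁻¹ φ` with an
eigenvector `φ` of the monodromy at `x₀` (`IsFrame.fixedPointsAtInfinity_eq`). As `F⁻¹ φ` is a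
solution of a linear equation that is periodic up to the spin lift and a scalar, `S = hopf (F⁻¹ φ)`
satisfies the equation of Darboux transforms and has the monodromy of the curve
(`IsFrame.hasDerivAt_hopf`, `IsFrame.hopf_add`). Two eigenlines coincide everywhere or nowhere, so
any continuous choice of fixed points arises in this way.

A Darboux transformation `η` of `γ`, with parameter `a + i b`, rotates the tangent by the quaternion
`d = -a + b S` (`IsDarbouxPair.deriv_η`), so it preserves arclength. The same rotation takes
parallel normal fields to parallel normal fields, hence the total torsion is preserved. The
densities of area and volume change by the derivatives of explicit functions that are periodic.

For the higher Hamiltonians let `Y = ∑ Y_k X ^ k`, an imaginary unit quaternion over `ℝ⟦X⟧`. It is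
characterized by its constant term `T` and the Lax equation `X Y' = Y × T` (`eq_flowField`). The
Darboux matrix `D = 2 (a² + b²) X + d` gauges the connection of `γ` to that of `η`, hence it
conjugates the series `Y` of `γ` to the series `W` of `η` (`IsDarbouxPair.quatConj_flowSeries`). The
element `1 - Y T` conjugates `T` to `Y` and thus diagonalizes the connection; half the generating
density of the Hamiltonians is the correction of the resulting connection form
(`hamiltonianDensity_mul_speed`). Therefore `κ = (1 - Y T)* D (1 - W T₁) d*`, with `T₁` the tangent
of `η`, commutes with `T`, that is `κ = α + β T`, and `arctan (β / α)` is a primitive of half the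
difference of the densities (`phase_ode_of_isGaugePair`). Since `β / α` has no constant term, the
arctangent is a formal power series, and since `κ` is equivariant under the monodromy, it is
periodic. So the integrals over a period agree (`IsDarbouxPair.higherHamiltonian_eq`).
-/

/-! ### Gauge identities for quaternions over a commutative ring -/

section
open Quaternion

/-- If `T` and `Y` are imaginary units and `2 x Y' = v [Y, T]`, then `Y` is conjugated to `T` by
`G = 1 - Y T`, and `G` gauges the connection `(v / 2 x) T` to one whose part along `T` has the
coefficient `v / 2 x + e / n`. Here `n = |G|²`, and all denominators have been cleared. -/
theorem one_sub_mul_gauge {R : Type*} [CommRing R] {x v n n' e : R} {T Y T' Y' : ℍ[R]}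
    (hT : T.re = 0) (hY : Y.re = 0) (hT' : T'.re = 0) (hY' : Y'.re = 0)
    (hTT : T.imI ^ 2 + T.imJ ^ 2 + T.imK ^ 2 = 1) (hYY : Y.imI ^ 2 + Y.imJ ^ 2 + Y.imK ^ 2 = 1)
    (hTT' : T.imI * T'.imI + T.imJ * T'.imJ + T.imK * T'.imK = 0)
    (hI : x * Y'.imI = v * (Y.imJ * T.imK - Y.imK * T.imJ))
    (hJ : x * Y'.imJ = v * (Y.imK * T.imI - Y.imI * T.imK))
    (hK : x * Y'.imK = v * (Y.imI * T.imJ - Y.imJ * T.imI))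
    (hn : n = 2 - 2 * (T * Y).re) (hn' : n' = - 2 * (T' * Y + T * Y').re)
    (he : e = (Y * (T' * T)).re) :
    (2 * x * n) • (-(Y' * T + Y * T')) + (n * v) • (T * (1 - Y * T)) =
      (1 - Y * T) * ((x * n') • 1 + (x * n) • (T' * T) + (v * n + 2 * x * e) • T) := by
  have hxn' : x * n' = -2 * x * (T' * Y).re := by
    simp [Quaternion.re_mul, hT, hY, hT', hY'] at *
    linear_combination x * hn' + 2 * T.imI * hI + 2 * T.imJ * hJ + 2 * T.imK * hK
  have h1 : (2 * x * n) • (-(Y' * T + Y * T')) = (-2 * x * n) • (Y * T') - (n * v) • ((Y * T - T *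
      Y) * T) := by
    apply Quaternion.ext <;>
    simp [Quaternion.re_mul, Quaternion.imI_mul, Quaternion.imJ_mul, Quaternion.imK_mul, hT, hY,
        hT', hY']
    · linear_combination 2 * n * (T.imI * hI + T.imJ * hJ + T.imK * hK)
    · linear_combination 2 * n * (T.imJ * hK - T.imK * hJ)
    · linear_combination 2 * n * (T.imK * hI - T.imI * hK)
    · linear_combination 2 * n * (T.imI * hJ - T.imJ * hI)
  rw [h1, hxn', hn, he]
  clear h1 hn' hI hJ hK hxn' hn he
  apply Quaternion.ext <;>
    simp [Quaternion.re_mul, Quaternion.imI_mul, Quaternion.imJ_mul, Quaternion.imK_mul, hT, hY,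
        hT'] <;> grind

/-- The derivative of a product of three gauge transformations, with denominators cleared. -/
theorem gauge_conj_comp {R A : Type*} [CommRing R] [Ring A] [Algebra R A] {x v n m : R}
    {Gs Gs' D D' H H' T S P Q : A}
    (h1 : (2 * x * n) • Gs' = P * Gs + (n * v) • (Gs * T))
    (h2 : (2 * x) • D' = v • (D * S - T * D))
    (h3 : (2 * x * m) • H' + (m * v) • (S * H) = H * Q) :
    (2 * x * n * m) • (Gs' * D * H + Gs * D' * H + Gs * D * H') =
      m • (P * (Gs * D * H)) + n • (Gs * D * H * Q) := by
  have e1 := congrArg (fun z => m • (z * D * H)) h1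
  have e2 := congrArg (fun z => (n * m) • (Gs * z * H)) h2
  have e3 := congrArg (fun z => n • (Gs * D * z)) h3
  simp only [smul_mul_assoc, mul_smul_comm, smul_smul, mul_add, add_mul, mul_sub, sub_mul,
      smul_add, smul_sub, ← mul_assoc] at e1 e2 e3 ⊢
  linear_combination (norm := module) e1 + e2 + e3

/-- If `κ` commutes with `T`, it is `α + β T`. When `κ` is the product of an intertwiner `ψ` of two
diagonalized connections with a quaternion `d` that rotates `T` to `T₁` in a parallel way, the
logarithmic derivative of `κ` has the imaginary part `e₁ / n₁ - e / n`, which is the difference of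
the diagonal connection forms. -/
theorem phase_ode {R : Type*} [CommRing R] [IsDomain R] [CharZero R] {x n n₁ n' n₁' e e₁ v : R}
    {T T₁ T' T₁' ψ ψ' d d' : ℍ[R]} (hx : x ≠ 0)
    (hT : T.re = 0) (hT' : T'.re = 0)
    (hTT : T.imI ^ 2 + T.imJ ^ 2 + T.imK ^ 2 = 1)
    (hTT' : T.imI * T'.imI + T.imJ * T'.imJ + T.imK * T'.imK = 0)
    (hT₁T₁ : T₁ * T₁ = -1)
    (hψ : ψ * T₁ = T * ψ) (hd : T₁ * d = d * T) (μ : R) (hd' : d' = μ • (T - T₁))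
    (hdd' : T₁' * d + T₁ * d' = d' * T + d * T')
    (h : (2 * x * n * n₁) • ψ' =
      n₁ • (((x * n') • 1 - (x * n) • (T' * T) - (v * n + 2 * x * e) • T) * ψ) +
      n • (ψ * ((x * n₁') • 1 + (x * n₁) • (T₁' * T₁) + (v * n₁ + 2 * x * e₁) • T₁)))
    {κ κ' : ℍ[R]} (hκ : κ = ψ * d) (hκ' : κ' = ψ' * d + ψ * d') {α β α' β' : R}
    (hα : α = κ.re) (hβ : β = - (κ * T).re)
    (hα' : α' = κ'.re) (hβ' : β' = - (κ' * T + κ * T').re) :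
    n * n₁ * (α * β' - β * α') = (n * e₁ - n₁ * e) * (α ^ 2 + β ^ 2) := by
  have hTTq : T * T = -1 := by
    apply Quaternion.ext <;>
    simp [Quaternion.re_mul, Quaternion.imI_mul, Quaternion.imJ_mul, Quaternion.imK_mul, hT] <;>
        grind
  have hκT : κ * T = T * κ := by
    rw [hκ, mul_assoc, ← hd, ← mul_assoc, hψ, mul_assoc]
  -- The rotation by `d` is parallel: it takes the connection `T' T` to `T₁' T₁`, up to `2 d'`.
  have h5 : T₁' * T₁ * d + 2 • d' = d * (T' * T) := by
    have h6 := congrArg (· * T) hdd'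
    have h7 : T₁ * d' * T = d' := by
      rw [hd', mul_smul_comm, smul_mul_assoc, mul_sub, sub_mul, hT₁T₁, mul_assoc, hTTq,
        mul_neg_one, neg_one_mul]
      module
    simp only [add_mul, h7, mul_assoc, hTTq, ← hd] at h6
    rw [mul_assoc, ← mul_assoc d]
    rw [mul_assoc, mul_neg_one] at *
    linear_combination (norm := module) h6
  -- The terms `± v T` cancel because `ψ` intertwines `T₁` and `T`.
  have h8 : (2 * x * n * n₁) • κ' = (x * (n₁ * n' + n * n₁')) • κ + (2 * x * (n * e₁ - n₁ * e)) •
      (T * κ)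
      + (x * n * n₁) • (κ * (T' * T) - T' * T * κ) := by
    have e1 := congrArg (· * d) h
    have e2 := congrArg (fun z => (x * n * n₁) • (ψ * z)) h5
    have e3 : ψ * T₁ * d = T * κ := by rw [hψ, mul_assoc, hκ]
    rw [hκ']
    simp only [mul_add, add_mul, mul_smul_comm, smul_mul_assoc, sub_mul, mul_one, one_mul,
        smul_add, smul_sub, smul_smul, ← mul_assoc] at e1 e2 e3 ⊢
    simp only [e3] at e1
    rw [hκ] at *
    simp only [← mul_assoc] at *
    linear_combination (norm := module) e1 + e2
  have h9 : (2 * n * n₁) • κ' = (n₁ * n' + n * n₁') • κ + (2 * (n * e₁ - n₁ * e)) • (T * κ)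
      + (n * n₁) • (κ * (T' * T) - T' * T * κ) := by
    apply smul_right_injective _ hx
    simp only [smul_add, smul_smul]
    convert h8 using 2 <;> ring_nf
  -- `κ` commutes with the imaginary unit `T`, so its imaginary part is a multiple of `T`.
  have c1 : κ.imI = β * T.imI ∧ κ.imJ = β * T.imJ ∧ κ.imK = β * T.imK := by
    have a1 := congrArg QuaternionAlgebra.imI hκT
    have a2 := congrArg QuaternionAlgebra.imJ hκT
    have a3 := congrArg QuaternionAlgebra.imK hκT
    simp [Quaternion.re_mul, Quaternion.imI_mul, Quaternion.imJ_mul, Quaternion.imK_mul, hT]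
        at a1 a2 a3 hβ
    have two : (2:R) ≠ 0 := two_ne_zero
    refine ⟨?_, ?_, ?_⟩ <;> apply mul_left_cancel₀ two <;> grind
  obtain ⟨k1, k2, k3⟩ := c1
  have b0 := congrArg QuaternionAlgebra.re h9
  have b1 := congrArg QuaternionAlgebra.imI h9
  have b2 := congrArg QuaternionAlgebra.imJ h9
  have b3 := congrArg QuaternionAlgebra.imK h9
  simp [Quaternion.re_mul, Quaternion.imI_mul, Quaternion.imJ_mul, Quaternion.imK_mul, hT, hT', k1,
      k2, k3, ← hα] at b0 b1 b2 b3 hβ' hα'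
  have two : (2:R) ≠ 0 := two_ne_zero
  apply mul_left_cancel₀ two
  have q1 : 2 * n * n₁ * α' = (n₁ * n' + n * n₁') * α - 2 * (n * e₁ - n₁ * e) * β := by
    linear_combination b0 + 2 * n * n₁ * hα' - 2 * (n * e₁ - n₁ * e) * β * hTT
  have q2 : 2 * n * n₁ * β' = (n₁ * n' + n * n₁') * β + 2 * (n * e₁ - n₁ * e) * α := by
    linear_combination T.imI * b1 + T.imJ * b2 + T.imK * b3 + 2 * n * n₁ * hβ' + ((n₁ * n' + n *
        n₁') * β + 2 * (n * e₁ - n₁ * e) * α) * hTT + 2 * n * n₁ * β * hTT'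
  linear_combination α * q2 - β * q1
end

/-! ### Differentiation of families of power series -/

section
open PowerSeries

/-- The family `f` of power series has the coefficientwise derivative `f'` at `t`. -/
def HasFormalDerivAt (f : ℝ → PowerSeries ℝ) (f' : PowerSeries ℝ) (t : ℝ) : Prop :=
  ∀ n, HasDerivAt (fun s => coeff n (f s)) (coeff n f') t

namespace HasFormalDerivAt
variable {f g : ℝ → PowerSeries ℝ} {f' g' : PowerSeries ℝ} {t : ℝ}

theorem const (c : PowerSeries ℝ) (t : ℝ) : HasFormalDerivAt (fun _ => c) 0 t := fun n => by
  simpa using hasDerivAt_const t (coeff n c)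

theorem add (hf : HasFormalDerivAt f f' t) (hg : HasFormalDerivAt g g' t) :
    HasFormalDerivAt (fun s => f s + g s) (f' + g') t := fun n => by
  simpa using (hf n).fun_add (hg n)

theorem neg (hf : HasFormalDerivAt f f' t) : HasFormalDerivAt (fun s => -f s) (-f') t := fun n => by
  simpa using (hf n).fun_neg

theorem sub (hf : HasFormalDerivAt f f' t) (hg : HasFormalDerivAt g g' t) :
    HasFormalDerivAt (fun s => f s - g s) (f' - g') t := fun n => by
  simpa using (hf n).fun_sub (hg n)

theorem mul (hf : HasFormalDerivAt f f' t) (hg : HasFormalDerivAt g g' t) :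
    HasFormalDerivAt (fun s => f s * g s) (f' * g t + f t * g') t := fun n => by
  simp only [map_add, coeff_mul, ← Finset.sum_add_distrib]
  exact HasDerivAt.fun_sum fun ij _ => (hf ij.1).mul (hg ij.2)

theorem unique {f₁' : PowerSeries ℝ} (h : HasFormalDerivAt f f' t) (h₁ : HasFormalDerivAt f f₁' t) :
    f' = f₁' := by
  ext n; exact (h n).unique (h₁ n)

theorem pow (hf : HasFormalDerivAt f f' t) (n : ℕ) :
    HasFormalDerivAt (fun s => f s ^ (n + 1)) ((n + 1 : ℕ) * f t ^ n * f') t := by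
  induction n with
  | zero => simpa using hf
  | succ n ih =>
    have := ih.mul hf
    simp only [← pow_succ] at this
    convert this using 1
    push_cast; ring

theorem inv (hf : HasFormalDerivAt f f' t) (h0 : ∀ s, constantCoeff (f s) ≠ 0) :
    HasFormalDerivAt (fun s => (f s)⁻¹) (-(f' * (f t)⁻¹ ^ 2)) t := by
  -- Each coefficient of the inverse is a rational function of coefficients of `f`; the value of the
  -- derivative then follows by differentiating `f * f⁻¹ = 1`.
  have hd : ∀ n, DifferentiableAt ℝ (fun s => coeff n (f s)⁻¹) t := by
    intro n
    induction n using Nat.strong_induction_on with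
    | _ n ih =>
      have hc : DifferentiableAt ℝ (fun s => (constantCoeff (f s))⁻¹) t := by
        have := (hf 0).differentiableAt
        simp only [coeff_zero_eq_constantCoeff] at this
        exact this.inv (h0 t)
      rw [funext fun s => PowerSeries.coeff_inv n (f s)]
      split_ifs with hn
      · exact hc
      · refine hc.neg.mul (DifferentiableAt.fun_sum fun ij hij => ?_)
        split_ifs with hlt
        · exact (hf _).differentiableAt.mul (ih _ hlt)
        · exact differentiableAt_const _
  let g' : PowerSeries ℝ := PowerSeries.mk fun n => deriv (fun s => coeff n (f s)⁻¹) t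
  have hg : HasFormalDerivAt (fun s => (f s)⁻¹) g' t := fun n => by
    simpa [g'] using (hd n).hasDerivAt
  have h1 := hf.mul hg
  simp only [PowerSeries.mul_inv_cancel _ (h0 _)] at h1
  have h2 := h1.unique (const 1 t)
  have h3 := PowerSeries.mul_inv_cancel _ (h0 t)
  have : g' = -(f' * (f t)⁻¹ ^ 2) := by
    linear_combination (f t)⁻¹ * h2 - g' * h3
  exact this ▸ hg
end HasFormalDerivAt

theorem continuous_coeff_inv {f : ℝ → PowerSeries ℝ} (hf : ∀ n, Continuous fun s => coeff n (f s))
    (h0 : ∀ s, constantCoeff (f s) ≠ 0) (n : ℕ) : Continuous fun s => coeff n (f s)⁻¹ := by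
  induction n using Nat.strong_induction_on with
  | _ n ih =>
    have hc : Continuous (fun s => (constantCoeff (f s))⁻¹) := by
      have := hf 0
      simp only [coeff_zero_eq_constantCoeff] at this
      exact this.inv₀ h0
    rw [funext fun s => PowerSeries.coeff_inv n (f s)]
    split_ifs with hn
    · exact hc
    · refine hc.neg.mul (continuous_finsetSum _ fun ij hij => ?_)
      split_ifs with hlt
      · exact (hf _).mul (ih _ hlt)
      · exact continuous_const

theorem continuous_coeff_mul {f g : ℝ → PowerSeries ℝ} (hf : ∀ n, Continuous fun s => coeff n (f s))
    (hg : ∀ n, Continuous fun s => coeff n (g s)) (n : ℕ) :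
    Continuous fun s => coeff n (f s * g s) := by
  simp only [coeff_mul]
  exact continuous_finsetSum _ fun ij _ => (hf _).mul (hg _)

/-- Coefficientwise, `u' / (1 + u ^ 2)` is the derivative of the arctangent series of `u`. As `u`
has no constant term, the terms of degree at most `2 m + 1` suffice for the coefficient of order
`m`. -/
theorem hasDerivAt_coeff_arctan {u : ℝ → PowerSeries ℝ} {u' g : PowerSeries ℝ} {t : ℝ}
    (hu0 : constantCoeff (u t) = 0) (hu : HasFormalDerivAt u u' t)
    (hg : g * (1 + u t ^ 2) = u') (m : ℕ) :
    HasDerivAt (fun s => ∑ k ∈ Finset.range (m + 1),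
      (-1 : ℝ) ^ k / (2 * k + 1) * coeff m (u s ^ (2 * k + 1))) (coeff m g) t := by
  have h1 : HasDerivAt (fun s => ∑ k ∈ Finset.range (m + 1),
      (-1 : ℝ) ^ k / (2 * k + 1) * coeff m (u s ^ (2 * k + 1)))
      (∑ k ∈ Finset.range (m + 1), (-1 : ℝ) ^ k / (2 * k + 1) *
        coeff m (((2 * k + 1 : ℕ) : PowerSeries ℝ) * u t ^ (2 * k) * u')) t :=
    HasDerivAt.fun_sum fun k _ => (hu.pow (2 * k) m).const_mul _
  convert h1 using 1
  have h2 : ∀ k : ℕ, (-1 : ℝ) ^ k / (2 * k + 1) *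
        coeff m (((2 * k + 1 : ℕ) : PowerSeries ℝ) * u t ^ (2 * k) * u') =
      coeff m ((-u t ^ 2) ^ k * u') := by
    intro k
    have e1 : ((2 * k + 1 : ℕ) : PowerSeries ℝ) * u t ^ (2 * k) * u' =
        (2 * k + 1 : ℝ) • (u t ^ (2 * k) * u') := by
      rw [PowerSeries.smul_eq_C_mul]; simp only [map_add, map_mul, map_natCast, map_ofNat, map_one]
      push_cast; ring
    have e2 : (-u t ^ 2) ^ k * u' = (-1 : ℝ) ^ k • (u t ^ (2 * k) * u') := by
      rw [PowerSeries.smul_eq_C_mul, neg_pow, ← pow_mul]; simp; ring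
    rw [e1, e2, PowerSeries.coeff_smul, PowerSeries.coeff_smul, smul_eq_mul,
      smul_eq_mul, ← mul_assoc, div_mul_cancel₀ _ (by positivity)]
  simp only [h2]
  rw [← map_sum, ← Finset.sum_mul]
  have h3 := geom_sum_mul (-u t ^ 2) (m + 1)
  have h4 : (∑ k ∈ Finset.range (m + 1), (-u t ^ 2) ^ k) * u' = g - g * (-u t ^ 2) ^ (m + 1) := by
    linear_combination (-g) * h3 - (∑ k ∈ Finset.range (m + 1), (-u t ^ 2) ^ k) * hg
  rw [h4, map_sub]
  -- The remainder of the geometric series has order greater than `m`.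
  have h5 : (X : PowerSeries ℝ) ^ (m + 1) ∣ g * (-u t ^ 2) ^ (m + 1) := by
    apply Dvd.dvd.mul_left
    apply pow_dvd_pow_of_dvd
    rw [dvd_neg]
    exact (X_dvd_iff.mpr hu0).trans (dvd_pow_self _ two_ne_zero)
  rw [X_pow_dvd_iff.mp h5 m (Nat.lt_succ_self m), sub_zero]

/-- If `u` is a periodic family of power series without constant term, every coefficient of
`u' / (1 + u ^ 2)`, the derivative of `arctan u`, has integral zero over a period. -/
theorem integral_coeff_eq_zero {x₀ p : ℝ} {u u' g : ℝ → PowerSeries ℝ}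
    (hu0 : ∀ t, constantCoeff (u t) = 0) (hu : ∀ t, HasFormalDerivAt u (u' t) t)
    (hg : ∀ t, g t * (1 + u t ^ 2) = u' t) (m : ℕ) (hc : Continuous fun t => coeff m (g t))
    (hper : u (x₀ + p) = u x₀) : ∫ t in x₀..(x₀ + p), coeff m (g t) = 0 := by
  rw [intervalIntegral.integral_eq_sub_of_hasDerivAt
    (fun t _ => hasDerivAt_coeff_arctan (hu0 t) (hu t) (hg t) m) (hc.intervalIntegrable _ _), hper,
    sub_self]
end

/-! ### The phase of a pair of diagonalized formal connections -/

section
open Quaternion PowerSeries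

/-- The algebraic data of a formal solution of the Lax equation `x Y' = v Y × T` at a point:
imaginary unit quaternions `T` and `Y` over a commutative ring, and elements `T'` and `Y'` that play
the part of their derivatives. -/
structure IsGaugePair {R : Type*} [CommRing R] (x v : R) (T Y T' Y' : ℍ[R]) : Prop where
  re_T : T.re = 0
  re_Y : Y.re = 0
  re_T' : T'.re = 0
  re_Y' : Y'.re = 0
  sq_T : T.imI ^ 2 + T.imJ ^ 2 + T.imK ^ 2 = 1
  sq_Y : Y.imI ^ 2 + Y.imJ ^ 2 + Y.imK ^ 2 = 1
  orth : T.imI * T'.imI + T.imJ * T'.imJ + T.imK * T'.imK = 0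
  ode_I : x * Y'.imI = v * (Y.imJ * T.imK - Y.imK * T.imJ)
  ode_J : x * Y'.imJ = v * (Y.imK * T.imI - Y.imI * T.imK)
  ode_K : x * Y'.imK = v * (Y.imI * T.imJ - Y.imJ * T.imI)

namespace IsGaugePair
variable {R : Type*} [CommRing R] {x v : R} {T Y T' Y' : ℍ[R]}

theorem T_mul_T (h : IsGaugePair x v T Y T' Y') : T * T = -1 := by
  have := h.sq_T
  apply Quaternion.ext <;>
    simp [Quaternion.re_mul, Quaternion.imI_mul, Quaternion.imJ_mul, Quaternion.imK_mul, h.re_T] <;>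
    grind

theorem Y_mul_Y (h : IsGaugePair x v T Y T' Y') : Y * Y = -1 := by
  have := h.sq_Y
  apply Quaternion.ext <;>
    simp [Quaternion.re_mul, Quaternion.imI_mul, Quaternion.imJ_mul, Quaternion.imK_mul, h.re_Y] <;>
    grind

theorem T_mul_T' (h : IsGaugePair x v T Y T' Y') : T * T' = -(T' * T) := by
  have := h.orth
  apply Quaternion.ext <;>
    simp [Quaternion.re_mul, Quaternion.imI_mul, Quaternion.imJ_mul, Quaternion.imK_mul, h.re_T,
      h.re_T'] <;>
    grind

theorem star_T (h : IsGaugePair x v T Y T' Y') : star T = -T := by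
  apply Quaternion.ext <;> simp [h.re_T]

theorem star_Y (h : IsGaugePair x v T Y T' Y') : star Y = -Y := by
  apply Quaternion.ext <;> simp [h.re_Y]

theorem star_T' (h : IsGaugePair x v T Y T' Y') : star T' = -T' := by
  apply Quaternion.ext <;> simp [h.re_T']

theorem gauge (h : IsGaugePair x v T Y T' Y') {n n' e : R}
    (hn : n = 2 - 2 * (T * Y).re) (hn' : n' = - 2 * (T' * Y + T * Y').re)
    (he : e = (Y * (T' * T)).re) :
    (2 * x * n) • (-(Y' * T + Y * T')) + (n * v) • (T * (1 - Y * T)) =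
      (1 - Y * T) * ((x * n') • 1 + (x * n) • (T' * T) + (v * n + 2 * x * e) • T) :=
  one_sub_mul_gauge h.re_T h.re_Y h.re_T' h.re_Y' h.sq_T h.sq_Y h.orth h.ode_I h.ode_J h.ode_K
    hn hn' he

theorem star_gauge (h : IsGaugePair x v T Y T' Y') {n n' e : R}
    (hn : n = 2 - 2 * (T * Y).re) (hn' : n' = - 2 * (T' * Y + T * Y').re)
    (he : e = (Y * (T' * T)).re) :
    (2 * x * n) • star (-(Y' * T + Y * T')) =
      ((x * n') • 1 - (x * n) • (T' * T) - (v * n + 2 * x * e) • T) * star (1 - Y * T) +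
      (n * v) • (star (1 - Y * T) * T) := by
  have := congrArg star (h.gauge hn hn' he)
  rw [star_add, Quaternion.star_smul, Quaternion.star_smul, star_mul T, star_mul (1 - Y * T) (_ +
      _),
    star_add (_ + _), star_add ((x * n') • 1), Quaternion.star_smul, Quaternion.star_smul,
    Quaternion.star_smul,
    star_one, star_mul T' T, h.star_T, h.star_T', neg_mul_neg, h.T_mul_T'] at this
  rw [eq_sub_of_add_eq this]
  simp only [mul_neg, smul_neg, ← sub_eq_add_neg, sub_neg_eq_add]

end IsGaugePair

/-- The quaternion `2 L x + d` gauges `v T₁ / 2 x` to `v T / 2 x`. -/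
theorem darboux_ode {R : Type*} [CommRing R] {x v L : R} {T T₁ d d' : ℍ[R]} (hd : T * d = d * T₁)
    (hd' : d' = (L * v) • (T₁ - T)) : (2 * x) • d' =
      v • (((2 * L * x) • 1 + d) * T₁ - T * ((2 * L * x) • 1 + d)) := by
  rw [hd', mul_add, add_mul, hd, smul_one_mul, mul_smul_one]
  module

/-- Let `Y` and `W` solve the Lax equations of `T` and `T₁`, and let `D = 2 L x + d` gauge one to
the other. The gauge transformations `1 - Y T` and `1 - W T₁` diagonalize the two connections, so
that `κ = (1 - Y T)* D (1 - W T₁) d*` commutes with `T`. The angle of `κ = α + β T` changes at the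
rate `e₁ / n₁ - e / n`. -/
theorem phase_ode_of_isGaugePair {R : Type*} [CommRing R] [IsDomain R] [CharZero R] {x v L n n₁ n'
    n₁' e e₁ : R}
    {T T₁ Y W d T' T₁' Y' W' d' : ℍ[R]} (hx : x ≠ 0)
    (h : IsGaugePair x v T Y T' Y') (h₁ : IsGaugePair x v T₁ W T₁' W')
    (hd : T * d = d * T₁) (hW : ((2 * L * x) • 1 + d) * W = Y * ((2 * L * x) • 1 + d))
    (hd' : d' = (L * v) • (T₁ - T)) (hdd' : T' * d + T * d' = d' * T₁ + d * T₁')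
    (hn : n = 2 - 2 * (T * Y).re) (hn' : n' = - 2 * (T' * Y + T * Y').re)
    (he : e = (Y * (T' * T)).re)
    (hn₁ : n₁ = 2 - 2 * (T₁ * W).re) (hn₁' : n₁' = - 2 * (T₁' * W + T₁ * W').re)
    (he₁ : e₁ = (W * (T₁' * T₁)).re)
    {κ κ' : ℍ[R]} (hκ : κ = star (1 - Y * T) * ((2 * L * x) • 1 + d) * (1 - W * T₁) * star d)
    (hκ' : κ' = (star (-(Y' * T + Y * T')) * ((2 * L * x) • 1 + d) * (1 - W * T₁) +
      star (1 - Y * T) * d' * (1 - W * T₁) +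
      star (1 - Y * T) * ((2 * L * x) • 1 + d) * (-(W' * T₁ + W * T₁'))) * star d +
      star (1 - Y * T) * ((2 * L * x) • 1 + d) * (1 - W * T₁) * star d') {α β α' β' : R}
    (hα : α = κ.re) (hβ : β = - (κ * T).re)
    (hα' : α' = κ'.re) (hβ' : β' = - (κ' * T + κ * T').re) :
    n * n₁ * (α * β' - β * α') = (n * e₁ - n₁ * e) * (α ^ 2 + β ^ 2) := by
  have hsd : T₁ * star d = star d * T := by
    have := congrArg star hd
    rw [star_mul, star_mul, h.star_T, h₁.star_T, mul_neg, neg_mul] at this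
    exact (neg_injective this).symm
  have hsd' : T₁' * star d + T₁ * star d' = star d' * T + star d * T' := by
    have := congrArg star hdd'
    rw [star_add, star_add, star_mul, star_mul, star_mul, star_mul, h.star_T, h₁.star_T, h.star_T',
      h₁.star_T'] at this
    simp only [mul_neg, neg_mul, ← neg_add] at this
    have := neg_injective this
    rw [add_comm (star d' * T), this, add_comm]
  have hstard' : star d' = (L * v) • (T - T₁) := by
    rw [hd', Quaternion.star_smul, star_sub, h.star_T, h₁.star_T]; congr 1; abel
  have hD := darboux_ode (x := x) hd hd'
  refine phase_ode (v := v) (n' := n') (n₁' := n₁') hx h.re_T h.re_T' h.sq_T h.orth h₁.T_mul_T ?_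
      hsd (L * v) hstard' hsd' ?_ hκ hκ'
    hα hβ hα' hβ'
  · have e1 : (1 - W * T₁) * T₁ = W * (1 - W * T₁) := by
      rw [sub_mul, mul_sub, mul_assoc, h₁.T_mul_T, ← mul_assoc, h₁.Y_mul_Y]; simp [add_comm]
    have e2 : star (1 - Y * T) * Y = T * star (1 - Y * T) := by
      rw [star_sub, star_mul, star_one, h.star_T, h.star_Y, neg_mul_neg, sub_mul, mul_sub,
          mul_assoc,
        h.Y_mul_Y, ← mul_assoc T, h.T_mul_T]; simp [add_comm]
    rw [mul_assoc _ _ T₁, e1, ← mul_assoc, mul_assoc _ _ W, hW, ← mul_assoc, e2]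
    simp only [mul_assoc]
  · exact gauge_conj_comp (h.star_gauge hn hn' he) hD (h₁.gauge hn₁ hn₁' he₁)

/-! ### Differentiation of families of quaternionic power series -/

/-- The family `f` of quaternions over `ℝ⟦X⟧` has the coefficientwise derivative `f'` at `t`. -/
def HasQuatDerivAt (f : ℝ → ℍ[PowerSeries ℝ]) (f' : ℍ[PowerSeries ℝ]) (t : ℝ) : Prop :=
  HasFormalDerivAt (fun s => (f s).re) f'.re t ∧ HasFormalDerivAt (fun s => (f s).imI) f'.imI t ∧
  HasFormalDerivAt (fun s => (f s).imJ) f'.imJ t ∧ HasFormalDerivAt (fun s => (f s).imK) f'.imK t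

namespace HasQuatDerivAt
variable {f g : ℝ → ℍ[PowerSeries ℝ]} {f' g' : ℍ[PowerSeries ℝ]} {t : ℝ}

theorem const (c : ℍ[PowerSeries ℝ]) (t : ℝ) : HasQuatDerivAt (fun _ => c) 0 t :=
  ⟨.const _ t, .const _ t, .const _ t, .const _ t⟩

theorem add (hf : HasQuatDerivAt f f' t) (hg : HasQuatDerivAt g g' t) :
    HasQuatDerivAt (fun s => f s + g s) (f' + g') t :=
  ⟨hf.1.add hg.1, hf.2.1.add hg.2.1, hf.2.2.1.add hg.2.2.1, hf.2.2.2.add hg.2.2.2⟩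

theorem neg (hf : HasQuatDerivAt f f' t) : HasQuatDerivAt (fun s => -f s) (-f') t :=
  ⟨hf.1.neg, hf.2.1.neg, hf.2.2.1.neg, hf.2.2.2.neg⟩

theorem star (hf : HasQuatDerivAt f f' t) : HasQuatDerivAt (fun s => star (f s)) (star f') t :=
  ⟨by simpa using hf.1, by simpa using hf.2.1.neg, by simpa using hf.2.2.1.neg,
    by simpa using hf.2.2.2.neg⟩

theorem mul (hf : HasQuatDerivAt f f' t) (hg : HasQuatDerivAt g g' t) :
    HasQuatDerivAt (fun s => f s * g s) (f' * g t + f t * g') t := by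
  obtain ⟨a, b, c, d⟩ := hf
  obtain ⟨a', b', c', d'⟩ := hg
  refine ⟨?_, ?_, ?_, ?_⟩
  · convert (((a.mul a').sub (b.mul b')).sub (c.mul c')).sub (d.mul d') using 1
    · simp only [Quaternion.re_mul]
    · simp only [Quaternion.re_mul, Quaternion.re_add]; ring
  · convert (((a.mul b').add (b.mul a')).add (c.mul d')).sub (d.mul c') using 1
    · simp only [Quaternion.imI_mul]
    · simp only [Quaternion.imI_mul, Quaternion.imI_add]; ring
  · convert (((a.mul c').sub (b.mul d')).add (c.mul a')).add (d.mul b') using 1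
    · simp only [Quaternion.imJ_mul]
    · simp only [Quaternion.imJ_mul, Quaternion.imJ_add]; ring
  · convert (((a.mul d').add (b.mul c')).sub (c.mul b')).add (d.mul a') using 1
    · simp only [Quaternion.imK_mul]
    · simp only [Quaternion.imK_mul, Quaternion.imK_add]; ring

theorem unique {f₁' : ℍ[PowerSeries ℝ]} (h : HasQuatDerivAt f f' t) (h₁ : HasQuatDerivAt f f₁' t) :
    f' = f₁' :=
  Quaternion.ext _ _ (h.1.unique h₁.1) (h.2.1.unique h₁.2.1) (h.2.2.1.unique h₁.2.2.1)
    (h.2.2.2.unique h₁.2.2.2)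

end HasQuatDerivAt
end

/-! ### Conjugation by a quaternion of invertible norm -/

section
open Quaternion PowerSeries

section
variable {R : Type*} [CommRing R]

/-- The conjugate `D⁻¹ Y D`, written as `r D* Y D` with `r` the inverse of the norm `D D*`. -/
def quatConj (r : R) (D Y : ℍ[R]) : ℍ[R] := r • (star D * Y * D)

theorem star_mul_self_of_mul_star {N : R} {D : ℍ[R]} (hN : D * star D = (N : ℍ[R])) :
    star D * D = (N : ℍ[R]) := by
  rw [← hN, Quaternion.self_mul_star, Quaternion.star_mul_self]

theorem mul_quatConj {N r : R} {D : ℍ[R]} (hN : D * star D = (N : ℍ[R])) (hr : N * r = 1)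
    (Y : ℍ[R]) : D * quatConj r D Y = Y * D := by
  rw [quatConj, mul_smul_comm, ← mul_assoc, ← mul_assoc, hN, mul_assoc, Quaternion.coe_mul_eq_smul,
    smul_smul, mul_comm, hr, one_smul]

theorem quat_mul_left_cancel {N r : R} {D q q' : ℍ[R]} (hN : D * star D = (N : ℍ[R]))
    (hr : N * r = 1) (h : D * q = D * q') : q = q' := by
  have h1 := congrArg (fun z => r • (star D * z)) h
  simpa only [← mul_assoc, star_mul_self_of_mul_star hN, Quaternion.coe_mul_eq_smul, smul_smul,
    mul_comm r, hr, one_smul] using h1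

theorem quatConj_mul_self {N r : R} {D : ℍ[R]} (hN : D * star D = (N : ℍ[R])) (hr : N * r = 1)
    {Y : ℍ[R]} (hY : Y * Y = -1) : quatConj r D Y * quatConj r D Y = -1 := by
  apply quat_mul_left_cancel hN hr
  rw [← mul_assoc, mul_quatConj hN hr, mul_assoc, mul_quatConj hN hr, ← mul_assoc, hY]
  simp

theorem re_quatConj {r : R} {D Y : ℍ[R]} (hY : Y.re = 0) : (quatConj r D Y).re = 0 := by
  simp [quatConj, Quaternion.re_mul, Quaternion.imI_mul, Quaternion.imJ_mul, Quaternion.imK_mul, hY]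
  ring

/-- Conjugation by the gauge transformation `D` takes solutions of the Lax equation of `T` to
solutions of the Lax equation of `T₁`. -/
theorem gauge_ode_of_mul_eq {x v N r : R} {D D' Y Y' W W' T T₁ : ℍ[R]}
    (hN : D * star D = (N : ℍ[R])) (hr : N * r = 1) (hDW : D * W = Y * D)
    (hDW' : D' * W + D * W' = Y' * D + Y * D') (hY' : (2 * x) • Y' = v • (Y * T - T * Y))
    (hD' : (2 * x) • D' = v • (D * T₁ - T * D)) :
    (2 * x) • W' = v • (W * T₁ - T₁ * W) := by
  apply quat_mul_left_cancel hN hr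
  have h1 := congrArg (fun z => (2 * x) • z) hDW'
  have h2 := congrArg (fun z => z * W) hD'
  have h3 := congrArg (fun z => z * D) hY'
  have h4 := congrArg (fun z => Y * z) hD'
  have h5 : D * W * T₁ = Y * D * T₁ := by rw [hDW]
  have h6 : T * (D * W) = T * (Y * D) := by rw [hDW]
  simp only [smul_mul_assoc, mul_smul_comm, smul_add, smul_sub, mul_sub, sub_mul,
    ← mul_assoc] at h1 h2 h3 h4 h5 h6 ⊢
  have h5' := congrArg (fun z => v • z) h5
  have h6' := congrArg (fun z => v • z) h6
  linear_combination (norm := module) h1 - h2 + h3 + h4 - h5' + h6'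

theorem gauge_ode_components [IsDomain R] [CharZero R] {x v : R} {Y Y' T : ℍ[R]}
    (h : (2 * x) • Y' = v • (Y * T - T * Y)) :
    x * Y'.imI = v * (Y.imJ * T.imK - Y.imK * T.imJ) ∧
    x * Y'.imJ = v * (Y.imK * T.imI - Y.imI * T.imK) ∧
    x * Y'.imK = v * (Y.imI * T.imJ - Y.imJ * T.imI) := by
  have two : (2 : R) ≠ 0 := two_ne_zero
  have h1 := congrArg QuaternionAlgebra.imI h
  have h2 := congrArg QuaternionAlgebra.imJ h
  have h3 := congrArg QuaternionAlgebra.imK h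
  simp [Quaternion.imI_mul, Quaternion.imJ_mul, Quaternion.imK_mul] at h1 h2 h3
  refine ⟨?_, ?_, ?_⟩ <;> apply mul_left_cancel₀ two
  · linear_combination h1
  · linear_combination h2
  · linear_combination h3

theorem sq_sum_of_mul_self {Y : ℍ[R]} (hY : Y * Y = -1) (h0 : Y.re = 0) :
    Y.imI ^ 2 + Y.imJ ^ 2 + Y.imK ^ 2 = 1 := by
  have h1 := congrArg QuaternionAlgebra.re hY
  simp [Quaternion.re_mul, h0] at h1
  linear_combination -h1

theorem mul_star_darboux {x L a b s₀ s₁ s₂ : R} {D : ℍ[R]} (h0 : D.re = 2 * L * x - a)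
    (h1 : D.imI = b * s₀) (h2 : D.imJ = b * s₁) (h3 : D.imK = b * s₂)
    (hs : s₀ ^ 2 + s₁ ^ 2 + s₂ ^ 2 = 1) :
    D * star D = (((2 * L * x - a) ^ 2 + b ^ 2 : R) : ℍ[R]) := by
  rw [Quaternion.self_mul_star, Quaternion.normSq_def', h0, h1, h2, h3]
  congr 1
  linear_combination b ^ 2 * hs

theorem IsGaugePair.ode {x v : R} {T Y T' Y' : ℍ[R]} (h : IsGaugePair x v T Y T' Y') :
    (2 * x) • Y' = v • (Y * T - T * Y) := by
  have h1 := h.ode_I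
  have h2 := h.ode_J
  have h3 := h.ode_K
  apply Quaternion.ext <;>
    simp [Quaternion.re_mul, Quaternion.imI_mul, Quaternion.imJ_mul, Quaternion.imK_mul, h.re_T,
      h.re_Y, h.re_Y'] <;> grind

end
end

/-! ### Coordinates in Euclidean three-space -/

noncomputable section

@[simp] theorem cross_apply_zero (u v : E3) : cross u v 0 = u 1 * v 2 - u 2 * v 1 := by
  simp [cross, cross_apply]

@[simp] theorem cross_apply_one (u v : E3) : cross u v 1 = u 2 * v 0 - u 0 * v 2 := by
  simp [cross, cross_apply]

@[simp] theorem cross_apply_two (u v : E3) : cross u v 2 = u 0 * v 1 - u 1 * v 0 := by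
  simp [cross, cross_apply]

theorem inner_eq (u v : E3) : inner ℝ u v = u 0 * v 0 + u 1 * v 1 + u 2 * v 2 := by
  simp [PiLp.inner_apply, Fin.sum_univ_three, mul_comm]

theorem E3.ext {u v : E3} (h0 : u 0 = v 0) (h1 : u 1 = v 1) (h2 : u 2 = v 2) : u = v := by
  ext i; fin_cases i <;> assumption

theorem norm_sq_eq (u : E3) : ‖u‖ ^ 2 = u 0 ^ 2 + u 1 ^ 2 + u 2 ^ 2 := by
  rw [← real_inner_self_eq_norm_sq, inner_eq]; ring

theorem sq_sum_eq_one {u : E3} (h : ‖u‖ = 1) : u 0 ^ 2 + u 1 ^ 2 + u 2 ^ 2 = 1 := by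
  rw [← norm_sq_eq, h, one_pow]

theorem norm_eq_one_of_sq_sum {u : E3} (h : u 0 ^ 2 + u 1 ^ 2 + u 2 ^ 2 = 1) : ‖u‖ = 1 := by
  rw [← norm_sq_eq] at h
  exact (pow_eq_one_iff_of_nonneg (norm_nonneg u) two_ne_zero).mp h

theorem hasDerivAt_E3 {f : ℝ → E3} {f' : E3} {t : ℝ} :
    HasDerivAt f f' t ↔ HasDerivAt (fun s => f s 0) (f' 0) t ∧ HasDerivAt (fun s => f s 1) (f' 1) t
        ∧
      HasDerivAt (fun s => f s 2) (f' 2) t := by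
  have h1 : HasDerivAt f f' t ↔ ∀ i, HasDerivAt (fun s => f s i) (f' i) t := by
    rw [hasDerivAt_iff_hasFDerivAt, ← hasFDerivWithinAt_univ, hasFDerivWithinAt_euclidean]
    refine forall_congr' fun i => ?_
    rw [hasFDerivWithinAt_univ, hasDerivAt_iff_hasFDerivAt]
    exact ⟨fun h => h.congr_fderiv (by ext; simp), fun h => h.congr_fderiv (by ext; simp)⟩
  rw [h1]
  exact ⟨fun h => ⟨h 0, h 1, h 2⟩, fun h i => by fin_cases i; exacts [h.1, h.2.1, h.2.2]⟩

theorem HasDerivAt.apply {f : ℝ → E3} {f' : E3} {t : ℝ} (h : HasDerivAt f f' t) (i : Fin 3) :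
    HasDerivAt (fun s => f s i) (f' i) t := by
  have := hasDerivAt_E3.mp h
  fin_cases i; exacts [this.1, this.2.1, this.2.2]

theorem HasDerivAt.cross {f g : ℝ → E3} {f' g' : E3} {t : ℝ} (hf : HasDerivAt f f' t)
    (hg : HasDerivAt g g' t) :
    HasDerivAt (fun s => cross (f s) (g s)) (cross f' (g t) + cross (f t) g') t := by
  simp only [hasDerivAt_E3, cross_apply_zero, cross_apply_one, cross_apply_two, PiLp.add_apply]
  refine ⟨?_, ?_, ?_⟩
  · exact (((hf.apply 1).fun_mul (hg.apply 2)).fun_sub ((hf.apply 2).fun_mul (hg.apply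
        1))).congr_deriv
      (by ring)
  · exact (((hf.apply 2).fun_mul (hg.apply 0)).fun_sub ((hf.apply 0).fun_mul (hg.apply
        2))).congr_deriv
      (by ring)
  · exact (((hf.apply 0).fun_mul (hg.apply 1)).fun_sub ((hf.apply 1).fun_mul (hg.apply
        0))).congr_deriv
      (by ring)

theorem ContDiff.cross {n : WithTop ℕ∞} {f g : ℝ → E3} (hf : ContDiff ℝ n f) (hg : ContDiff ℝ n g) :
    ContDiff ℝ n fun s => cross (f s) (g s) := by
  have hf := contDiff_euclidean.mp hf
  have hg := contDiff_euclidean.mp hg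
  refine contDiff_euclidean.mpr fun i => ?_
  fin_cases i
  · exact (funext fun s => cross_apply_zero (f s) (g s)) ▸ (((hf 1).mul (hg 2)).sub ((hf 2).mul (hg
        1)))
  · exact (funext fun s => cross_apply_one (f s) (g s)) ▸ (((hf 2).mul (hg 0)).sub ((hf 0).mul (hg
        2)))
  · exact (funext fun s => cross_apply_two (f s) (g s)) ▸ (((hf 0).mul (hg 1)).sub ((hf 1).mul (hg
        0)))

theorem cross_cross_self {T w : E3} (hT : ‖T‖ = 1) :
    cross T (cross w T) = w - (inner ℝ T w : ℝ) • T := by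
  have h := sq_sum_eq_one hT
  apply E3.ext <;> simp [inner_eq] <;> linear_combination (w _) * h

/-! ### The hierarchy of vector fields -/

theorem flowField_zero (γ : ℝ → E3) : flowField γ 0 = unitTangent γ := by rw [flowField]

theorem flowField_succ (γ : ℝ → E3) (k : ℕ) (t : ℝ) : flowField γ (k + 1) t =
    cross (unitTangent γ t) (arcDeriv γ (flowField γ k) t) -
        ((1 / 2 : ℝ) * ∑ i ∈ Finset.range k,
          inner ℝ (flowField γ (i + 1) t) (flowField γ (k - i) t)) • unitTangent γ t := by
  rw [flowField, Finset.sum_range]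

section Smooth
variable {γ : ℝ → E3} (hγ : ContDiff ℝ ∞ γ) (hγ' : ∀ t, deriv γ t ≠ 0)
include hγ hγ'

theorem contDiff_arcDeriv {f : ℝ → E3} (hf : ContDiff ℝ ∞ f) : ContDiff ℝ ∞ (arcDeriv γ f) := by
  have h1 : ContDiff ℝ ∞ (deriv γ) := (contDiff_infty_iff_deriv.mp hγ).2
  have h2 : ContDiff ℝ ∞ (deriv f) := (contDiff_infty_iff_deriv.mp hf).2
  exact ((h1.norm ℝ hγ').inv fun t => norm_ne_zero_iff.mpr (hγ' t)).smul h2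

theorem contDiff_unitTangent : ContDiff ℝ ∞ (unitTangent γ) := contDiff_arcDeriv hγ hγ' hγ

theorem contDiff_flowField (k : ℕ) : ContDiff ℝ ∞ (flowField γ k) := by
  induction k using Nat.strong_induction_on with
  | _ k ih =>
    cases k with
    | zero => rw [flowField_zero]; exact contDiff_unitTangent hγ hγ'
    | succ k =>
      rw [funext (flowField_succ γ k)]
      refine ((contDiff_unitTangent hγ hγ').cross
        (contDiff_arcDeriv hγ hγ' (ih k (Nat.lt_succ_self k)))).sub
        (ContDiff.smul (f := fun t => (1 / 2 : ℝ) * ∑ i ∈ Finset.range k,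
          inner ℝ (flowField γ (i + 1) t) (flowField γ (k - i) t))
          (ContDiff.mul contDiff_const (ContDiff.sum fun i hi => ?_))
          (contDiff_unitTangent hγ hγ'))
      have := Finset.mem_range.mp hi
      exact (ih _ (by omega)).inner ℝ (ih _ (by omega))

end Smooth

theorem norm_unitTangent {γ : ℝ → E3} {t : ℝ} (h : deriv γ t ≠ 0) : ‖unitTangent γ t‖ = 1 := by
  rw [unitTangent, arcDeriv, norm_smul, norm_inv, norm_norm,
    inv_mul_cancel₀ (norm_ne_zero_iff.mpr h)]

theorem deriv_eq_smul_unitTangent {γ : ℝ → E3} {t : ℝ} (h : deriv γ t ≠ 0) :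
    deriv γ t = ‖deriv γ t‖ • unitTangent γ t := by
  rw [unitTangent, arcDeriv, smul_smul, mul_inv_cancel₀ (norm_ne_zero_iff.mpr h), one_smul]

end

noncomputable section

theorem sum_inner_antidiagonal_succ (y : ℕ → E3) (k : ℕ) :
    ∑ ij ∈ Finset.HasAntidiagonal.antidiagonal (k + 1), inner ℝ (y ij.1) (y ij.2) =
      2 * inner ℝ (y 0) (y (k + 1)) + ∑ i ∈ Finset.range k, inner ℝ (y (i + 1)) (y (k - i)) := by
  rw [Finset.Nat.sum_antidiagonal_eq_sum_range_succ (fun i j => inner ℝ (y i) (y j)),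
    Finset.sum_range_succ, Finset.sum_range_succ', Nat.sub_self, Nat.sub_zero,
    real_inner_comm (y 0) (y (k + 1))]
  simp only [Nat.add_sub_add_right]
  ring

theorem inner_self_cross (T w : E3) : inner ℝ T (cross T w) = (0 : ℝ) := by
  simp [inner_eq]; ring

theorem inner_cross_antisymm (u w T : E3) : inner ℝ (cross u T) w = -(inner ℝ (cross w T) u : ℝ) :=
    by
  simp [inner_eq]; ring

theorem unitTangent_inner_flowField_succ {γ : ℝ → E3} {t : ℝ} (hγ' : deriv γ t ≠ 0) (k : ℕ) :
    inner ℝ (unitTangent γ t) (flowField γ (k + 1) t) = -((1 / 2 : ℝ) * ∑ i ∈ Finset.range k,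
          inner ℝ (flowField γ (i + 1) t) (flowField γ (k - i) t)) := by
  rw [flowField_succ, inner_sub_right, inner_self_cross, inner_smul_right,
    real_inner_self_eq_norm_sq, norm_unitTangent hγ']
  ring

/-- The generating series `∑ Y_k z ^ k` has length one. -/
theorem sum_inner_flowField {γ : ℝ → E3} {t : ℝ} (hγ' : deriv γ t ≠ 0) (n : ℕ) :
    ∑ ij ∈ Finset.HasAntidiagonal.antidiagonal n, inner ℝ (flowField γ ij.1 t) (flowField γ ij.2 t)
        =
      if n = 0 then (1 : ℝ) else 0 := by
  cases n with
  | zero =>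
    simp [flowField_zero, norm_unitTangent hγ']
  | succ k =>
    rw [sum_inner_antidiagonal_succ (fun k => flowField γ k t), flowField_zero,
      unitTangent_inner_flowField_succ hγ']
    simp

theorem cross_unitTangent_flowField_succ {γ : ℝ → E3} {t : ℝ} (hγ' : deriv γ t ≠ 0) (k : ℕ)
    (h : inner ℝ (unitTangent γ t) (arcDeriv γ (flowField γ k) t) = (0 : ℝ)) :
    cross (flowField γ (k + 1) t) (unitTangent γ t) = arcDeriv γ (flowField γ k) t := by
  have h1 := sq_sum_eq_one (norm_unitTangent hγ')
  rw [flowField_succ]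
  generalize (1 / 2 : ℝ) * ∑ i ∈ Finset.range k,
          inner ℝ (flowField γ (i + 1) t) (flowField γ (k - i) t) = c
  generalize unitTangent γ t = T at *
  generalize arcDeriv γ (flowField γ k) t = w at *
  rw [inner_eq] at h
  apply E3.ext <;> simp
  · linear_combination w 0 * h1 - T 0 * h
  · linear_combination w 1 * h1 - T 1 * h
  · linear_combination w 2 * h1 - T 2 * h

/-- The fields `Y_k` satisfy `Y_k' = Y_{k+1} × T`. This means that `Y_k'` is orthogonal to `T`,
which follows from `|∑ Y_k z ^ k|² = 1` and the equations of lower order. -/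
theorem hasDerivAt_flowField {γ : ℝ → E3} (hγ : ContDiff ℝ ∞ γ) (hγ' : ∀ t, deriv γ t ≠ 0) (k : ℕ)
    (t : ℝ) : HasDerivAt (flowField γ k)
      (‖deriv γ t‖ • cross (flowField γ (k + 1) t) (unitTangent γ t)) t := by
  induction k using Nat.strong_induction_on generalizing t with
  | _ k ih =>
    have hd : ∀ j t, HasDerivAt (flowField γ j) (deriv (flowField γ j) t) t := fun j t =>
      ((contDiff_flowField hγ hγ' j).differentiable (by simp) t).hasDerivAt
    have hsum : ∑ ij ∈ Finset.HasAntidiagonal.antidiagonal k,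
        inner ℝ (deriv (flowField γ ij.1) t) (flowField γ ij.2 t) = (0 : ℝ) := by
      have h1 : HasDerivAt (fun s => ∑ ij ∈ Finset.HasAntidiagonal.antidiagonal k,
          (inner ℝ (flowField γ ij.1 s) (flowField γ ij.2 s) : ℝ))
          (∑ ij ∈ Finset.HasAntidiagonal.antidiagonal k,
            (inner ℝ (flowField γ ij.1 t) (deriv (flowField γ ij.2) t) +
              inner ℝ (deriv (flowField γ ij.1) t) (flowField γ ij.2 t) : ℝ)) t :=
        HasDerivAt.fun_sum fun ij _ => (hd ij.1 t).inner ℝ (hd ij.2 t)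
      simp only [sum_inner_flowField (hγ' _)] at h1
      have h2 := h1.unique (hasDerivAt_const t _)
      rw [Finset.sum_add_distrib, ← Finset.Nat.sum_antidiagonal_swap] at h2
      simp only [Prod.fst_swap, Prod.snd_swap, real_inner_comm (deriv (flowField γ _) t)] at h2
      linarith
    rw [Finset.Nat.sum_antidiagonal_eq_sum_range_succ
      (fun i j => (inner ℝ (deriv (flowField γ i) t) (flowField γ j t) : ℝ)),
      Finset.sum_range_succ, Nat.sub_self] at hsum
    have hzero : ∑ i ∈ Finset.range k,
        (inner ℝ (deriv (flowField γ i) t) (flowField γ (k - i) t) : ℝ) = 0 := by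
      have h1 : ∀ i ∈ Finset.range k,
          (inner ℝ (deriv (flowField γ i) t) (flowField γ (k - i) t) : ℝ) =
          ‖deriv γ t‖ * inner ℝ (cross (flowField γ (i + 1) t) (unitTangent γ t))
            (flowField γ (k - i) t) := fun i hi => by
        rw [(ih i (Finset.mem_range.mp hi) t).deriv, real_inner_smul_left]
      rw [Finset.sum_congr rfl h1, ← Finset.mul_sum]
      -- The summands are antisymmetric under reflection of the range.
      have h2 := Finset.sum_range_reflect (fun i =>
        (inner ℝ (cross (flowField γ (i + 1) t) (unitTangent γ t)) (flowField γ (k - i) t) : ℝ)) k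
      have h3 : ∀ j ∈ Finset.range k,
          (inner ℝ (cross (flowField γ (k - 1 - j + 1) t) (unitTangent γ t))
            (flowField γ (k - (k - 1 - j)) t) : ℝ) =
          -inner ℝ (cross (flowField γ (j + 1) t) (unitTangent γ t))
            (flowField γ (k - j) t) := fun j hj => by
        have := Finset.mem_range.mp hj
        rw [inner_cross_antisymm, show k - 1 - j + 1 = k - j by omega,
          show k - (k - 1 - j) = j + 1 by omega]
      rw [Finset.sum_congr rfl h3, Finset.sum_neg_distrib] at h2
      rw [show ∑ i ∈ Finset.range k,
        (inner ℝ (cross (flowField γ (i + 1) t) (unitTangent γ t)) (flowField γ (k - i) t) : ℝ) = 0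
        by linarith, mul_zero]
    rw [hzero, zero_add, flowField_zero] at hsum
    rw [cross_unitTangent_flowField_succ (hγ' t), arcDeriv, smul_smul,
      mul_inv_cancel₀ (norm_ne_zero_iff.mpr (hγ' t)), one_smul]
    · exact hd k t
    · rw [arcDeriv, real_inner_smul_right, real_inner_comm, hsum, mul_zero]

/-- The fields `Y_k` are determined by `Y_0 = T`, by `Y_k' = Y_{k+1} × T`, which fixes the normal
part of `Y_{k+1}`, and by `|∑ Y_k z ^ k|² = 1`, which fixes its tangential part. -/
theorem eq_flowField {γ : ℝ → E3} (hγ' : ∀ t, deriv γ t ≠ 0) {W : ℕ → ℝ → E3}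
    (h0 : W 0 = unitTangent γ)
    (hsum : ∀ n t, ∑ ij ∈ Finset.HasAntidiagonal.antidiagonal n, inner ℝ (W ij.1 t) (W ij.2 t) =
      if n = 0 then (1 : ℝ) else 0)
    (hW : ∀ k t, HasDerivAt (W k) (‖deriv γ t‖ • cross (W (k + 1) t) (unitTangent γ t)) t) (k : ℕ) :
    W k = flowField γ k := by
  induction k using Nat.strong_induction_on with
  | _ k ih =>
    cases k with
    | zero => rw [h0, flowField_zero]
    | succ k =>
      funext t
      have hn := norm_ne_zero_iff.mpr (hγ' t)
      rw [flowField_succ, ← ih k (Nat.lt_succ_self k), arcDeriv, (hW k t).deriv, smul_smul,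
        inv_mul_cancel₀ hn, one_smul, cross_cross_self (norm_unitTangent (hγ' t))]
      have h1 := hsum (k + 1) t
      rw [sum_inner_antidiagonal_succ (fun k => W k t), h0, if_neg (Nat.succ_ne_zero k)] at h1
      have h2 : ∀ i ∈ Finset.range k,
          (inner ℝ (flowField γ (i + 1) t) (flowField γ (k - i) t) : ℝ) =
            inner ℝ (W (i + 1) t) (W (k - i) t) := fun i hi => by
        have := Finset.mem_range.mp hi
        rw [ih (i + 1) (by omega), ih (k - i) (by omega)]
      rw [Finset.sum_congr rfl h2, sub_sub, ← add_smul]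
      rw [show (inner ℝ (unitTangent γ t) (W (k + 1) t) +
        1 / 2 * ∑ i ∈ Finset.range k, inner ℝ (W (i + 1) t) (W (k - i) t) : ℝ) = 0 by linarith]
      simp
end

/-! ### Pairs of curves related by a Darboux transformation -/

noncomputable section

/-- The curve `η` is the Darboux transform of the immersion `γ` with parameter `a + i b`, by means
of the field `S` of unit vectors. -/
structure IsDarbouxPair (a b : ℝ) (γ η S : ℝ → E3) : Prop where
  contDiff : ContDiff ℝ ∞ γ
  deriv_ne_zero : ∀ t, deriv γ t ≠ 0
  im_ne_zero : b ≠ 0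
  norm_eq_one : ∀ t, ‖S t‖ = 1
  eq_add_smul : ∀ t, η t = γ t + (b / (a ^ 2 + b ^ 2)) • S t
  hasDerivAt : ∀ t, HasDerivAt S
      (-(2 * a) • cross (deriv γ t) (S t) - (2 * b) • cross (S t) (cross (deriv γ t) (S t))) t

/-- The rotation `w ↦ d⁻¹ w d` for the quaternion `d = -a + b S`, with `S` a unit vector. -/
def darbouxRotation (a b : ℝ) (S w : E3) : E3 :=
  (a ^ 2 + b ^ 2)⁻¹ • ((a ^ 2 - b ^ 2) • w + (2 * b ^ 2 * inner ℝ S w : ℝ) • S +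
    (2 * a * b) • cross S w)

theorem darbouxRotation_smul (a b c : ℝ) (S w : E3) :
    darbouxRotation a b S (c • w) = c • darbouxRotation a b S w := by
  apply E3.ext <;> simp [darbouxRotation, inner_eq] <;> ring

theorem inner_darbouxRotation {a b : ℝ} (hb : b ≠ 0) {S : E3} (hS : ‖S‖ = 1) (u w : E3) :
    inner ℝ (darbouxRotation a b S u) (darbouxRotation a b S w) = (inner ℝ u w : ℝ) := by
  have h := sq_sum_eq_one hS
  have hL : a ^ 2 + b ^ 2 ≠ 0 := by positivity
  have hr := inv_mul_cancel₀ hL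
  simp only [darbouxRotation, inner_eq, PiLp.smul_apply, PiLp.add_apply, cross_apply_zero,
    cross_apply_one, cross_apply_two, smul_eq_mul]
  generalize (a ^ 2 + b ^ 2)⁻¹ = r at *
  linear_combination (r ^ 2 * (4 * b ^ 4 * (S 0 * u 0 + S 1 * u 1 + S 2 * u 2) *
    (S 0 * w 0 + S 1 * w 1 + S 2 * w 2) + 4 * a ^ 2 * b ^ 2 * (u 0 * w 0 + u 1 * w 1 + u 2 * w 2)))
        * h +
    (u 0 * w 0 + u 1 * w 1 + u 2 * w 2) * (r * (a ^ 2 + b ^ 2) + 1) * hr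

theorem norm_darbouxRotation {a b : ℝ} (hb : b ≠ 0) {S : E3} (hS : ‖S‖ = 1) (w : E3) :
    ‖darbouxRotation a b S w‖ = ‖w‖ := by
  refine (sq_eq_sq₀ (norm_nonneg _) (norm_nonneg _)).mp ?_
  rw [← real_inner_self_eq_norm_sq, ← real_inner_self_eq_norm_sq, inner_darbouxRotation hb hS]

theorem cross_darbouxRotation {a b : ℝ} (hb : b ≠ 0) {S : E3} (hS : ‖S‖ = 1) (u w : E3) :
    cross (darbouxRotation a b S u) (darbouxRotation a b S w) = darbouxRotation a b S (cross u w)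
        := by
  have h := sq_sum_eq_one hS
  have hL : a ^ 2 + b ^ 2 ≠ 0 := by positivity
  have hr := inv_mul_cancel₀ hL
  apply E3.ext <;>
  simp only [darbouxRotation, inner_eq, PiLp.smul_apply, PiLp.add_apply, cross_apply_zero,
    cross_apply_one, cross_apply_two, smul_eq_mul] <;>
  generalize (a ^ 2 + b ^ 2)⁻¹ = r at *
  · linear_combination (r ^ 2 * (2 * b ^ 2) * ((a ^ 2 - b ^ 2) * (u 1 * w 2 - u 2 * w 1) +
      2 * a * b * (S 1 * (u 0 * w 1 - u 1 * w 0) - S 2 * (u 2 * w 0 - u 0 * w 2)))) * h +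
      r * ((a ^ 2 - b ^ 2) * (u 1 * w 2 - u 2 * w 1) + 2 * b ^ 2 * (S 0 * (u 1 * w 2 - u 2 * w 1) +
      S 1 * (u 2 * w 0 - u 0 * w 2) + S 2 * (u 0 * w 1 - u 1 * w 0)) * S 0 + 2 * a * b * (S 1 * (u
          0 * w 1 - u 1 * w 0) - S 2 * (u 2 * w 0 - u 0 * w 2))) * hr
  · linear_combination (r ^ 2 * (2 * b ^ 2) * ((a ^ 2 - b ^ 2) * (u 2 * w 0 - u 0 * w 2) +
      2 * a * b * (S 2 * (u 1 * w 2 - u 2 * w 1) - S 0 * (u 0 * w 1 - u 1 * w 0)))) * h +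
      r * ((a ^ 2 - b ^ 2) * (u 2 * w 0 - u 0 * w 2) + 2 * b ^ 2 * (S 0 * (u 1 * w 2 - u 2 * w 1) +
      S 1 * (u 2 * w 0 - u 0 * w 2) + S 2 * (u 0 * w 1 - u 1 * w 0)) * S 1 + 2 * a * b * (S 2 * (u
          1 * w 2 - u 2 * w 1) - S 0 * (u 0 * w 1 - u 1 * w 0))) * hr
  · linear_combination (r ^ 2 * (2 * b ^ 2) * ((a ^ 2 - b ^ 2) * (u 0 * w 1 - u 1 * w 0) +
      2 * a * b * (S 0 * (u 2 * w 0 - u 0 * w 2) - S 1 * (u 1 * w 2 - u 2 * w 1)))) * h +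
      r * ((a ^ 2 - b ^ 2) * (u 0 * w 1 - u 1 * w 0) + 2 * b ^ 2 * (S 0 * (u 1 * w 2 - u 2 * w 1) +
      S 1 * (u 2 * w 0 - u 0 * w 2) + S 2 * (u 0 * w 1 - u 1 * w 0)) * S 2 + 2 * a * b * (S 0 * (u
          2 * w 0 - u 0 * w 2) - S 1 * (u 1 * w 2 - u 2 * w 1))) * hr

namespace IsDarbouxPair
variable {a b : ℝ} {γ η S : ℝ → E3} (h : IsDarbouxPair a b γ η S)
include h

theorem contDiff_S : ContDiff ℝ ∞ S := by
  rw [contDiff_infty]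
  intro n
  induction n with
  | zero =>
    exact contDiff_zero.mpr (continuous_iff_continuousAt.mpr fun t => (h.hasDerivAt t).continuousAt)
  | succ n ih =>
    have hγ : ContDiff ℝ n (deriv γ) :=
      (contDiff_infty_iff_deriv.mp h.contDiff).2.of_le (by exact_mod_cast le_top)
    push_cast
    rw [contDiff_succ_iff_deriv]
    refine ⟨fun t => (h.hasDerivAt t).differentiableAt, by simp, ?_⟩
    rw [funext fun t => (h.hasDerivAt t).deriv]
    exact ((hγ.cross ih).const_smul _).sub ((ih.cross (hγ.cross ih)).const_smul _)

theorem contDiff_η : ContDiff ℝ ∞ η := by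
  rw [funext h.eq_add_smul]
  exact h.contDiff.add (h.contDiff_S.const_smul _)

theorem hasDerivAt_γ (t : ℝ) : HasDerivAt γ (deriv γ t) t :=
  (h.contDiff.differentiable (by simp) t).hasDerivAt

/-- A Darboux transformation rotates the velocity. -/
theorem deriv_η (t : ℝ) : deriv η t = darbouxRotation a b (S t) (deriv γ t) := by
  rw [funext h.eq_add_smul, ((h.hasDerivAt_γ t).fun_add ((h.hasDerivAt t).fun_const_smul _)).deriv]
  have hS := sq_sum_eq_one (h.norm_eq_one t)
  have hb := h.im_ne_zero
  have hr := inv_mul_cancel₀ (show a ^ 2 + b ^ 2 ≠ 0 by positivity)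
  rw [div_eq_mul_inv]
  apply E3.ext <;>
  simp only [darbouxRotation, inner_eq, PiLp.smul_apply, PiLp.add_apply, PiLp.sub_apply,
    cross_apply_zero, cross_apply_one, cross_apply_two, smul_eq_mul] <;>
  generalize (a ^ 2 + b ^ 2)⁻¹ = r at * <;>
  generalize deriv γ t = w
  · linear_combination (-w 0) * hr - 2 * b ^ 2 * r * w 0 * hS
  · linear_combination (-w 1) * hr - 2 * b ^ 2 * r * w 1 * hS
  · linear_combination (-w 2) * hr - 2 * b ^ 2 * r * w 2 * hS

theorem norm_deriv_η (t : ℝ) : ‖deriv η t‖ = ‖deriv γ t‖ := by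
  rw [h.deriv_η, norm_darbouxRotation h.im_ne_zero (h.norm_eq_one t)]

theorem deriv_η_ne_zero (t : ℝ) : deriv η t ≠ 0 := by
  rw [← norm_ne_zero_iff, h.norm_deriv_η, norm_ne_zero_iff]
  exact h.deriv_ne_zero t

theorem unitTangent_η (t : ℝ) :
    unitTangent η t = darbouxRotation a b (S t) (unitTangent γ t) := by
  rw [unitTangent, arcDeriv, unitTangent, arcDeriv, darbouxRotation_smul, h.norm_deriv_η, h.deriv_η]

/-- The Darboux relation is symmetric, up to the sign of `S`. -/
theorem symm : IsDarbouxPair a b η γ (fun t => -S t) where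
  contDiff := h.contDiff_η
  deriv_ne_zero := h.deriv_η_ne_zero
  im_ne_zero := h.im_ne_zero
  norm_eq_one t := by rw [norm_neg, h.norm_eq_one]
  eq_add_smul t := by rw [h.eq_add_smul]; simp
  hasDerivAt t := by
    refine (h.hasDerivAt t).fun_neg.congr_deriv ?_
    rw [h.deriv_η]
    have hS := sq_sum_eq_one (h.norm_eq_one t)
    have hb := h.im_ne_zero
    have hr := inv_mul_cancel₀ (show a ^ 2 + b ^ 2 ≠ 0 by positivity)
    apply E3.ext <;>
    simp only [darbouxRotation, inner_eq, PiLp.smul_apply, PiLp.add_apply, PiLp.sub_apply,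
      PiLp.neg_apply, cross_apply_zero, cross_apply_one, cross_apply_two, smul_eq_mul] <;>
    generalize (a ^ 2 + b ^ 2)⁻¹ = r at * <;>
    generalize deriv γ t = w
    · linear_combination (2 * a * (S t 1 * w 2 - S t 2 * w 1) - 2 * b * w 0 +
        2 * b * (S t 0 * w 0 + S t 1 * w 1 + S t 2 * w 2) * S t 0) * hr +
        (2 * b * w 0 - 4 * a ^ 2 * b * r * w 0 + 2 * b * r * (a ^ 2 - b ^ 2) * w 0 +
          4 * a * b ^ 2 * r * (S t 1 * w 2 - S t 2 * w 1)) * hS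
    · linear_combination (2 * a * (S t 2 * w 0 - S t 0 * w 2) - 2 * b * w 1 +
        2 * b * (S t 0 * w 0 + S t 1 * w 1 + S t 2 * w 2) * S t 1) * hr +
        (2 * b * w 1 - 4 * a ^ 2 * b * r * w 1 + 2 * b * r * (a ^ 2 - b ^ 2) * w 1 +
          4 * a * b ^ 2 * r * (S t 2 * w 0 - S t 0 * w 2)) * hS
    · linear_combination (2 * a * (S t 0 * w 1 - S t 1 * w 0) - 2 * b * w 2 +
        2 * b * (S t 0 * w 0 + S t 1 * w 1 + S t 2 * w 2) * S t 2) * hr +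
        (2 * b * w 2 - 4 * a ^ 2 * b * r * w 2 + 2 * b * r * (a ^ 2 - b ^ 2) * w 2 +
          4 * a * b ^ 2 * r * (S t 0 * w 1 - S t 1 * w 0)) * hS

end IsDarbouxPair
end

/-! ### Monodromy, area and volume -/

noncomputable section

theorem deriv_monodromy {p : ℝ} {h : E3 ≃ᵃⁱ[ℝ] E3} {γ : ℝ → E3} (hd : Differentiable ℝ γ)
    (hγ : ∀ t, γ (t + p) = h (γ t)) (t : ℝ) :
    deriv γ (t + p) = h.linearIsometryEquiv (deriv γ t) := by
  have h1 : ∀ s, γ (s + p) = h.linearIsometryEquiv (γ s) + h 0 := fun s => by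
    rw [hγ s]
    have := h.map_vadd 0 (γ s)
    simpa using this
  rw [← deriv_comp_add_const, funext h1, deriv_add_const]
  exact ((h.linearIsometryEquiv.toContinuousLinearEquiv.toContinuousLinearMap.hasFDerivAt
    (x := γ t)).comp_hasDerivAt t (hd t).hasDerivAt).deriv

theorem intervalIntegral_eq_of_hasDerivAt_sub {f g Φ : ℝ → ℝ} {x₀ p : ℝ} (hf : Continuous f)
    (hg : Continuous g) (hΦ : ∀ t, HasDerivAt Φ (f t - g t) t) (hper : Φ (x₀ + p) = Φ x₀) :
    ∫ t in x₀..(x₀ + p), f t = ∫ t in x₀..(x₀ + p), g t := by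
  rw [← sub_eq_zero, ← intervalIntegral.integral_sub (hf.intervalIntegrable _ _)
    (hg.intervalIntegrable _ _), intervalIntegral.integral_eq_sub_of_hasDerivAt (fun t _ => hΦ t)
    ((hf.sub hg).intervalIntegrable _ _), hper, sub_self]

namespace IsDarbouxPair
variable {a b : ℝ} {γ η S : ℝ → E3} (H : IsDarbouxPair a b γ η S)
include H

theorem mem_curvesWithMonodromy {p : ℝ} {h : E3 ≃ᵃⁱ[ℝ] E3} (hγ : ∀ t, γ (t + p) = h (γ t))
    (hS : ∀ t, S (t + p) = h.linearIsometryEquiv (S t)) : η ∈ curvesWithMonodromy p h := by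
  refine ⟨H.contDiff_η, H.deriv_η_ne_zero, fun t => ?_⟩
  rw [H.eq_add_smul, H.eq_add_smul, hγ, hS]
  have := h.map_vadd (γ t) ((b / (a ^ 2 + b ^ 2)) • S t)
  simp only [vadd_eq_add, map_smul] at this
  rw [add_comm (γ t), this, add_comm]

/-- The terms of the area of `η` that are not evidently exact are a multiple of `S'`. -/
theorem smul_cross_S_add (t : ℝ) :
    (2 * (b / (a ^ 2 + b ^ 2))) • cross (S t) (deriv γ t) +
      (b / (a ^ 2 + b ^ 2)) ^ 2 • cross (S t) (deriv S t) =
      (a * b / (a ^ 2 + b ^ 2) ^ 2) • deriv S t := by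
  rw [(H.hasDerivAt t).deriv]
  have hS := sq_sum_eq_one (H.norm_eq_one t)
  have hb := H.im_ne_zero
  have hr := inv_mul_cancel₀ (show a ^ 2 + b ^ 2 ≠ 0 by positivity)
  simp only [div_eq_mul_inv, ← inv_pow]
  apply E3.ext <;>
  simp only [PiLp.smul_apply, PiLp.add_apply, PiLp.sub_apply,
    cross_apply_zero, cross_apply_one, cross_apply_two, smul_eq_mul] <;>
  generalize (a ^ 2 + b ^ 2)⁻¹ = r at * <;>
  generalize deriv γ t = w at *
  · linear_combination (-(2 * b * r) * (S t 1 * w 2 - S t 2 * w 1)) * hr +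
      (-2 * b ^ 3 * r ^ 2 * (S t 1 * w 2 - S t 2 * w 1)) * hS
  · linear_combination (-(2 * b * r) * (S t 2 * w 0 - S t 0 * w 2)) * hr +
      (-2 * b ^ 3 * r ^ 2 * (S t 2 * w 0 - S t 0 * w 2)) * hS
  · linear_combination (-(2 * b * r) * (S t 0 * w 1 - S t 1 * w 0)) * hr +
      (-2 * b ^ 3 * r ^ 2 * (S t 0 * w 1 - S t 1 * w 0)) * hS

theorem deriv_η_eq_add (t : ℝ) : deriv η t = deriv γ t + (b / (a ^ 2 + b ^ 2)) • deriv S t := by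
  rw [funext H.eq_add_smul,
    ((H.hasDerivAt_γ t).fun_add ((H.hasDerivAt t).fun_const_smul _)).deriv, (H.hasDerivAt t).deriv]

/-- The area densities of `η` and `γ` differ by an exact form with a periodic primitive. -/
theorem areaFunctional_eq {p x₀ : ℝ} {h : E3 ≃ᵃⁱ[ℝ] E3} (hγ : ∀ t, γ (t + p) = h (γ t))
    (hS : ∀ t, S (t + p) = h.linearIsometryEquiv (S t))
    (hA : ∀ u v, h.linearIsometryEquiv (cross u v) =
      cross (h.linearIsometryEquiv u) (h.linearIsometryEquiv v)) {o v : E3} (hov : IsAxis h o v) :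
    areaFunctional p x₀ o v η = areaFunctional p x₀ o v γ := by
  obtain ⟨hv, hAv, s, hs⟩ := hov
  have hSd : ∀ t, HasDerivAt S (deriv S t) t := fun t => (H.hasDerivAt
      t).differentiableAt.hasDerivAt
  have hgp : ∀ t, γ (t + p) - o = h.linearIsometryEquiv (γ t - o) + s • v := fun t => by
    have := h.map_vsub (γ t) o
    simp only [vsub_eq_sub] at this
    rw [this, hγ, hs]; abel
  have hcont : ∀ f : ℝ → E3, ContDiff ℝ ∞ f →
      Continuous fun t => (inner ℝ (cross (f t - o) (deriv f t)) v : ℝ) := fun f hf =>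
    (((hf.sub contDiff_const).cross (contDiff_infty_iff_deriv.mp hf).2).continuous).inner
      continuous_const
  unfold areaFunctional
  congr 1
  refine intervalIntegral_eq_of_hasDerivAt_sub (Φ := fun t =>
    b / (a ^ 2 + b ^ 2) * inner ℝ (cross (γ t - o) (S t)) v +
      a * b / (a ^ 2 + b ^ 2) ^ 2 * inner ℝ (S t) v) (hcont η H.contDiff_η) (hcont γ H.contDiff)
    (fun t => ?_) ?_
  · have h1 := (((((H.hasDerivAt_γ t).sub_const o).cross (hSd t)).inner ℝ
      (hasDerivAt_const t v)).const_mul (b / (a ^ 2 + b ^ 2))).fun_add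
      (((hSd t).inner ℝ (hasDerivAt_const t v)).const_mul (a * b / (a ^ 2 + b ^ 2) ^ 2))
    refine h1.congr_deriv ?_
    have hk := congrArg (fun z => (inner ℝ z v : ℝ)) (H.smul_cross_S_add t)
    rw [H.deriv_η_eq_add, H.eq_add_smul]
    simp only [inner_eq, PiLp.smul_apply, PiLp.add_apply, PiLp.sub_apply, PiLp.zero_apply,
      cross_apply_zero, cross_apply_one, cross_apply_two, smul_eq_mul] at hk ⊢
    linear_combination -hk
  · have e1 : ∀ w, (inner ℝ (h.linearIsometryEquiv w) v : ℝ) = inner ℝ w v := fun w => by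
      conv_lhs => rw [← hAv]
      exact LinearIsometryEquiv.inner_map_map _ _ _
    have e2 : (inner ℝ (cross (h.linearIsometryEquiv (γ x₀ - o) + s • v)
        (h.linearIsometryEquiv (S x₀))) v : ℝ) = inner ℝ (cross (γ x₀ - o) (S x₀)) v := by
      rw [← e1 (cross (γ x₀ - o) (S x₀)), hA]
      simp only [inner_eq, PiLp.smul_apply, PiLp.add_apply,
        cross_apply_zero, cross_apply_one, cross_apply_two, smul_eq_mul]
      ring
    rw [hgp, hS, e1, e2]

set_option maxRecDepth 4000 in
/-- The volume densities of `η` and `γ` differ by an exact form. Its primitive is periodic as `h`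
preserves the distance from the axis and the component along `v` of all difference vectors. -/
theorem volumeFunctional_eq {p x₀ : ℝ} {h : E3 ≃ᵃⁱ[ℝ] E3} (hγ : ∀ t, γ (t + p) = h (γ t))
    (hS : ∀ t, S (t + p) = h.linearIsometryEquiv (S t))
    (hA : ∀ u v, h.linearIsometryEquiv (cross u v) =
      cross (h.linearIsometryEquiv u) (h.linearIsometryEquiv v)) {o v : E3} (hov : IsAxis h o v) :
    volumeFunctional p x₀ o v η = volumeFunctional p x₀ o v γ := by
  obtain ⟨hv, hAv, s, hs⟩ := hov
  have hSd : ∀ t, HasDerivAt S (deriv S t) t := fun t => (H.hasDerivAt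
      t).differentiableAt.hasDerivAt
  have hgp : ∀ t, γ (t + p) - o = h.linearIsometryEquiv (γ t - o) + s • v := fun t => by
    have := h.map_vsub (γ t) o
    simp only [vsub_eq_sub] at this
    rw [this, hγ, hs]; abel
  have hperp : ∀ x : E3, ‖x - (inner ℝ x v : ℝ) • v‖ ^ 2 = inner ℝ x x - inner ℝ x v ^ 2 := fun x
      => by
    have := sq_sum_eq_one hv
    simp only [norm_sq_eq, inner_eq, PiLp.smul_apply, PiLp.sub_apply, smul_eq_mul]
    linear_combination (x 0 * v 0 + x 1 * v 1 + x 2 * v 2) ^ 2 * this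
  have hcont : ∀ f : ℝ → E3, ContDiff ℝ ∞ f →
      Continuous fun t => ((inner ℝ (f t - o) (f t - o) - inner ℝ (f t - o) v ^ 2) *
        inner ℝ (deriv f t) v : ℝ) := fun f hf => by
    have h1 := hf.continuous
    have h2 := (contDiff_infty_iff_deriv.mp hf).2.continuous
    fun_prop
  unfold volumeFunctional
  simp only [hperp]
  congr 1
  refine intervalIntegral_eq_of_hasDerivAt_sub (Φ := fun t =>
    b / (a ^ 2 + b ^ 2) * (inner ℝ (γ t - o) (γ t - o) - inner ℝ (γ t - o) v ^ 2) * inner ℝ (S t) v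
        +
    (b / (a ^ 2 + b ^ 2)) ^ 2 * (inner ℝ (γ t - o) (S t) - inner ℝ (γ t - o) v * inner ℝ (S t) v) *
      inner ℝ (S t) v -
    a * b / (a ^ 2 + b ^ 2) ^ 2 * inner ℝ (cross v (γ t - o)) (S t) +
    (b / (a ^ 2 + b ^ 2)) ^ 3 * (inner ℝ (S t) v - inner ℝ (S t) v ^ 3 / 3) -
    b / (2 * (a ^ 2 + b ^ 2) ^ 2) * inner ℝ (S t) v) (hcont η H.contDiff_η) (hcont γ H.contDiff)
    (fun t => ?_) ?_
  · have hg := (H.hasDerivAt_γ t).sub_const o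
    have hv' := hasDerivAt_const t v
    have hσ := (hSd t).inner ℝ hv'
    have hH := hg.inner ℝ hv'
    have h1 := ((((((hg.inner ℝ hg).fun_sub (hH.fun_pow 2)).const_mul (b / (a ^ 2 + b ^
        2))).fun_mul hσ).fun_add
      (((((hg.inner ℝ (hSd t)).fun_sub (hH.fun_mul hσ)).const_mul
        ((b / (a ^ 2 + b ^ 2)) ^ 2)).fun_mul hσ))).fun_sub
      (((hv'.cross hg).inner ℝ (hSd t)).const_mul (a * b / (a ^ 2 + b ^ 2) ^ 2))).fun_add
      ((hσ.fun_sub ((hσ.fun_pow 3).div_const 3)).const_mul ((b / (a ^ 2 + b ^ 2)) ^ 3))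
    have h2 := h1.fun_sub (hσ.const_mul (b / (2 * (a ^ 2 + b ^ 2) ^ 2)))
    refine h2.congr_deriv ?_
    have hk := congrArg (fun z => (inner ℝ (cross v (γ t - o)) z : ℝ)) (H.smul_cross_S_add t)
    have hz := congrArg (fun z => (inner ℝ v z : ℝ)) (H.hasDerivAt t).deriv
    have hn := sq_sum_eq_one (H.norm_eq_one t)
    rw [H.deriv_η_eq_add, H.eq_add_smul, add_sub_right_comm (γ t)]
    generalize γ t - o = g at *
    generalize deriv S t = z at *
    generalize deriv γ t = w at *
    generalize S t = S₀ at *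
    have hc1 : b / (2 * (a ^ 2 + b ^ 2) ^ 2) = b * (a ^ 2 + b ^ 2)⁻¹ ^ 2 / 2 := by
      rw [inv_pow]; field_simp
    have hc2 : a * b / (a ^ 2 + b ^ 2) ^ 2 = a * b * (a ^ 2 + b ^ 2)⁻¹ ^ 2 := by
      rw [inv_pow, div_eq_mul_inv]
    rw [hc2, div_eq_mul_inv b (a ^ 2 + b ^ 2)] at hk
    rw [hc1, hc2, div_eq_mul_inv b (a ^ 2 + b ^ 2)]
    generalize (a ^ 2 + b ^ 2)⁻¹ = r at *
    simp only [inner_eq, PiLp.smul_apply, PiLp.add_apply, PiLp.sub_apply, PiLp.zero_apply,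
      cross_apply_zero, cross_apply_one, cross_apply_two, smul_eq_mul, Nat.cast_ofNat,
      Nat.add_one_sub_one, pow_one] at hk hz ⊢
    linear_combination hk - (b * r ^ 2 / 2) * hz - ((b * r) ^ 2 * (w 0 * v 0 + w 1 * v 1 + w 2 * v
        2 +
      b * r * (z 0 * v 0 + z 1 * v 1 + z 2 * v 2))) * hn +
      (b ^ 2 * r ^ 2 * (w 0 * v 0 + w 1 * v 1 + w 2 * v 2)) * hn
  · have e0 : ∀ u w, (inner ℝ (h.linearIsometryEquiv u) (h.linearIsometryEquiv w) : ℝ) =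
        inner ℝ u w := fun u w => LinearIsometryEquiv.inner_map_map _ _ _
    have e1 : ∀ w, (inner ℝ (h.linearIsometryEquiv w) v : ℝ) = inner ℝ w v := fun w => by
      conv_lhs => rw [← hAv]
      exact e0 _ _
    have e2 : ∀ w, (inner ℝ v (h.linearIsometryEquiv w) : ℝ) = inner ℝ v w := fun w => by
      rw [real_inner_comm, e1, real_inner_comm]
    have e3 : cross v (h.linearIsometryEquiv (γ x₀ - o) + s • v) =
        h.linearIsometryEquiv (cross v (γ x₀ - o)) := by
      rw [hA, hAv]
      apply E3.ext <;> simp <;> ring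
    have e4 : (inner ℝ v v : ℝ) = 1 := by rw [real_inner_self_eq_norm_sq, hv, one_pow]
    simp only [hgp, hS, e3, inner_add_left, inner_add_right, real_inner_smul_left,
      real_inner_smul_right, e0, e1, e2, e4, real_inner_comm v]
    ring
end IsDarbouxPair
end

/-! ### Total torsion and length -/

noncomputable section

theorem map_darbouxRotation {A : E3 ≃ₗᵢ[ℝ] E3} (hA : ∀ u v, A (cross u v) = cross (A u) (A v))
    (a b : ℝ) (S w : E3) : A (darbouxRotation a b S w) = darbouxRotation a b (A S) (A w) := by
  simp only [darbouxRotation, map_add, map_smul, hA, LinearIsometryEquiv.inner_map_map]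

theorem darbouxRotation_add (a b : ℝ) (S u w : E3) :
    darbouxRotation a b S (u + w) = darbouxRotation a b S u + darbouxRotation a b S w := by
  apply E3.ext <;> simp [darbouxRotation, inner_eq] <;> ring

namespace IsDarbouxPair
variable {a b : ℝ} {γ η S : ℝ → E3} (H : IsDarbouxPair a b γ η S)
include H

/-- The rotation that takes `T` to the tangent of `η` takes parallel normal fields along `γ` to
parallel normal fields along `η`. -/
theorem isParallelUnitNormal {ξ : ℝ → E3} (hξ : IsParallelUnitNormal γ ξ) :
    IsParallelUnitNormal η fun t => darbouxRotation a b (S t) (ξ t) := by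
  obtain ⟨hc, hn, ho, hp⟩ := hξ
  have hSs := H.contDiff_S
  refine ⟨?_, fun t => ?_, fun t => ?_, fun t => ?_⟩
  · exact (((hc.const_smul (a ^ 2 - b ^ 2)).add ((contDiff_const.mul (hSs.inner ℝ hc)).smul
        hSs)).add
      ((hSs.cross hc).const_smul (2 * a * b))).const_smul _
  · rw [norm_darbouxRotation H.im_ne_zero (H.norm_eq_one t), hn]
  · rw [H.deriv_η, inner_darbouxRotation H.im_ne_zero (H.norm_eq_one t), ho]
  · obtain ⟨c, hc'⟩ := hp t
    have hξd : HasDerivAt ξ (c • unitTangent γ t) t := by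
      rw [← hc']; exact (hc.differentiable (by simp) t).hasDerivAt
    have hSd := H.hasDerivAt t
    have hd := ((((hξd.fun_const_smul (a ^ 2 - b ^ 2)).fun_add
      (((hSd.inner ℝ hξd).const_mul (2 * b ^ 2)).fun_smul hSd)).fun_add
      ((hSd.cross hξd).fun_const_smul (2 * a * b))).fun_const_smul ((a ^ 2 + b ^ 2)⁻¹))
    refine ⟨c + 4 * b * inner ℝ (ξ t) (S t) * ‖deriv γ t‖, ?_⟩
    refine hd.deriv.trans ?_
    have ho' := ho t
    rw [H.unitTangent_η]
    rw [deriv_eq_smul_unitTangent (H.deriv_ne_zero t)] at ho' ⊢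
    rw [real_inner_smul_right] at ho'
    have ho' := (mul_eq_zero.mp ho').resolve_left (norm_ne_zero_iff.mpr (H.deriv_ne_zero t))
    rw [inner_eq] at ho'
    rw [norm_smul, norm_norm, norm_unitTangent (H.deriv_ne_zero t), mul_one]
    generalize ‖deriv γ t‖ = v
    generalize unitTangent γ t = T at *
    have hS := sq_sum_eq_one (H.norm_eq_one t)
    generalize S t = S₀ at *
    generalize ξ t = x at *
    have hb := H.im_ne_zero
    have hr := inv_mul_cancel₀ (show a ^ 2 + b ^ 2 ≠ 0 by positivity)
    apply E3.ext <;>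
    simp only [darbouxRotation, inner_eq, PiLp.smul_apply, PiLp.add_apply, PiLp.sub_apply,
      cross_apply_zero, cross_apply_one, cross_apply_two, smul_eq_mul]  <;>
    generalize (a ^ 2 + b ^ 2)⁻¹ = r at *
    · linear_combination (-(4 * r * v * b ^ 3 * (S₀ 0 * x 0 + S₀ 1 * x 1 + S₀ 2 * x 2) * T 0)) * hS
          -
        (r * v * (4 * b ^ 3 * (S₀ 0 ^ 2 + S₀ 1 ^ 2 + S₀ 2 ^ 2) + 4 * a ^ 2 * b) * S₀ 0) * ho'
    · linear_combination (-(4 * r * v * b ^ 3 * (S₀ 0 * x 0 + S₀ 1 * x 1 + S₀ 2 * x 2) * T 1)) * hS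
          -
        (r * v * (4 * b ^ 3 * (S₀ 0 ^ 2 + S₀ 1 ^ 2 + S₀ 2 ^ 2) + 4 * a ^ 2 * b) * S₀ 1) * ho'
    · linear_combination (-(4 * r * v * b ^ 3 * (S₀ 0 * x 0 + S₀ 1 * x 1 + S₀ 2 * x 2) * T 2)) * hS
          -
        (r * v * (4 * b ^ 3 * (S₀ 0 ^ 2 + S₀ 1 ^ 2 + S₀ 2 ^ 2) + 4 * a ^ 2 * b) * S₀ 2) * ho'

theorem isTotalTorsion {p x₀ : ℝ} {h : E3 ≃ᵃⁱ[ℝ] E3}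
    (hS : ∀ t, S (t + p) = h.linearIsometryEquiv (S t))
    (hA : ∀ u v, h.linearIsometryEquiv (cross u v) =
      cross (h.linearIsometryEquiv u) (h.linearIsometryEquiv v)) {α : Real.Angle}
    (hα : IsTotalTorsion p x₀ h γ α) : IsTotalTorsion p x₀ h η α := by
  obtain ⟨ξ, hξ, hm⟩ := hα
  refine ⟨_, H.isParallelUnitNormal hξ, ?_⟩
  rw [map_darbouxRotation hA, ← hS, hm, darbouxRotation_add, darbouxRotation_smul,
    darbouxRotation_smul, H.unitTangent_η,
    cross_darbouxRotation H.im_ne_zero (H.norm_eq_one _)]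

/-- By symmetry of the Darboux relation, `γ` and `η` have the same total torsions. Only this
equivalence is needed for the angle chosen by `totalTorsion`. -/
theorem totalTorsion_eq {p x₀ : ℝ} {h : E3 ≃ᵃⁱ[ℝ] E3}
    (hS : ∀ t, S (t + p) = h.linearIsometryEquiv (S t))
    (hA : ∀ u v, h.linearIsometryEquiv (cross u v) =
      cross (h.linearIsometryEquiv u) (h.linearIsometryEquiv v)) :
    totalTorsion p x₀ h η = totalTorsion p x₀ h γ := by
  have : IsTotalTorsion p x₀ h η = IsTotalTorsion p x₀ h γ := by
    funext α
    exact propext ⟨H.symm.isTotalTorsion (fun t => by rw [hS, map_neg]) hA, H.isTotalTorsion hS hA⟩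
  rw [totalTorsion, totalTorsion, this]

theorem lengthFunctional_eq (p x₀ : ℝ) : lengthFunctional p x₀ η = lengthFunctional p x₀ γ := by
  simp only [lengthFunctional, H.norm_deriv_η]

end IsDarbouxPair
end

/-! ### The generating series of the hierarchy -/

noncomputable section
open Quaternion PowerSeries

/-- The power series `∑ y_k X ^ k` of vectors, as an imaginary quaternion over `ℝ⟦X⟧`. -/
def vecSeries (y : ℕ → E3) : ℍ[PowerSeries ℝ] :=
  ⟨0, PowerSeries.mk fun k => y k 0, PowerSeries.mk fun k => y k 1, PowerSeries.mk fun k => y k 2⟩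

/-- A vector as an imaginary quaternion over `ℝ⟦X⟧` with constant coefficients. -/
def constVec (w : E3) : ℍ[PowerSeries ℝ] := ⟨0, C (w 0), C (w 1), C (w 2)⟩

section
variable (y : ℕ → E3) (w : E3)
@[simp] theorem vecSeries_re : (vecSeries y).re = 0 := rfl
@[simp] theorem vecSeries_imI : (vecSeries y).imI = PowerSeries.mk fun k => y k 0 := rfl
@[simp] theorem vecSeries_imJ : (vecSeries y).imJ = PowerSeries.mk fun k => y k 1 := rfl
@[simp] theorem vecSeries_imK : (vecSeries y).imK = PowerSeries.mk fun k => y k 2 := rfl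
@[simp] theorem constVec_re : (constVec w).re = 0 := rfl
@[simp] theorem constVec_imI : (constVec w).imI = C (w 0) := rfl
@[simp] theorem constVec_imJ : (constVec w).imJ = C (w 1) := rfl
@[simp] theorem constVec_imK : (constVec w).imK = C (w 2) := rfl
end

theorem HasFormalDerivAt.C {f : ℝ → ℝ} {f' t : ℝ} (hf : HasDerivAt f f' t) :
    HasFormalDerivAt (fun s => C (f s)) (C f') t := fun n => by
  simp only [coeff_C]
  split_ifs
  · exact hf
  · exact hasDerivAt_const _ _

theorem hasQuatDerivAt_constVec {f : ℝ → E3} {f' : E3} {t : ℝ} (hf : HasDerivAt f f' t) :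
    HasQuatDerivAt (fun s => constVec (f s)) (constVec f') t :=
  ⟨.const 0 t, .C (hf.apply 0), .C (hf.apply 1), .C (hf.apply 2)⟩

theorem hasQuatDerivAt_vecSeries {y : ℕ → ℝ → E3} {y' : ℕ → E3} {t : ℝ}
    (hy : ∀ k, HasDerivAt (y k) (y' k) t) :
    HasQuatDerivAt (fun s => vecSeries fun k => y k s) (vecSeries y') t :=
  ⟨.const 0 t, fun k => by simpa using (hy k).apply 0, fun k => by simpa using (hy k).apply 1,
    fun k => by simpa using (hy k).apply 2⟩

theorem imI_constVec_mul (u w : E3) : (constVec u * constVec w).imI = C (cross u w 0) := by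
  simp [Quaternion.imI_mul]

theorem imJ_constVec_mul (u w : E3) : (constVec u * constVec w).imJ = C (cross u w 1) := by
  simp [Quaternion.imJ_mul]; ring

theorem imK_constVec_mul (u w : E3) : (constVec u * constVec w).imK = C (cross u w 2) := by
  simp [Quaternion.imK_mul]

/-- A series `∑ y_k X ^ k` of length one, in terms of its components. -/
theorem sq_sum_vecSeries {y : ℕ → E3} (hy : ∀ n, ∑ ij ∈ Finset.HasAntidiagonal.antidiagonal n,
      inner ℝ (y ij.1) (y ij.2) = if n = 0 then (1 : ℝ) else 0) :
    (vecSeries y).imI ^ 2 + (vecSeries y).imJ ^ 2 + (vecSeries y).imK ^ 2 = 1 := by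
  ext n
  simp only [vecSeries_imI, vecSeries_imJ, vecSeries_imK, pow_two, map_add, coeff_mul, coeff_mk,
    ← Finset.sum_add_distrib, coeff_one, ← hy n, inner_eq]

theorem X_mul_mk_eq {f f' : ℕ → ℝ} (h0 : f 0 = 0) (h : ∀ k, f' k = f (k + 1)) :
    (X : PowerSeries ℝ) * PowerSeries.mk f' = PowerSeries.mk f := by
  ext n
  cases n with
  | zero => simp [h0]
  | succ n => rw [coeff_succ_X_mul, coeff_mk, coeff_mk, h]

section Curve
variable {γ : ℝ → E3} (hγ : ContDiff ℝ ∞ γ) (hγ' : ∀ t, deriv γ t ≠ 0)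
include hγ hγ'

theorem hasDerivAt_unitTangent (t : ℝ) :
    HasDerivAt (unitTangent γ) (deriv (unitTangent γ) t) t :=
  ((contDiff_unitTangent hγ hγ').differentiable (by simp) t).hasDerivAt

/-- The generating series of the fields `Y_k` solves the Lax equation `X Y' = Y × T`, multiplied by
the speed. -/
theorem isGaugePair_flowField (t : ℝ) :
    IsGaugePair (X : PowerSeries ℝ) (C ‖deriv γ t‖) (constVec (unitTangent γ t))
      (vecSeries fun k => flowField γ k t) (constVec (deriv (unitTangent γ) t))
      (vecSeries fun k => ‖deriv γ t‖ • cross (flowField γ (k + 1) t) (unitTangent γ t)) where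
  re_T := rfl
  re_Y := rfl
  re_T' := rfl
  re_Y' := rfl
  sq_T := by
    simp only [constVec_imI, constVec_imJ, constVec_imK, ← map_pow, ← map_add,
      sq_sum_eq_one (norm_unitTangent (hγ' t)), map_one]
  sq_Y := sq_sum_vecSeries (sum_inner_flowField (hγ' t))
  orth := by
    have h1 := (hasDerivAt_unitTangent hγ hγ' t).inner ℝ (hasDerivAt_unitTangent hγ hγ' t)
    have h2 : (fun t => (inner ℝ (unitTangent γ t) (unitTangent γ t) : ℝ)) = fun _ => 1 := by
      funext s; rw [real_inner_self_eq_norm_sq, norm_unitTangent (hγ' s), one_pow]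
    rw [h2] at h1
    have h3 := h1.unique (hasDerivAt_const t 1)
    rw [inner_eq, inner_eq] at h3
    simp only [constVec_imI, constVec_imJ, constVec_imK, ← map_mul, ← map_add]
    rw [← map_zero C]
    congr 1
    linarith
  ode_I := by
    rw [vecSeries_imI, X_mul_mk_eq (f := fun k => ‖deriv γ t‖ * (flowField γ k t 1 * unitTangent γ
        t 2 -
      flowField γ k t 2 * unitTangent γ t 1)) (by simp only [flowField_zero]; ring) (by simp)]
    ext n; simp
  ode_J := by
    rw [vecSeries_imJ, X_mul_mk_eq (f := fun k => ‖deriv γ t‖ * (flowField γ k t 2 * unitTangent γ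
        t 0 -
      flowField γ k t 0 * unitTangent γ t 2)) (by simp only [flowField_zero]; ring) (by simp)]
    ext n; simp
  ode_K := by
    rw [vecSeries_imK, X_mul_mk_eq (f := fun k => ‖deriv γ t‖ * (flowField γ k t 0 * unitTangent γ
        t 1 -
      flowField γ k t 1 * unitTangent γ t 0)) (by simp only [flowField_zero]; ring) (by simp)]
    ext n; simp

omit hγ in
theorem unitTangent_inner_flowField_one (t : ℝ) :
    inner ℝ (unitTangent γ t) (flowField γ 1 t) = (0 : ℝ) := by
  rw [unitTangent_inner_flowField_succ (hγ' t) 0]; simp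

omit hγ in
/-- The density of the higher Hamiltonians, up to the factor `2`, is the connection form `e / n`
that the gauge transformation `1 - Y T` produces along `T`. -/
theorem hamiltonianDensity_mul_speed (t : ℝ) {n e : PowerSeries ℝ}
    (hn : n = 2 - 2 * (constVec (unitTangent γ t) * vecSeries fun k => flowField γ k t).re)
    (he : e = ((vecSeries fun k => flowField γ k t) *
      (constVec (deriv (unitTangent γ) t) * constVec (unitTangent γ t))).re) :
    hamiltonianDensity γ t * C ‖deriv γ t‖ = 2 * (e * n⁻¹) ∧ constantCoeff n = 4 := by
  have h01 := unitTangent_inner_flowField_one hγ' t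
  have hTT : (inner ℝ (unitTangent γ t) (unitTangent γ t) : ℝ) = 1 := by
    rw [real_inner_self_eq_norm_sq, norm_unitTangent (hγ' t), one_pow]
  have hn' : n = PowerSeries.mk fun k => (if k = 0 then 2 else 0) +
      2 * (inner ℝ (unitTangent γ t) (flowField γ k t) : ℝ) := by
    rw [hn]
    ext k
    have h2 : (2 : PowerSeries ℝ) = C 2 := (map_ofNat C 2).symm
    rw [h2]
    simp [Quaternion.re_mul, inner_eq, coeff_C]
    ring
  have h1 : PowerSeries.mk (fun i => if 1 ≤ i then
      (inner ℝ (flowField γ i t) (flowField γ 1 t) : ℝ) else 0) * C ‖deriv γ t‖ = e := by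
    rw [he]
    ext k
    have hY1 : flowField γ 1 t = cross (unitTangent γ t) (arcDeriv γ (unitTangent γ) t) := by
      rw [flowField_succ, flowField_zero]; simp
    have hi : (if 1 ≤ k then (inner ℝ (flowField γ k t) (flowField γ 1 t) : ℝ) else 0) =
        inner ℝ (flowField γ k t) (flowField γ 1 t) := by
      split_ifs with hk
      · rfl
      · rw [show k = 0 by omega, flowField_zero, h01]
    have hT' : deriv (unitTangent γ) t = ‖deriv γ t‖ • arcDeriv γ (unitTangent γ) t := by
      rw [arcDeriv, smul_smul, mul_inv_cancel₀ (norm_ne_zero_iff.mpr (hγ' t)), one_smul]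
    rw [coeff_mul_C, coeff_mk, hi, hY1, hT']
    rw [Quaternion.re_mul, imI_constVec_mul, imJ_constVec_mul, imK_constVec_mul]
    rw [vecSeries_re, vecSeries_imI, vecSeries_imJ, vecSeries_imK, map_sub, map_sub, map_sub,
      coeff_mul_C, coeff_mul_C, coeff_mul_C]
    simp only [zero_mul, map_zero, coeff_mk, inner_eq, cross_apply_zero, cross_apply_one,
        cross_apply_two,
      PiLp.smul_apply, smul_eq_mul]
    ring
  have h2 : (1 + PowerSeries.mk (fun l =>
      if 2 ≤ l then (1 / 2 : ℝ) * inner ℝ (unitTangent γ t) (flowField γ l t) else 0)) =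
      C (1 / 4 : ℝ) * n := by
    rw [hn']
    ext k
    rw [map_add, coeff_C_mul, coeff_mk, coeff_mk, coeff_one]
    match k with
    | 0 => simp [flowField_zero, norm_unitTangent (hγ' t)]; norm_num
    | 1 => simp [h01]
    | k + 2 => simp; ring
  have hn0 : constantCoeff n = 4 := by
    rw [hn', ← coeff_zero_eq_constantCoeff_apply, coeff_mk, flowField_zero, hTT]
    norm_num
  refine ⟨?_, hn0⟩
  have hnn : n * n⁻¹ = 1 := PowerSeries.mul_inv_cancel _ (by rw [hn0]; norm_num)
  have h44 : (C (1 / 4 : ℝ) * n)⁻¹ = C 4 * n⁻¹ := by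
    rw [PowerSeries.inv_eq_iff_mul_eq_one]
    · have : (C (4 : ℝ) : PowerSeries ℝ) * C (1 / 4) = 1 := by rw [← map_mul]; norm_num
      linear_combination this + C (4 : ℝ) * C (1 / 4) * hnn
    · simp [hn0]
  have h42 : (C (1 / 2 : ℝ) : PowerSeries ℝ) * C 4 = 2 := by
    rw [← map_mul, ← map_ofNat C 2]; norm_num
  rw [hamiltonianDensity, h2, h44]
  linear_combination (C (1 / 2 : ℝ) * C 4 * n⁻¹) * h1 + (e * n⁻¹) * h42

theorem continuous_coeff_hamiltonianDensity (m : ℕ) :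
    Continuous fun t => coeff m (hamiltonianDensity γ t) := by
  have hY := fun k => (contDiff_flowField hγ hγ' k).continuous
  have hT := (contDiff_unitTangent hγ hγ').continuous
  refine continuous_coeff_mul (continuous_coeff_mul (fun _ => continuous_const) fun k => ?_)
    (continuous_coeff_inv (fun k => ?_) fun t => ?_) m
  · simp only [coeff_mk]
    split_ifs
    · exact (hY _).inner (hY _)
    · exact continuous_const
  · simp only [map_add, coeff_mk]
    refine continuous_const.add ?_
    split_ifs
    · exact continuous_const.mul (hT.inner (hY _))
    · exact continuous_const
  · rw [← coeff_zero_eq_constantCoeff_apply, map_add, coeff_mk]; simp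

end Curve
end

/-! ### The Darboux transformation of the generating series -/

noncomputable section
open Quaternion PowerSeries

/-- The constant term of a quaternion over `ℝ⟦X⟧`. -/
def quatConstCoeff (q : ℍ[PowerSeries ℝ]) : ℍ[ℝ] :=
  ⟨constantCoeff q.re, constantCoeff q.imI, constantCoeff q.imJ, constantCoeff q.imK⟩

section
variable (q : ℍ[PowerSeries ℝ])
@[simp] theorem quatConstCoeff_re : (quatConstCoeff q).re = constantCoeff q.re := rfl
@[simp] theorem quatConstCoeff_imI : (quatConstCoeff q).imI = constantCoeff q.imI := rfl
@[simp] theorem quatConstCoeff_imJ : (quatConstCoeff q).imJ = constantCoeff q.imJ := rfl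
@[simp] theorem quatConstCoeff_imK : (quatConstCoeff q).imK = constantCoeff q.imK := rfl
end

theorem quatConstCoeff_mul (q r : ℍ[PowerSeries ℝ]) :
    quatConstCoeff (q * r) = quatConstCoeff q * quatConstCoeff r := by
  apply Quaternion.ext <;>
    simp [Quaternion.re_mul, Quaternion.imI_mul, Quaternion.imJ_mul, Quaternion.imK_mul]

theorem quatConstCoeff_star (q : ℍ[PowerSeries ℝ]) :
    quatConstCoeff (star q) = star (quatConstCoeff q) := by
  apply Quaternion.ext <;> simp

/-- The quaternion `d = -a + b S`, with constant coefficients. -/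
def darbouxQuat (a b : ℝ) (S : E3) : ℍ[PowerSeries ℝ] :=
  ⟨C (-a), C (b * S 0), C (b * S 1), C (b * S 2)⟩

section
variable (a b : ℝ) (S : E3)
@[simp] theorem darbouxQuat_re : (darbouxQuat a b S).re = C (-a) := rfl
@[simp] theorem darbouxQuat_imI : (darbouxQuat a b S).imI = C (b * S 0) := rfl
@[simp] theorem darbouxQuat_imJ : (darbouxQuat a b S).imJ = C (b * S 1) := rfl
@[simp] theorem darbouxQuat_imK : (darbouxQuat a b S).imK = C (b * S 2) := rfl
end

/-- The Darboux matrix `D = 2 (a² + b²) X + d`, as a polynomial in the inverse spectral parameter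
`X`. -/
def darbouxSeries (a b : ℝ) (S : E3) : ℍ[PowerSeries ℝ] :=
  (2 * C (a ^ 2 + b ^ 2) * X : PowerSeries ℝ) • (1 : ℍ[PowerSeries ℝ]) + darbouxQuat a b S

/-- The norm `D D*` of the Darboux matrix. It does not depend on the direction of `S`. -/
def darbouxNorm (a b : ℝ) : PowerSeries ℝ := (2 * C (a ^ 2 + b ^ 2) * X - C a) ^ 2 + C b ^ 2

theorem constantCoeff_darbouxNorm (a b : ℝ) : constantCoeff (darbouxNorm a b) = a ^ 2 + b ^ 2 := by
  simp [darbouxNorm]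

section
variable {a b : ℝ} {S : E3}

theorem C_sq_sum (hS : ‖S‖ = 1) :
    (C (S 0) : PowerSeries ℝ) ^ 2 + C (S 1) ^ 2 + C (S 2) ^ 2 = 1 := by
  rw [← map_pow, ← map_pow, ← map_pow, ← map_add, ← map_add, sq_sum_eq_one hS, map_one]

theorem darbouxSeries_mul_star (hS : ‖S‖ = 1) :
    darbouxSeries a b S * star (darbouxSeries a b S) = (darbouxNorm a b : ℍ[PowerSeries ℝ]) :=
  mul_star_darboux (by simp [darbouxSeries, sub_eq_add_neg]) (by simp [darbouxSeries])
    (by simp [darbouxSeries]) (by simp [darbouxSeries]) (C_sq_sum hS)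

theorem darbouxNorm_mul_inv (hb : b ≠ 0) : darbouxNorm a b * (darbouxNorm a b)⁻¹ = 1 :=
  PowerSeries.mul_inv_cancel _ (by rw [constantCoeff_darbouxNorm]; positivity)

end

instance : CharZero (PowerSeries ℝ) :=
  ⟨fun m n h => by simpa using congrArg (constantCoeff (R := ℝ)) h⟩

/-- The generating series of the fields `Y_k` is the only imaginary unit series with constant term
`T` that solves the Lax equation. -/
theorem eq_vecSeries_flowField {γ : ℝ → E3} (hγ' : ∀ t, deriv γ t ≠ 0) {W : ℝ → ℍ[PowerSeries ℝ]}
    (hre : ∀ t, (W t).re = 0) (hsq : ∀ t, W t * W t = -1)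
    (hode : ∀ t, ∃ W', HasQuatDerivAt W W' t ∧ (2 * X : PowerSeries ℝ) • W' =
      (C ‖deriv γ t‖ : PowerSeries ℝ) • (W t * constVec (unitTangent γ t) -
        constVec (unitTangent γ t) * W t))
    (h0 : ∀ t, quatConstCoeff (W t) = ⟨0, unitTangent γ t 0, unitTangent γ t 1, unitTangent γ t 2⟩)
    (t : ℝ) : W t = vecSeries fun k => flowField γ k t := by
  let w : ℕ → ℝ → E3 := fun k t =>
    !₂[coeff k (W t).imI, coeff k (W t).imJ, coeff k (W t).imK]
  have hw : ∀ t, W t = vecSeries fun k => w k t := fun t => by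
    apply Quaternion.ext
    · exact hre t
    · ext k; simp [w]
    · ext k; simp [w]
    · ext k; simp [w]
  rw [hw t]
  have key : ∀ k, w k = flowField γ k := by
    refine eq_flowField hγ' ?_ (fun n t => ?_) fun k t => ?_
    · funext t
      have h := h0 t
      apply E3.ext
      · simpa [w] using congrArg QuaternionAlgebra.imI h
      · simpa [w] using congrArg QuaternionAlgebra.imJ h
      · simpa [w] using congrArg QuaternionAlgebra.imK h
    · have h := congrArg (coeff n) (sq_sum_of_mul_self (hsq t) (hre t))
      rw [hw t] at h
      simpa only [vecSeries_imI, vecSeries_imJ, vecSeries_imK, pow_two, map_add, coeff_mul,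
        coeff_mk, ← Finset.sum_add_distrib, coeff_one, ← inner_eq] using h
    · obtain ⟨W', hW', h⟩ := hode t
      obtain ⟨e1, e2, e3⟩ := gauge_ode_components h
      rw [hasDerivAt_E3]
      refine ⟨?_, ?_, ?_⟩
      · have := congrArg (coeff (k + 1)) e1
        rw [coeff_succ_X_mul] at this
        refine (hW'.2.1 k).congr_deriv ?_
        rw [this]; simp [w]
      · have := congrArg (coeff (k + 1)) e2
        rw [coeff_succ_X_mul] at this
        refine (hW'.2.2.1 k).congr_deriv ?_
        rw [this]; simp [w]
      · have := congrArg (coeff (k + 1)) e3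
        rw [coeff_succ_X_mul] at this
        refine (hW'.2.2.2 k).congr_deriv ?_
        rw [this]; simp [w]
  simp only [key]

theorem hasQuatDerivAt_darbouxSeries {a b t : ℝ} {S : ℝ → E3} {S' : E3} (hS : HasDerivAt S S' t) :
    HasQuatDerivAt (fun s => darbouxSeries a b (S s)) (constVec (b • S')) t := by
  have h1 : HasQuatDerivAt (fun s => darbouxQuat a b (S s)) (constVec (b • S')) t :=
    ⟨.const _ t, .C ((hS.apply 0).const_mul b), .C ((hS.apply 1).const_mul b),
      .C ((hS.apply 2).const_mul b)⟩
  simpa using! (HasQuatDerivAt.const ((2 * C (a ^ 2 + b ^ 2) * X : PowerSeries ℝ) • 1) t).add h1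

theorem hasQuatDerivAt_darbouxQuat {a b t : ℝ} {S : ℝ → E3} {S' : E3} (hS : HasDerivAt S S' t) :
    HasQuatDerivAt (fun s => darbouxQuat a b (S s)) (constVec (b • S')) t :=
    ⟨.const _ t, .C ((hS.apply 0).const_mul b), .C ((hS.apply 1).const_mul b),
      .C ((hS.apply 2).const_mul b)⟩

theorem HasQuatDerivAt.const_smul {f : ℝ → ℍ[PowerSeries ℝ]} {f' : ℍ[PowerSeries ℝ]} {t : ℝ}
    (hf : HasQuatDerivAt f f' t) (r : PowerSeries ℝ) :
    HasQuatDerivAt (fun s => r • f s) (r • f') t := by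
  simpa only [zero_mul, zero_add, Quaternion.coe_mul_eq_smul] using
    (HasQuatDerivAt.const (r : ℍ[PowerSeries ℝ]) t).mul hf

theorem HasQuatDerivAt.const_sub {f : ℝ → ℍ[PowerSeries ℝ]} {f' : ℍ[PowerSeries ℝ]} {t : ℝ}
    (hf : HasQuatDerivAt f f' t) (c : ℍ[PowerSeries ℝ]) :
    HasQuatDerivAt (fun s => c - f s) (-f') t := by
  simpa only [zero_add, sub_eq_add_neg] using (HasQuatDerivAt.const c t).add hf.neg

/-- The generating series `∑ Y_k X ^ k` of the hierarchy of vector fields along `γ`. -/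
abbrev flowSeries (γ : ℝ → E3) (t : ℝ) : ℍ[PowerSeries ℝ] := vecSeries fun k => flowField γ k t

theorem quatConstCoeff_darbouxSeries (a b : ℝ) (S : E3) :
    quatConstCoeff (darbouxSeries a b S) = quatConstCoeff (darbouxQuat a b S) := by
  apply Quaternion.ext <;> simp [darbouxSeries]

theorem quatConstCoeff_flowSeries (γ : ℝ → E3) (t : ℝ) :
    quatConstCoeff (flowSeries γ t) = quatConstCoeff (constVec (unitTangent γ t)) := by
  apply Quaternion.ext <;> simp [flowField_zero, constantCoeff_mk]

namespace IsDarbouxPair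
variable {a b : ℝ} {γ η S : ℝ → E3} (H : IsDarbouxPair a b γ η S)
include H

/-- The derivative of `d` is `a² + b²` times the difference of the velocities of `η` and `γ`. -/
theorem darbouxQuat_deriv (t : ℝ) : constVec (b • deriv S t) =
    (C (a ^ 2 + b ^ 2) * C ‖deriv γ t‖ : PowerSeries ℝ) •
      (constVec (unitTangent η t) - constVec (unitTangent γ t)) := by
  have hb := H.im_ne_zero
  have hL : a ^ 2 + b ^ 2 ≠ 0 := by positivity
  have h1 : b • deriv S t = ((a ^ 2 + b ^ 2) * ‖deriv γ t‖) • (unitTangent η t - unitTangent γ t)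
      := by
    rw [← smul_smul, smul_sub, ← deriv_eq_smul_unitTangent (H.deriv_ne_zero t), ← H.norm_deriv_η t,
      ← deriv_eq_smul_unitTangent (H.deriv_η_ne_zero t), H.deriv_η_eq_add, add_sub_cancel_left,
      smul_smul, mul_div_cancel₀ _ hL]
  rw [h1]
  apply Quaternion.ext <;> simp

theorem unitTangent_mul_darbouxQuat (t : ℝ) :
    constVec (unitTangent γ t) * darbouxQuat a b (S t) =
      darbouxQuat a b (S t) * constVec (unitTangent η t) := by
  rw [H.unitTangent_η]
  have hS := sq_sum_eq_one (H.norm_eq_one t)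
  have hb := H.im_ne_zero
  have hr := inv_mul_cancel₀ (show a ^ 2 + b ^ 2 ≠ 0 by positivity)
  generalize unitTangent γ t = T
  generalize S t = S₀ at *
  have key : ∀ x y : ℝ, x = y → (C x : PowerSeries ℝ) = C y := fun x y h => by rw [h]
  apply Quaternion.ext <;>
    simp only [Quaternion.re_mul, Quaternion.imI_mul, Quaternion.imJ_mul, Quaternion.imK_mul,
      darbouxQuat_re, darbouxQuat_imI, darbouxQuat_imJ, darbouxQuat_imK, constVec_re, constVec_imI,
      constVec_imJ, constVec_imK, ← map_mul, ← map_sub, ← map_add, ← map_zero C] <;>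
    apply key <;>
    simp only [darbouxRotation, inner_eq, PiLp.smul_apply, PiLp.add_apply, cross_apply_zero,
      cross_apply_one, cross_apply_two, smul_eq_mul] <;>
    generalize (a ^ 2 + b ^ 2)⁻¹ = r at *
  · linear_combination (b * (S₀ 0 * T 0 + S₀ 1 * T 1 + S₀ 2 * T 2)) * hr +
      (2 * b ^ 3 * r * (S₀ 0 * T 0 + S₀ 1 * T 1 + S₀ 2 * T 2)) * hS
  · linear_combination (b * (S₀ 1 * T 2 - S₀ 2 * T 1) + a * T 0) * hr +
      (2 * a * b ^ 2 * r * T 0) * hS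
  · linear_combination (b * (S₀ 2 * T 0 - S₀ 0 * T 2) + a * T 1) * hr +
      (2 * a * b ^ 2 * r * T 1) * hS
  · linear_combination (b * (S₀ 0 * T 1 - S₀ 1 * T 0) + a * T 2) * hr +
      (2 * a * b ^ 2 * r * T 2) * hS

theorem darbouxSeries_mul_star (t : ℝ) : darbouxSeries a b (S t) * star (darbouxSeries a b (S t)) =
    (darbouxNorm a b : ℍ[PowerSeries ℝ]) := _root_.darbouxSeries_mul_star (H.norm_eq_one t)

theorem hasDerivAt_S (t : ℝ) : HasDerivAt S (deriv S t) t :=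
  (H.hasDerivAt t).differentiableAt.hasDerivAt

theorem hasQuatDerivAt_flowSeries (t : ℝ) : HasQuatDerivAt (flowSeries γ)
    (vecSeries fun k => ‖deriv γ t‖ • cross (flowField γ (k + 1) t) (unitTangent γ t)) t :=
  hasQuatDerivAt_vecSeries fun k => hasDerivAt_flowField H.contDiff H.deriv_ne_zero k t

theorem isGaugePair (t : ℝ) :
    IsGaugePair (X : PowerSeries ℝ) (C ‖deriv γ t‖) (constVec (unitTangent γ t)) (flowSeries γ t)
      (constVec (deriv (unitTangent γ) t))
      (vecSeries fun k => ‖deriv γ t‖ • cross (flowField γ (k + 1) t) (unitTangent γ t)) :=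
  isGaugePair_flowField H.contDiff H.deriv_ne_zero t

/-- A Darboux transformation acts on the generating series by conjugation with the Darboux matrix.
-/
theorem quatConj_flowSeries (t : ℝ) :
    quatConj (darbouxNorm a b)⁻¹ (darbouxSeries a b (S t)) (flowSeries γ t) = flowSeries η t := by
  have hr := darbouxNorm_mul_inv (a := a) H.im_ne_zero
  refine eq_vecSeries_flowField (W := fun t =>
    quatConj (darbouxNorm a b)⁻¹ (darbouxSeries a b (S t)) (flowSeries γ t)) H.deriv_η_ne_zero
    (fun t => re_quatConj rfl)
    (fun t => quatConj_mul_self (H.darbouxSeries_mul_star t) hr (H.isGaugePair t).Y_mul_Y)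
    (fun t => ?_) (fun t => ?_) t
  · have hD := hasQuatDerivAt_darbouxSeries (a := a) (b := b) (H.hasDerivAt_S t)
    have hY := H.hasQuatDerivAt_flowSeries t
    have hW := ((hD.star.mul hY).mul hD).const_smul (darbouxNorm a b)⁻¹
    refine ⟨_, hW, ?_⟩
    rw [H.norm_deriv_η]
    have e1 := hD.mul hW
    have e2 := hY.mul hD
    have e3 : (fun s => darbouxSeries a b (S s) * ((darbouxNorm a b)⁻¹ •
        (star (darbouxSeries a b (S s)) * flowSeries γ s * darbouxSeries a b (S s)))) =
        fun s => flowSeries γ s * darbouxSeries a b (S s) :=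
      funext fun s => mul_quatConj (H.darbouxSeries_mul_star s) hr _
    rw [e3] at e1
    exact gauge_ode_of_mul_eq (H.darbouxSeries_mul_star t) hr
      (mul_quatConj (H.darbouxSeries_mul_star t) hr _) (e1.unique e2) (H.isGaugePair t).ode
      (darboux_ode (H.unitTangent_mul_darbouxQuat t) (H.darbouxQuat_deriv t))
  · have e1 := congrArg quatConstCoeff (mul_quatConj (H.darbouxSeries_mul_star t) hr
      (flowSeries γ t))
    have e2 := congrArg quatConstCoeff (H.unitTangent_mul_darbouxQuat t)
    rw [quatConstCoeff_mul, quatConstCoeff_mul] at e1 e2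
    rw [quatConstCoeff_flowSeries, quatConstCoeff_darbouxSeries, e2] at e1
    have hd : quatConstCoeff (darbouxQuat a b (S t)) ≠ 0 := fun h0 => by
      have hs := sq_sum_eq_one (H.norm_eq_one t)
      have h1 := congrArg QuaternionAlgebra.imI h0
      have h2 := congrArg QuaternionAlgebra.imJ h0
      have h3 := congrArg QuaternionAlgebra.imK h0
      simp [H.im_ne_zero] at h1 h2 h3
      simp [h1, h2, h3] at hs
    rw [mul_left_cancel₀ hd e1]
    apply Quaternion.ext <;> simp

theorem darbouxSeries_mul_flowSeries (t : ℝ) :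
    darbouxSeries a b (S t) * flowSeries η t = flowSeries γ t * darbouxSeries a b (S t) := by
  rw [← H.quatConj_flowSeries, mul_quatConj (H.darbouxSeries_mul_star t)
    (darbouxNorm_mul_inv H.im_ne_zero)]

end IsDarbouxPair

/-- The product `(1 - Y T)* D (1 - W T₁) d*`, with `Y` and `W` the generating series of `γ` and `η`.
It commutes with `T`, and compares the diagonalizing gauges of the two curves. -/
def darbouxPhase (a b : ℝ) (γ η S : ℝ → E3) (t : ℝ) : ℍ[PowerSeries ℝ] :=
  star (1 - flowSeries γ t * constVec (unitTangent γ t)) * darbouxSeries a b (S t) *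
    (1 - flowSeries η t * constVec (unitTangent η t)) * star (darbouxQuat a b (S t))

namespace IsDarbouxPair
variable {a b : ℝ} {γ η S : ℝ → E3} (H : IsDarbouxPair a b γ η S)
include H

theorem quatConstCoeff_darbouxPhase (t : ℝ) :
    quatConstCoeff (darbouxPhase a b γ η S t) = ((4 * (a ^ 2 + b ^ 2) : ℝ) : ℍ[ℝ]) := by
  have e1 : ∀ {γ : ℝ → E3} (_ : deriv γ t ≠ 0), quatConstCoeff (1 - flowSeries γ t *
      constVec (unitTangent γ t)) = ((2 : ℝ) : ℍ[ℝ]) := fun {γ} hγ' => by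
    have hs := sq_sum_eq_one (norm_unitTangent hγ')
    have e0 : quatConstCoeff (1 - flowSeries γ t * constVec (unitTangent γ t)) =
        1 - quatConstCoeff (flowSeries γ t * constVec (unitTangent γ t)) := by
      apply Quaternion.ext <;> simp
    rw [e0, quatConstCoeff_mul, quatConstCoeff_flowSeries]
    apply Quaternion.ext <;>
      simp [Quaternion.re_mul, Quaternion.imI_mul, Quaternion.imJ_mul, Quaternion.imK_mul]
    · linear_combination hs
    all_goals ring
  have hs := sq_sum_eq_one (H.norm_eq_one t)
  rw [darbouxPhase, quatConstCoeff_mul, quatConstCoeff_mul, quatConstCoeff_mul, quatConstCoeff_star,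
    quatConstCoeff_star, e1 (H.deriv_ne_zero t), e1 (H.deriv_η_ne_zero t),
    quatConstCoeff_darbouxSeries]
  generalize hc : 4 * (a ^ 2 + b ^ 2) = c
  apply Quaternion.ext <;>
    simp [Quaternion.re_mul, Quaternion.imI_mul, Quaternion.imJ_mul, Quaternion.imK_mul]
  · linear_combination 4 * b ^ 2 * hs + hc
  all_goals ring

end IsDarbouxPair
end

/-! ### Equivariance under the monodromy -/

noncomputable section
open Quaternion PowerSeries

/-- A vector as an imaginary quaternion. -/
def vecQuat (w : E3) : ℍ[ℝ] := ⟨0, w 0, w 1, w 2⟩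

section
variable (w : E3)
@[simp] theorem vecQuat_re : (vecQuat w).re = 0 := rfl
@[simp] theorem vecQuat_imI : (vecQuat w).imI = w 0 := rfl
@[simp] theorem vecQuat_imJ : (vecQuat w).imJ = w 1 := rfl
@[simp] theorem vecQuat_imK : (vecQuat w).imK = w 2 := rfl
end

theorem vecQuat_injective : Function.Injective vecQuat := fun _ _ h =>
  E3.ext (congrArg QuaternionAlgebra.imI h) (congrArg QuaternionAlgebra.imJ h)
    (congrArg QuaternionAlgebra.imK h)

theorem vecQuat_mul_sub (u v : E3) :
    vecQuat u * vecQuat v - vecQuat v * vecQuat u = (2 : ℝ) • vecQuat (cross u v) := by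
  apply Quaternion.ext <;>
    simp [Quaternion.re_mul, Quaternion.imI_mul, Quaternion.imJ_mul, Quaternion.imK_mul] <;> ring

/-- The unit quaternion `u` lifts the rotational part of `h`. -/
structure IsQuatLift (h : E3 ≃ᵃⁱ[ℝ] E3) (u : ℍ[ℝ]) : Prop where
  star_mul : star u * u = 1
  vecQuat_map : ∀ w, vecQuat (h.linearIsometryEquiv w) = u * vecQuat w * star u

/-- As a conjugation, the rotational part of `h` preserves the commutator of quaternions. -/
theorem IsQuatLift.map_cross {h : E3 ≃ᵃⁱ[ℝ] E3} {u : ℍ[ℝ]} (hu : IsQuatLift h u) (x y : E3) :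
    h.linearIsometryEquiv (cross x y) =
      cross (h.linearIsometryEquiv x) (h.linearIsometryEquiv y) := by
  apply vecQuat_injective
  have key : ∀ x y : ℍ[ℝ], u * x * star u * (u * y * star u) = u * (x * y) * star u := fun x y => by
    have : u * x * star u * (u * y * star u) = u * x * (star u * u) * y * star u := by
      simp only [mul_assoc]
    rw [this, hu.star_mul, mul_one, mul_assoc u]
  refine smul_right_injective _ (two_ne_zero (α := ℝ)) ?_
  simp only
  rw [← vecQuat_mul_sub, hu.vecQuat_map, hu.vecQuat_map, hu.vecQuat_map, key, key, ← sub_mul,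
    ← mul_sub, vecQuat_mul_sub, mul_smul_comm, smul_mul_assoc]

section Equivariance
variable {p : ℝ} {h : E3 ≃ᵃⁱ[ℝ] E3} {γ : ℝ → E3} (hγ : γ ∈ curvesWithMonodromy p h)
include hγ

theorem norm_deriv_add (t : ℝ) : ‖deriv γ (t + p)‖ = ‖deriv γ t‖ := by
  rw [deriv_monodromy (hγ.1.differentiable (by simp)) hγ.2.2, LinearIsometryEquiv.norm_map]

theorem arcDeriv_add {f : ℝ → E3} (hf : Differentiable ℝ f)
    (hfp : ∀ t, f (t + p) = h.linearIsometryEquiv (f t)) (t : ℝ) :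
    arcDeriv γ f (t + p) = h.linearIsometryEquiv (arcDeriv γ f t) := by
  have h1 : HasDerivAt (fun s => h.linearIsometryEquiv (f s)) (h.linearIsometryEquiv (deriv f t)) t
      :=
    (h.linearIsometryEquiv.toContinuousLinearEquiv.toContinuousLinearMap.hasFDerivAt).comp_hasDerivAt
      t (hf t).hasDerivAt
  have h2 : deriv f (t + p) = h.linearIsometryEquiv (deriv f t) := by
    rw [← deriv_comp_add_const, funext hfp, h1.deriv]
  rw [arcDeriv, arcDeriv, norm_deriv_add hγ, h2, map_smul]

theorem unitTangent_add (t : ℝ) :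
    unitTangent γ (t + p) = h.linearIsometryEquiv (unitTangent γ t) := by
  rw [unitTangent, arcDeriv, arcDeriv, norm_deriv_add hγ,
    deriv_monodromy (hγ.1.differentiable (by simp)) hγ.2.2, map_smul]

theorem flowField_add (hA : ∀ x y, h.linearIsometryEquiv (cross x y) =
      cross (h.linearIsometryEquiv x) (h.linearIsometryEquiv y)) (k : ℕ) (t : ℝ) :
    flowField γ k (t + p) = h.linearIsometryEquiv (flowField γ k t) := by
  induction k using Nat.strong_induction_on generalizing t with
  | _ k ih =>
    cases k with
    | zero => rw [flowField_zero]; exact unitTangent_add hγ t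
    | succ k =>
      have hs : ∀ t i, i < k + 1 → flowField γ i (t + p) = h.linearIsometryEquiv (flowField γ i t)
          :=
        fun t i hi => ih i hi t
      rw [flowField_succ, flowField_succ, arcDeriv_add hγ
        ((contDiff_flowField hγ.1 hγ.2.1 k).differentiable (by simp)) (fun t => hs t k (by omega)),
        unitTangent_add hγ, map_sub, hA, map_smul]
      congr 3
      refine Finset.sum_congr rfl fun i hi => ?_
      have hik := Finset.mem_range.mp hi
      rw [hs _ _ (by omega), hs _ _ (by omega), LinearIsometryEquiv.inner_map_map]

end Equivariance

/-- The coefficient of `X ^ k` of a quaternion over `ℝ⟦X⟧`. -/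
def quatCoeff (k : ℕ) (q : ℍ[PowerSeries ℝ]) : ℍ[ℝ] :=
  ⟨coeff k q.re, coeff k q.imI, coeff k q.imJ, coeff k q.imK⟩

theorem quatCoeff_ext {q r : ℍ[PowerSeries ℝ]} (h : ∀ k, quatCoeff k q = quatCoeff k r) : q = r :=
  Quaternion.ext _ _ (PowerSeries.ext fun k => congrArg QuaternionAlgebra.re (h k))
    (PowerSeries.ext fun k => congrArg QuaternionAlgebra.imI (h k))
    (PowerSeries.ext fun k => congrArg QuaternionAlgebra.imJ (h k))
    (PowerSeries.ext fun k => congrArg QuaternionAlgebra.imK (h k))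

/-- A real quaternion as a quaternion over `ℝ⟦X⟧` with constant coefficients. -/
def constQuat (u : ℍ[ℝ]) : ℍ[PowerSeries ℝ] := ⟨C u.re, C u.imI, C u.imJ, C u.imK⟩

section
variable (u : ℍ[ℝ]) (k : ℕ) (q : ℍ[PowerSeries ℝ])
@[simp] theorem constQuat_re : (constQuat u).re = C u.re := rfl
@[simp] theorem constQuat_imI : (constQuat u).imI = C u.imI := rfl
@[simp] theorem constQuat_imJ : (constQuat u).imJ = C u.imJ := rfl
@[simp] theorem constQuat_imK : (constQuat u).imK = C u.imK := rfl
@[simp] theorem quatCoeff_re : (quatCoeff k q).re = coeff k q.re := rfl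
@[simp] theorem quatCoeff_imI : (quatCoeff k q).imI = coeff k q.imI := rfl
@[simp] theorem quatCoeff_imJ : (quatCoeff k q).imJ = coeff k q.imJ := rfl
@[simp] theorem quatCoeff_imK : (quatCoeff k q).imK = coeff k q.imK := rfl

theorem quatCoeff_constQuat_mul : quatCoeff k (constQuat u * q) = u * quatCoeff k q := by
  apply Quaternion.ext <;>
    simp [Quaternion.re_mul, Quaternion.imI_mul, Quaternion.imJ_mul, Quaternion.imK_mul]

theorem quatCoeff_mul_constQuat : quatCoeff k (q * constQuat u) = quatCoeff k q * u := by
  apply Quaternion.ext <;>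
    simp [Quaternion.re_mul, Quaternion.imI_mul, Quaternion.imJ_mul, Quaternion.imK_mul]

theorem star_constQuat : star (constQuat u) = constQuat (star u) := by
  apply Quaternion.ext <;> simp

theorem constQuat_mul (v : ℍ[ℝ]) : constQuat (u * v) = constQuat u * constQuat v := by
  apply Quaternion.ext <;>
    simp [Quaternion.re_mul, Quaternion.imI_mul, Quaternion.imJ_mul, Quaternion.imK_mul]

theorem constQuat_one : constQuat 1 = 1 := by
  apply Quaternion.ext <;> simp
end

theorem quatCoeff_vecSeries (y : ℕ → E3) (k : ℕ) : quatCoeff k (vecSeries y) = vecQuat (y k) := by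
  apply Quaternion.ext <;> simp

theorem constVec_eq_constQuat (w : E3) : constVec w = constQuat (vecQuat w) := by
  apply Quaternion.ext <;> simp

namespace IsQuatLift
variable {h : E3 ≃ᵃⁱ[ℝ] E3} {u : ℍ[ℝ]} (hu : IsQuatLift h u)
include hu

theorem star_mul_constQuat : star (constQuat u) * constQuat u = 1 := by
  rw [star_constQuat, ← constQuat_mul, hu.star_mul, constQuat_one]

theorem vecSeries_map (y : ℕ → E3) : vecSeries (fun k => h.linearIsometryEquiv (y k)) =
    constQuat u * vecSeries y * star (constQuat u) := by
  refine quatCoeff_ext fun k => ?_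
  rw [star_constQuat, quatCoeff_mul_constQuat, quatCoeff_constQuat_mul, quatCoeff_vecSeries,
    quatCoeff_vecSeries, hu.vecQuat_map]

theorem constVec_map (w : E3) : constVec (h.linearIsometryEquiv w) =
    constQuat u * constVec w * star (constQuat u) := by
  rw [constVec_eq_constQuat, constVec_eq_constQuat, hu.vecQuat_map, constQuat_mul, constQuat_mul,
    star_constQuat]

end IsQuatLift

theorem re_conj_of_star_mul {R : Type*} [CommRing R] {u q : ℍ[R]} (hu : star u * u = 1) :
    (u * q * star u).re = q.re := by
  have h : ∀ q r : ℍ[R], (q * r).re = (r * q).re := fun q r => by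
    rw [Quaternion.re_mul, Quaternion.re_mul]; ring
  rw [h, ← mul_assoc, hu, one_mul]

theorem conj_mul_conj {R : Type*} [CommRing R] {u : ℍ[R]} (hu : star u * u = 1) (q r : ℍ[R]) :
    u * q * star u * (u * r * star u) = u * (q * r) * star u := by
  have : u * q * star u * (u * r * star u) = u * q * (star u * u) * r * star u := by
    simp only [mul_assoc]
  rw [this, hu, mul_one, mul_assoc u]

theorem conj_smul_one_add {R : Type*} [CommRing R] {u : ℍ[R]} (hu : star u * u = 1) (x : R)
    (q : ℍ[R]) : x • 1 + u * q * star u = u * (x • 1 + q) * star u := by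
  have : u * star u = 1 := by rw [Quaternion.self_mul_star, ← Quaternion.star_mul_self, hu]
  rw [mul_add, add_mul, mul_smul_one, smul_mul_assoc, this]

theorem darbouxPhase_conj {R : Type*} [CommRing R] {u Y T d W T₁ : ℍ[R]} (hu : star u * u = 1) (x :
    R) :
    star (1 - u * Y * star u * (u * T * star u)) * (x • 1 + u * d * star u) *
      (1 - u * W * star u * (u * T₁ * star u)) * star (u * d * star u) =
    u * (star (1 - Y * T) * (x • 1 + d) * (1 - W * T₁) * star d) * star u := by
  have h1 : ∀ q : ℍ[R], 1 - u * q * star u = u * (1 - q) * star u := fun q => by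
    have : u * star u = 1 := by rw [Quaternion.self_mul_star, ← Quaternion.star_mul_self, hu]
    rw [mul_sub, sub_mul, mul_one, this]
  have h2 : ∀ q : ℍ[R], star (u * q * star u) = u * star q * star u := fun q => by
    rw [star_mul, star_mul, star_star, mul_assoc]
  rw [conj_mul_conj hu, conj_mul_conj hu, h1, h1, h2, h2, conj_smul_one_add hu, conj_mul_conj hu,
    conj_mul_conj hu, conj_mul_conj hu]
end

/-! ### The higher Hamiltonians -/

noncomputable section
open Quaternion PowerSeries

theorem HasFormalDerivAt.div {f g : ℝ → PowerSeries ℝ} {f' g' : PowerSeries ℝ} {t : ℝ}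
    (hf : HasFormalDerivAt f f' t) (hg : HasFormalDerivAt g g' t)
    (h0 : ∀ s, constantCoeff (g s) ≠ 0) :
    HasFormalDerivAt (fun s => f s * (g s)⁻¹) ((g t * f' - f t * g') * (g t)⁻¹ ^ 2) t := by
  have h1 := PowerSeries.mul_inv_cancel (g t) (h0 t)
  have h2 := hf.mul (hg.inv h0)
  have h3 : f' * (g t)⁻¹ + f t * -(g' * (g t)⁻¹ ^ 2) = (g t * f' - f t * g') * (g t)⁻¹ ^ 2 := by
    linear_combination (-f' * (g t)⁻¹) * h1
  rwa [h3] at h2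

theorem darbouxPhase_add {p a b : ℝ} {γ η S : ℝ → E3} {h : E3 ≃ᵃⁱ[ℝ] E3} (hγ : γ ∈
    curvesWithMonodromy p h)
    (hη : η ∈ curvesWithMonodromy p h) (hS : ∀ t, S (t + p) = h.linearIsometryEquiv (S t))
    {u : ℍ[ℝ]} (hu : IsQuatLift h u) (t : ℝ) :
    darbouxPhase a b γ η S (t + p) = constQuat u * darbouxPhase a b γ η S t * star (constQuat u) :=
        by
  have hstar := hu.star_mul_constQuat
  have hd : darbouxQuat a b (S (t + p)) =
      constQuat u * darbouxQuat a b (S t) * star (constQuat u) := by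
    have e : ∀ S : E3, darbouxQuat a b S = (C (-a) : PowerSeries ℝ) • 1 + constVec (b • S) :=
      fun S => by apply Quaternion.ext <;> simp
    rw [e, e, hS, ← map_smul, hu.constVec_map, conj_smul_one_add hstar]
  have hY : ∀ {γ : ℝ → E3}, γ ∈ curvesWithMonodromy p h → flowSeries γ (t + p) =
      constQuat u * flowSeries γ t * star (constQuat u) := fun {γ} hγ => by
    rw [← hu.vecSeries_map]
    exact congrArg vecSeries (funext fun k => flowField_add hγ hu.map_cross k t)
  have hT : ∀ {γ : ℝ → E3}, γ ∈ curvesWithMonodromy p h → constVec (unitTangent γ (t + p)) =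
      constQuat u * constVec (unitTangent γ t) * star (constQuat u) := fun {γ} hγ => by
    rw [unitTangent_add hγ, hu.constVec_map]
  rw [darbouxPhase, darbouxSeries, hd, hY hγ, hY hη, hT hγ, hT hη, darbouxPhase_conj hstar]
  rfl

namespace IsDarbouxPair
variable {a b : ℝ} {γ η S : ℝ → E3} (H : IsDarbouxPair a b γ η S)
include H

theorem isGaugePair_η (t : ℝ) : IsGaugePair (X : PowerSeries ℝ) (C ‖deriv γ t‖) (constVec
    (unitTangent η t))
      (flowSeries η t) (constVec (deriv (unitTangent η) t))
      (vecSeries fun k => ‖deriv γ t‖ • cross (flowField η (k + 1) t) (unitTangent η t)) := by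
  have := H.symm.isGaugePair t
  rwa [H.norm_deriv_η] at this

/-- The angle of the phase `α + β T` changes at the rate `e₁ / n₁ - e₀ / n₀`, which is half the
difference of the Hamiltonian densities. -/
theorem exists_hasFormalDerivAt_phase (t : ℝ) {n₀ n₁ e₀ e₁ : PowerSeries ℝ}
    (hn₀ : n₀ = 2 - 2 * (constVec (unitTangent γ t) * flowSeries γ t).re)
    (he₀ : e₀ = (flowSeries γ t *
      (constVec (deriv (unitTangent γ) t) * constVec (unitTangent γ t))).re)
    (hn₁ : n₁ = 2 - 2 * (constVec (unitTangent η t) * flowSeries η t).re)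
    (he₁ : e₁ = (flowSeries η t *
      (constVec (deriv (unitTangent η) t) * constVec (unitTangent η t))).re) :
    ∃ α' β' : PowerSeries ℝ, HasFormalDerivAt (fun s => (darbouxPhase a b γ η S s).re) α' t ∧
      HasFormalDerivAt (fun s => -(darbouxPhase a b γ η S s * constVec (unitTangent γ s)).re) β' t ∧
      n₀ * n₁ * ((darbouxPhase a b γ η S t).re * β' -
        -(darbouxPhase a b γ η S t * constVec (unitTangent γ t)).re * α') =
      (n₀ * e₁ - n₁ * e₀) * ((darbouxPhase a b γ η S t).re ^ 2 +
        (-(darbouxPhase a b γ η S t * constVec (unitTangent γ t)).re) ^ 2) := by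
  have hT := hasQuatDerivAt_constVec (hasDerivAt_unitTangent H.contDiff H.deriv_ne_zero t)
  have hT₁ := hasQuatDerivAt_constVec (hasDerivAt_unitTangent H.contDiff_η H.deriv_η_ne_zero t)
  have hY := H.hasQuatDerivAt_flowSeries t
  have hW := H.symm.hasQuatDerivAt_flowSeries t
  rw [H.norm_deriv_η] at hW
  have hd := hasQuatDerivAt_darbouxQuat (a := a) (b := b) (H.hasDerivAt_S t)
  have hD := hasQuatDerivAt_darbouxSeries (a := a) (b := b) (H.hasDerivAt_S t)
  have hκ := (((((hY.mul hT).const_sub 1).star.mul hD).mul ((hW.mul hT₁).const_sub 1)).mul hd.star)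
  have hκT := hκ.mul hT
  have hdd := (hT.mul hd)
  rw [funext H.unitTangent_mul_darbouxQuat] at hdd
  have hdd' := hdd.unique (hd.mul hT₁)
  refine ⟨_, _, hκ.1, hκT.1.neg, ?_⟩
  refine phase_ode_of_isGaugePair (x := X) (L := C (a ^ 2 + b ^ 2)) X_ne_zero (H.isGaugePair t)
    (H.isGaugePair_η t) (H.unitTangent_mul_darbouxQuat t) (H.darbouxSeries_mul_flowSeries t)
    (H.darbouxQuat_deriv t) hdd' hn₀ rfl he₀ hn₁ rfl he₁ rfl ?_ rfl rfl rfl rfl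
  exact congrArg (· + _) (congrArg (· * _) (congrArg (· + _) (add_mul _ _ _)))

theorem constantCoeff_re_darbouxPhase (t : ℝ) :
    constantCoeff (darbouxPhase a b γ η S t).re = 4 * (a ^ 2 + b ^ 2) :=
  congrArg QuaternionAlgebra.re (H.quatConstCoeff_darbouxPhase t)

theorem constantCoeff_re_darbouxPhase_mul (t : ℝ) :
    constantCoeff (-(darbouxPhase a b γ η S t * constVec (unitTangent γ t)).re) = 0 := by
  have h1 := congrArg QuaternionAlgebra.re
    (quatConstCoeff_mul (darbouxPhase a b γ η S t) (constVec (unitTangent γ t)))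
  rw [H.quatConstCoeff_darbouxPhase, Quaternion.coe_mul_eq_smul] at h1
  rw [map_neg, neg_eq_zero]
  simpa using h1

/-- The difference of the densities is twice the derivative of `arctan (β / α)`, where `α + β T` is
the phase. The quotient `β / α` is a periodic power series without constant term. -/
theorem higherHamiltonian_eq {p : ℝ} {h : E3 ≃ᵃⁱ[ℝ] E3} (hγ : γ ∈ curvesWithMonodromy p h)
    (hη : η ∈ curvesWithMonodromy p h) (hS : ∀ t, S (t + p) = h.linearIsometryEquiv (S t))
    {u : ℍ[ℝ]} (hu : IsQuatLift h u) (x₀ : ℝ) (k : ℕ) :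
    higherHamiltonian p x₀ k η = higherHamiltonian p x₀ k γ := by
  have hb := H.im_ne_zero
  set α : ℝ → PowerSeries ℝ := fun t => (darbouxPhase a b γ η S t).re with hα
  set β : ℝ → PowerSeries ℝ := fun t => -(darbouxPhase a b γ η S t * constVec (unitTangent γ t)).re
      with hβ
  have hα0 : ∀ t, constantCoeff (α t) ≠ 0 := fun t => by
    rw [hα]; simp only; rw [H.constantCoeff_re_darbouxPhase]; positivity
  let n : (ℝ → E3) → ℝ → PowerSeries ℝ := fun γ t =>
    2 - 2 * (constVec (unitTangent γ t) * flowSeries γ t).re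
  let e : (ℝ → E3) → ℝ → PowerSeries ℝ := fun γ t =>
    (flowSeries γ t * (constVec (deriv (unitTangent γ) t) * constVec (unitTangent γ t))).re
  have hdγ := fun t => hamiltonianDensity_mul_speed H.deriv_ne_zero t (n := n γ t) (e := e γ t)
    rfl rfl
  have hdη := fun t => hamiltonianDensity_mul_speed H.deriv_η_ne_zero t (n := n η t) (e := e η t)
    rfl rfl
  have hk := fun t => H.exists_hasFormalDerivAt_phase t (n₀ := n γ t) (n₁ := n η t) (e₀ := e γ t)
      (e₁ := e η t)
    rfl rfl rfl rfl
  choose α' β' hα' hβ' key using hk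
  have hper : ∀ t, β (t + p) * (α (t + p))⁻¹ = β t * (α t)⁻¹ := fun t => by
    have h1 : α (t + p) = α t := by
      rw [hα]; simp only
      rw [darbouxPhase_add hγ hη hS hu, re_conj_of_star_mul hu.star_mul_constQuat]
    have h2 : β (t + p) = β t := by
      rw [hβ]; simp only
      rw [darbouxPhase_add hγ hη hS hu, unitTangent_add hγ, hu.constVec_map,
        conj_mul_conj hu.star_mul_constQuat, re_conj_of_star_mul hu.star_mul_constQuat]
    rw [h1, h2]
  have hcont : ∀ {γ : ℝ → E3}, ContDiff ℝ ∞ γ → (∀ t, deriv γ t ≠ 0) →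
      Continuous fun t => coeff (k - 2) (hamiltonianDensity γ t) * ‖deriv γ t‖ := fun h1 h2 =>
    (continuous_coeff_hamiltonianDensity h1 h2 _).mul (h1.continuous_deriv (by simp)).norm
  have hcγ := hcont H.contDiff H.deriv_ne_zero
  have hcη := hcont H.contDiff_η H.deriv_η_ne_zero
  have hdiff : ∀ t, coeff (k - 2) (e η t * (n η t)⁻¹ - e γ t * (n γ t)⁻¹) =
      (1 / 2) * (coeff (k - 2) (hamiltonianDensity η t) * ‖deriv η t‖ -
        coeff (k - 2) (hamiltonianDensity γ t) * ‖deriv γ t‖) := fun t => by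
    rw [← coeff_mul_C, ← coeff_mul_C, (hdγ t).1, (hdη t).1, ← map_sub, ← coeff_C_mul]
    congr 1
    have h2 : (C (1 / 2 : ℝ) : PowerSeries ℝ) * 2 = 1 := by
      rw [← map_ofNat C 2, ← map_mul]; norm_num
    linear_combination -(e η t * (n η t)⁻¹ - e γ t * (n γ t)⁻¹) * h2
  have hint := integral_coeff_eq_zero (x₀ := x₀) (p := p) (u := fun t => β t * (α t)⁻¹)
    (u' := fun t => (α t * β' t - β t * α' t) * (α t)⁻¹ ^ 2)
    (g := fun t => e η t * (n η t)⁻¹ - e γ t * (n γ t)⁻¹)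
    (fun t => by rw [map_mul, hβ]; simp only; rw [H.constantCoeff_re_darbouxPhase_mul, zero_mul])
    (fun t => HasFormalDerivAt.div (hβ' t) (hα' t) hα0)
    (fun t => by
      have h1 := PowerSeries.mul_inv_cancel (α t) (hα0 t)
      have h2 := PowerSeries.mul_inv_cancel (n γ t) (by rw [(hdγ t).2]; norm_num)
      have h3 := PowerSeries.mul_inv_cancel (n η t) (by rw [(hdη t).2]; norm_num)
      have h4 : n γ t * n η t * (α t * β' t - β t * α' t) =
        (n γ t * e η t - n η t * e γ t) * (α t ^ 2 + β t ^ 2) := key t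
      have hn : n γ t * n η t ≠ 0 := mul_ne_zero (left_ne_zero_of_mul_eq_one h2)
        (left_ne_zero_of_mul_eq_one h3)
      have hα2 : α t ^ 2 ≠ 0 := pow_ne_zero _ (left_ne_zero_of_mul_eq_one h1)
      refine mul_left_cancel₀ (mul_ne_zero hn hα2) ?_
      generalize (α t)⁻¹ = ι at *
      generalize (n γ t)⁻¹ = ν at *
      generalize (n η t)⁻¹ = ν₁ at *
      generalize α t = x at *
      generalize β t = y at *
      generalize n γ t = m at *
      generalize n η t = m₁ at *
      have h5 : x ^ 2 * ι ^ 2 = 1 := by rw [← mul_pow, h1, one_pow]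
      have e1 : m * m₁ * x ^ 2 * ((e η t * ν₁ - e γ t * ν) * (1 + (y * ι) ^ 2)) =
          (m * e η t * (m₁ * ν₁) - m₁ * e γ t * (m * ν)) * (x ^ 2 + y ^ 2 * (x ^ 2 * ι ^ 2)) := by
        ring
      rw [e1, h2, h3, h5, mul_one, mul_one, mul_one, ← h4]
      linear_combination (-m * m₁ * (x * β' t - y * α' t)) * h5)
    (k - 2) (by
      simp only [hdiff]
      exact continuous_const.mul (hcη.sub hcγ)) (hper x₀)
  simp only [hdiff] at hint
  rw [intervalIntegral.integral_const_mul, intervalIntegral.integral_sub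
    (hcη.intervalIntegrable _ _) (hcγ.intervalIntegrable _ _)] at hint
  rw [higherHamiltonian, higherHamiltonian]
  linarith

end IsDarbouxPair
end

/-! ### Quaternions as complex matrices -/

noncomputable section
open Quaternion

/-- The embedding of the quaternions into the complex matrices that sends the imaginary quaternions
to `su₂` as `su2` does. -/
def quatToMatrix (q : ℍ[ℝ]) : Matrix (Fin 2) (Fin 2) ℂ :=
  !![(q.re : ℂ) - Complex.I * q.imK, -(Complex.I * q.imI) - q.imJ;
     -(Complex.I * q.imI) + q.imJ, q.re + Complex.I * q.imK]

theorem quatToMatrix_mul (q r : ℍ[ℝ]) : quatToMatrix (q * r) = quatToMatrix q * quatToMatrix r := by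
  ext i j
  fin_cases i <;> fin_cases j <;> apply Complex.ext <;>
    simp [quatToMatrix, Matrix.mul_apply, Fin.sum_univ_two, Quaternion.re_mul, Quaternion.imI_mul,
      Quaternion.imJ_mul, Quaternion.imK_mul] <;> ring

theorem quatToMatrix_star (q : ℍ[ℝ]) : quatToMatrix (star q) = (quatToMatrix q)ᴴ := by
  ext i j
  fin_cases i <;> fin_cases j <;> apply Complex.ext <;>
    simp [quatToMatrix, Matrix.conjTranspose_apply]

theorem quatToMatrix_one : quatToMatrix 1 = 1 := by
  ext i j
  fin_cases i <;> fin_cases j <;> simp [quatToMatrix]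

theorem quatToMatrix_vecQuat (w : E3) : quatToMatrix (vecQuat w) = su2 w := by
  ext i j
  fin_cases i <;> fin_cases j <;> simp [quatToMatrix, su2]

theorem quatToMatrix_injective : Function.Injective quatToMatrix := fun q r h => by
  have h0 := congrFun (congrFun h 0) 0
  have h1 := congrFun (congrFun h 1) 0
  have a0 := congrArg Complex.re h0
  have a1 := congrArg Complex.im h0
  have a2 := congrArg Complex.re h1
  have a3 := congrArg Complex.im h1
  simp [quatToMatrix] at a0 a1 a2 a3
  exact Quaternion.ext _ _ a0 a3 a2 a1

theorem exists_quatToMatrix_eq {U : Matrix (Fin 2) (Fin 2) ℂ}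
    (hU : U ∈ Matrix.specialUnitaryGroup (Fin 2) ℂ) : ∃ u, quatToMatrix u = U := by
  obtain ⟨h1, h2⟩ := Matrix.mem_specialUnitaryGroup_iff.mp hU
  have h3 : U.adjugate = star U := by
    have h4 : U * star U = 1 := Matrix.mem_unitaryGroup_iff.mp h1
    have h5 : U.adjugate * U = 1 := by rw [Matrix.adjugate_mul, h2, one_smul]
    exact left_inv_eq_right_inv h5 h4
  rw [Matrix.adjugate_fin_two] at h3
  have e0 := congrFun (congrFun h3 0) 0
  have e1 := congrFun (congrFun h3 0) 1
  simp [Matrix.star_apply] at e0 e1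
  refine ⟨⟨(U 0 0).re, -(U 1 0).im, (U 1 0).re, -(U 0 0).im⟩, ?_⟩
  have e1' : U 0 1 = -(starRingEnd ℂ) (U 1 0) := by rw [← e1, neg_neg]
  ext i j
  fin_cases i <;> fin_cases j <;> apply Complex.ext <;> simp [quatToMatrix, e0, e1']

theorem IsSpinLift.exists_isQuatLift {h : E3 ≃ᵃⁱ[ℝ] E3} {U : Matrix (Fin 2) (Fin 2) ℂ}
    (hU : IsSpinLift h U) : ∃ u, IsQuatLift h u := by
  obtain ⟨u, rfl⟩ := exists_quatToMatrix_eq hU.1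
  refine ⟨u, ?_, fun w => ?_⟩
  · apply quatToMatrix_injective
    rw [quatToMatrix_mul, quatToMatrix_star, quatToMatrix_one]
    exact Matrix.mem_unitaryGroup_iff'.mp (Matrix.mem_specialUnitaryGroup_iff.mp hU.1).1
  · apply quatToMatrix_injective
    rw [quatToMatrix_mul, quatToMatrix_mul, quatToMatrix_star, quatToMatrix_vecQuat,
      quatToMatrix_vecQuat, hU.2]

/-! ### Frames and their monodromy -/
/-- The family `F` of matrices has the entrywise derivative `F'` at `t`. Matrices carry no canonical
norm, hence the entrywise definition. -/
def HasMatrixDerivAt {m n : Type*} (F : ℝ → Matrix m n ℂ) (F' : Matrix m n ℂ) (t : ℝ) : Prop :=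
  ∀ i j, HasDerivAt (fun s => F s i j) (F' i j) t

namespace HasMatrixDerivAt
variable {l m n : Type*} {t : ℝ}

theorem const (M : Matrix m n ℂ) : HasMatrixDerivAt (fun _ => M) 0 t :=
  fun _ _ => hasDerivAt_const _ _

theorem mul [Fintype m] {F : ℝ → Matrix l m ℂ} {G : ℝ → Matrix m n ℂ} {F' : Matrix l m ℂ}
    {G' : Matrix m n ℂ} (hF : HasMatrixDerivAt F F' t) (hG : HasMatrixDerivAt G G' t) :
    HasMatrixDerivAt (fun s => F s * G s) (F' * G t + F t * G') t := fun i j => by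
  simp only [Matrix.mul_apply, Matrix.add_apply, ← Finset.sum_add_distrib]
  exact HasDerivAt.fun_sum fun k _ => (hF i k).mul (hG k j)

theorem adjugate {F : ℝ → Matrix (Fin 2) (Fin 2) ℂ} {F' : Matrix (Fin 2) (Fin 2) ℂ}
    (hF : HasMatrixDerivAt F F' t) : HasMatrixDerivAt (fun s => (F s).adjugate) F'.adjugate t := by
  intro i j
  simp only [Matrix.adjugate_fin_two]
  fin_cases i <;> fin_cases j
  · exact hF 1 1
  · exact (hF 0 1).fun_neg
  · exact (hF 1 0).fun_neg
  · exact hF 0 0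

end HasMatrixDerivAt

theorem eq_of_hasMatrixDerivAt_zero {m n : Type*} {F : ℝ → Matrix m n ℂ}
    (hF : ∀ t, HasMatrixDerivAt F 0 t) (s t : ℝ) : F s = F t := by
  ext i j
  exact is_const_of_deriv_eq_zero (f := fun s => F s i j) (fun t => (hF t i j).differentiableAt)
    (fun t => (hF t i j).deriv) s t

theorem adjugate_smul_su2 (lam : ℂ) (w : E3) : (lam • su2 w).adjugate = -(lam • su2 w) := by
  ext i j
  rw [Matrix.adjugate_fin_two]
  fin_cases i <;> fin_cases j <;> simp [su2]

namespace IsFrame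
variable {γ : ℝ → E3} {lam : ℂ} {x₀ : ℝ} {F : ℝ → Matrix (Fin 2) (Fin 2) ℂ}
  (hF : IsFrame γ lam x₀ F)
include hF

theorem hasMatrixDerivAt (t : ℝ) : HasMatrixDerivAt F (F t * (lam • su2 (deriv γ t))) t :=
  hF.2 t

theorem hasMatrixDerivAt_adjugate (t : ℝ) : HasMatrixDerivAt (fun s => (F s).adjugate)
    (-(lam • su2 (deriv γ t)) * (F t).adjugate) t := by
  have := (hF.hasMatrixDerivAt t).adjugate
  rwa [Matrix.adjugate_mul_distrib, adjugate_smul_su2] at this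

theorem det_eq_one (t : ℝ) : (F t).det = 1 := by
  have h : ∀ t, HasMatrixDerivAt (fun s => F s * (F s).adjugate) 0 t := fun t => by
    have := (hF.hasMatrixDerivAt t).mul (hF.hasMatrixDerivAt_adjugate t)
    convert this using 1
    rw [← mul_assoc, mul_neg, neg_mul, add_neg_cancel]
  have h1 := eq_of_hasMatrixDerivAt_zero h t x₀
  simp only [Matrix.mul_adjugate, hF.1, Matrix.det_one] at h1
  simpa using congrFun (congrFun h1 0) 0

theorem mul_adjugate (t : ℝ) : F t * (F t).adjugate = 1 := by
  rw [Matrix.mul_adjugate, hF.det_eq_one, one_smul]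

theorem adjugate_mul (t : ℝ) : (F t).adjugate * F t = 1 := by
  rw [Matrix.adjugate_mul, hF.det_eq_one, one_smul]

variable {p : ℝ} {h : E3 ≃ᵃⁱ[ℝ] E3} (hγ : γ ∈ curvesWithMonodromy p h)
  {U : Matrix (Fin 2) (Fin 2) ℂ} (hU : IsSpinLift h U)
include hγ hU

/-- The frame is quasiperiodic: `F (t + p) U F (t)⁻¹` is constant, as both factors solve the same
equation. -/
theorem frame_add_mul (t : ℝ) : F (t + p) * U = hypMonodromy p F U x₀ * F t := by
  have hUU : star U * U = 1 :=
    Matrix.mem_unitaryGroup_iff'.mp (Matrix.mem_specialUnitaryGroup_iff.mp hU.1).1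
  have hd : ∀ t, HasMatrixDerivAt (fun s => F (s + p) * U * (F s).adjugate) 0 t := fun t => by
    have h1 : HasMatrixDerivAt (fun s => F (s + p))
        (F (t + p) * (lam • su2 (deriv γ (t + p)))) t :=
      fun i j => (hF.hasMatrixDerivAt (t + p) i j).comp_add_const t p
    convert (h1.mul (.const U)).mul (hF.hasMatrixDerivAt_adjugate t) using 1
    rw [deriv_monodromy (hγ.1.differentiable (by simp)) hγ.2.2, hU.2,
        ← Matrix.star_eq_conjTranspose]
    have : U * su2 (deriv γ t) * star U * U = U * su2 (deriv γ t) := by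
      rw [mul_assoc, hUU, mul_one]
    simp only [mul_smul_comm, smul_mul_assoc, mul_zero, add_zero, neg_mul, mul_neg, mul_assoc,
      mul_assoc] at this ⊢
    rw [← mul_assoc (star U) U, hUU, one_mul, add_neg_cancel]
  have h2 := eq_of_hasMatrixDerivAt_zero hd t x₀
  have h3 : hypMonodromy p F U x₀ = F (t + p) * U * (F t).adjugate := by
    rw [h2, hypMonodromy, hF.1, inv_one, one_mul, Matrix.adjugate_one, mul_one]
  rw [h3, mul_assoc _ _ (F t), hF.adjugate_mul, mul_one]

/-- The monodromies with different base points are conjugate by the frame. -/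
theorem hypMonodromy_eq (t : ℝ) :
    hypMonodromy p F U t = (F t).adjugate * hypMonodromy p F U x₀ * F t := by
  have hinv : (F t)⁻¹ = (F t).adjugate := Matrix.inv_eq_left_inv (hF.adjugate_mul t)
  rw [hypMonodromy, mul_assoc, hF.frame_add_mul hγ hU, hinv, mul_assoc]

omit hγ in
theorem det_hypMonodromy : (hypMonodromy p F U x₀).det = 1 := by
  rw [hypMonodromy, hF.1, inv_one, one_mul, Matrix.det_mul, hF.det_eq_one, one_mul]
  exact (Matrix.mem_specialUnitaryGroup_iff.mp hU.1).2

end IsFrame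
end

/-! ### The Hopf map and fixed points at infinity -/

noncomputable section

/-- The hermitian matrix `φ φ*`. -/
def rankOne (φ : Fin 2 → ℂ) : Matrix (Fin 2) (Fin 2) ℂ := Matrix.vecMulVec φ (star φ)

/-- The square of the hermitian norm of `φ`. -/
def spinorNormSq (φ : Fin 2 → ℂ) : ℝ := Complex.normSq (φ 0) + Complex.normSq (φ 1)

/-- The Hopf map: `hopf φ` is the point `S ∈ S²` with `φ φ*` on the light ray of `S`. -/
def hopf (φ : Fin 2 → ℂ) : E3 :=
  (spinorNormSq φ)⁻¹ • !₂[2 * (φ 1 * star (φ 0)).re, 2 * (φ 1 * star (φ 0)).im,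
    Complex.normSq (φ 0) - Complex.normSq (φ 1)]

theorem spinorNormSq_pos {φ : Fin 2 → ℂ} (hφ : φ ≠ 0) : 0 < spinorNormSq φ := by
  have h0 := Complex.normSq_nonneg (φ 0)
  have h1 := Complex.normSq_nonneg (φ 1)
  refine lt_of_le_of_ne (add_nonneg h0 h1) fun h => hφ ?_
  unfold spinorNormSq at h
  have e0 : φ 0 = 0 := Complex.normSq_eq_zero.mp (by linarith)
  have e1 : φ 1 = 0 := Complex.normSq_eq_zero.mp (by linarith)
  ext i
  fin_cases i
  · exact e0
  · exact e1

theorem norm_hopf {φ : Fin 2 → ℂ} (hφ : φ ≠ 0) : ‖hopf φ‖ = 1 := by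
  apply norm_eq_one_of_sq_sum
  have hN := (spinorNormSq_pos hφ).ne'
  simp [hopf]
  field_simp
  simp only [spinorNormSq, Complex.normSq_apply]
  ring

theorem rankOne_eq {φ : Fin 2 → ℂ} (hφ : φ ≠ 0) :
    rankOne φ = ((spinorNormSq φ / 2 : ℝ) : ℂ) • lightRay (hopf φ) := by
  have hN := (spinorNormSq_pos hφ).ne'
  ext i j
  fin_cases i <;> fin_cases j <;> apply Complex.ext <;>
    simp [rankOne, Matrix.vecMulVec_apply, lightRay, su2, hopf] <;> field_simp <;>
    (try simp only [spinorNormSq, Complex.normSq_apply]) <;> ring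

theorem smul_lightRay_injective {r s : ℝ} (hr : r ≠ 0) {S S' : E3}
    (h : (r : ℂ) • lightRay S = (s : ℂ) • lightRay S') : S = S' := by
  have h0 := congrFun (congrFun h 0) 0
  have h1 := congrFun (congrFun h 1) 1
  have h2 := congrFun (congrFun h 1) 0
  have a0 := congrArg Complex.re h0
  have a1 := congrArg Complex.re h1
  have a2 := congrArg Complex.re h2
  have a3 := congrArg Complex.im h2
  simp [lightRay, su2] at a0 a1 a2 a3
  have hrs : r = s := by linarith
  subst hrs
  refine E3.ext (mul_left_cancel₀ hr ?_) (mul_left_cancel₀ hr ?_) (mul_left_cancel₀ hr ?_) <;>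
    linarith

theorem eq_hopf_of_rankOne_eq {φ : Fin 2 → ℂ} (hφ : φ ≠ 0) {r : ℝ} {S : E3}
    (h : rankOne φ = (r : ℂ) • lightRay S) : hopf φ = S := by
  rw [rankOne_eq hφ] at h
  exact smul_lightRay_injective (by have := spinorNormSq_pos hφ; positivity) h

theorem rankOne_mulVec (B : Matrix (Fin 2) (Fin 2) ℂ) (φ : Fin 2 → ℂ) :
    rankOne (B *ᵥ φ) = B * rankOne φ * Bᴴ := by
  rw [rankOne, rankOne, Matrix.mul_vecMulVec, Matrix.vecMulVec_mul, Matrix.star_mulVec]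

theorem rankOne_smul (c : ℂ) (φ : Fin 2 → ℂ) :
    rankOne (c • φ) = ((Complex.normSq c : ℝ) : ℂ) • rankOne φ := by
  rw [rankOne, rankOne, star_smul, Matrix.smul_vecMulVec, Matrix.vecMulVec_smul, smul_smul,
    Complex.normSq_eq_conj_mul_self, mul_comm]
  rfl

theorem hopf_smul {c : ℂ} (hc : c ≠ 0) {φ : Fin 2 → ℂ} (hφ : φ ≠ 0) : hopf (c • φ) = hopf φ := by
  refine eq_hopf_of_rankOne_eq (smul_ne_zero hc hφ)
    (r := Complex.normSq c * (spinorNormSq φ / 2)) ?_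
  rw [rankOne_smul, rankOne_eq hφ, smul_smul, Complex.ofReal_mul]

theorem exists_smul_eq_of_hopf_eq {φ ψ : Fin 2 → ℂ} (hφ : φ ≠ 0) (hψ : ψ ≠ 0)
    (h : hopf φ = hopf ψ) : ∃ c : ℂ, c ≠ 0 ∧ ψ = c • φ := by
  have hN := (spinorNormSq_pos hφ).ne'
  have hM := (spinorNormSq_pos hψ).ne'
  have h1 : ((spinorNormSq φ : ℝ) : ℂ) • rankOne ψ = ((spinorNormSq ψ : ℝ) : ℂ) • rankOne φ := by
    rw [rankOne_eq hφ, rankOne_eq hψ, h, smul_smul, smul_smul, ← Complex.ofReal_mul,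
      ← Complex.ofReal_mul]
    congr 2; ring
  have h2 := congrArg (· *ᵥ ψ) h1
  simp only [Matrix.smul_mulVec, rankOne, Matrix.vecMulVec_mulVec] at h2
  have h3 : star ψ ⬝ᵥ ψ = ((spinorNormSq ψ : ℝ) : ℂ) := by
    simp [dotProduct, Fin.sum_univ_two, spinorNormSq, Complex.normSq_eq_conj_mul_self]
  rw [h3] at h2
  have h4 : ψ = ((star φ ⬝ᵥ ψ) / (spinorNormSq φ : ℝ)) • φ := by
    have hN' : ((spinorNormSq φ : ℝ) : ℂ) ≠ 0 := by exact_mod_cast hN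
    have hM' : ((spinorNormSq ψ : ℝ) : ℂ) ≠ 0 := by exact_mod_cast hM
    ext i
    have h5 := congrFun h2 i
    simp at h5
    simp
    field_simp
    apply mul_left_cancel₀ hM'
    linear_combination h5
  exact ⟨_, fun h0 => hψ (by rw [h4, h0, zero_smul]), h4⟩

theorem exists_hopf_eq {S : E3} (hS : ‖S‖ = 1) : ∃ φ : Fin 2 → ℂ, φ ≠ 0 ∧ hopf φ = S := by
  have hs := sq_sum_eq_one hS
  by_cases h2 : S 2 = -1
  · have h0 : S 0 = 0 := by nlinarith
    have h1 : S 1 = 0 := by nlinarith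
    refine ⟨![0, 1], fun h => by simpa using congrFun h 1, ?_⟩
    apply E3.ext <;> simp [hopf, spinorNormSq, h0, h1, h2]
  · have h3 : 1 + S 2 ≠ 0 := fun h => h2 (by linarith)
    have hφ : (![1 + S 2, S 0 + Complex.I * S 1] : Fin 2 → ℂ) ≠ 0 := fun h => h3 (by
      have := congrFun h 0
      simp at this
      have h4 := congrArg Complex.re this
      simpa using h4)
    refine ⟨_, hφ, eq_hopf_of_rankOne_eq hφ (r := 1 + S 2) ?_⟩
    ext i j
    fin_cases i <;> fin_cases j <;> apply Complex.ext <;>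
      simp [rankOne, Matrix.vecMulVec_apply, lightRay, su2] <;> nlinarith

theorem mulVec_ne_zero {B B' : Matrix (Fin 2) (Fin 2) ℂ} (hB : B' * B = 1) {φ : Fin 2 → ℂ}
    (hφ : φ ≠ 0) : B *ᵥ φ ≠ 0 := fun h => hφ (by
  rw [← Matrix.one_mulVec φ, ← hB, ← Matrix.mulVec_mulVec, h, Matrix.mulVec_zero])

/-- The sphere at infinity is the complex projective line: fixed points of `q ↦ B q B*` at infinity
are eigenlines of `B`. -/
theorem hopf_mem_fixedPointsAtInfinity_iff {B B' : Matrix (Fin 2) (Fin 2) ℂ} (hB : B' * B = 1)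
    {φ : Fin 2 → ℂ} (hφ : φ ≠ 0) :
    hopf φ ∈ fixedPointsAtInfinity B ↔ ∃ μ : ℂ, B *ᵥ φ = μ • φ := by
  have hBφ := mulVec_ne_zero hB hφ
  have hN := spinorNormSq_pos hφ
  have hM := spinorNormSq_pos hBφ
  have h1 := rankOne_mulVec B φ
  rw [rankOne_eq hφ, mul_smul_comm, smul_mul_assoc] at h1
  constructor
  · rintro ⟨-, r, -, hr⟩
    rw [hr, smul_smul, ← Complex.ofReal_mul] at h1
    obtain ⟨c, -, hc⟩ := exists_smul_eq_of_hopf_eq hφ hBφ (eq_hopf_of_rankOne_eq hBφ h1).symm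
    exact ⟨c, hc⟩
  · rintro ⟨μ, hμ⟩
    have hμ0 : μ ≠ 0 := fun h => hBφ (by rw [hμ, h, zero_smul])
    refine ⟨norm_hopf hφ, Complex.normSq μ, Complex.normSq_pos.mpr hμ0, ?_⟩
    rw [hμ, rankOne_smul, rankOne_eq hφ] at h1
    have hN' : ((spinorNormSq φ / 2 : ℝ) : ℂ) ≠ 0 := by
      have : spinorNormSq φ / 2 ≠ 0 := by positivity
      exact_mod_cast this
    rw [smul_comm] at h1
    exact (smul_right_injective _ hN' h1).symm

/-- A non-scalar matrix of size two has one or two eigenlines, which are spanned by `φ₁` and `φ₂`.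
-/
theorem exists_eigenvector_lines {B : Matrix (Fin 2) (Fin 2) ℂ} (hB : ∀ c : ℂ, B ≠ c • 1) :
    ∃ φ₁ φ₂ : Fin 2 → ℂ, φ₁ ≠ 0 ∧ φ₂ ≠ 0 ∧ (∃ μ : ℂ, B *ᵥ φ₁ = μ • φ₁) ∧
      (∃ μ : ℂ, B *ᵥ φ₂ = μ • φ₂) ∧ ∀ φ : Fin 2 → ℂ, (∃ μ : ℂ, B *ᵥ φ = μ • φ) →
        (∃ c : ℂ, φ = c • φ₁) ∨ ∃ c : ℂ, φ = c • φ₂ := by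
  have mv : ∀ φ : Fin 2 → ℂ, ∀ μ : ℂ, B *ᵥ φ = μ • φ ↔ B 0 0 * φ 0 + B 0 1 * φ 1 = μ * φ 0 ∧
      B 1 0 * φ 0 + B 1 1 * φ 1 = μ * φ 1 := fun φ μ => by
    rw [funext_iff, Fin.forall_fin_two]
    simp [Matrix.mulVec, dotProduct, Fin.sum_univ_two]
  -- The eigenlines are the zeros of the quadratic form
  -- `B 1 0 * x ^ 2 + (B 1 1 - B 0 0) * x * y - B 0 1 * y ^ 2`.
  by_cases hc : B 1 0 = 0
  · refine ⟨![1, 0], ![B 0 1, B 1 1 - B 0 0], fun h => by simpa using congrFun h 0, fun h => ?_,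
      ⟨B 0 0, ?_⟩, ⟨B 1 1, ?_⟩, ?_⟩
    · have e0 := congrFun h 0
      have e1 := congrFun h 1
      simp at e0 e1
      apply hB (B 0 0)
      ext i j
      fin_cases i <;> fin_cases j <;> simp [hc, e0]
      linear_combination e1
    · rw [mv]; simp [hc]
    · rw [mv]; simp [hc]; ring
    · rintro φ ⟨μ, hμ⟩
      rw [mv, hc, zero_mul, zero_add] at hμ
      by_cases h1 : φ 1 = 0
      · left
        refine ⟨φ 0, ?_⟩
        ext i; fin_cases i <;> simp [h1]
      · right
        have hμ1 : B 1 1 = μ := mul_right_cancel₀ h1 hμ.2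
        have h2 : (B 1 1 - B 0 0) * φ 0 = B 0 1 * φ 1 := by
          rw [hμ1]; linear_combination -hμ.1
        have h3 : B 1 1 - B 0 0 ≠ 0 := fun h => by
          rw [h, zero_mul] at h2
          have h01 : B 0 1 = 0 := (mul_eq_zero.mp h2.symm).resolve_right h1
          apply hB (B 0 0)
          ext i j
          fin_cases i <;> fin_cases j <;> simp [hc, h01]
          linear_combination h
        refine ⟨φ 1 / (B 1 1 - B 0 0), ?_⟩
        ext i; fin_cases i <;> simp <;> field_simp
        linear_combination h2
  · obtain ⟨s, hs⟩ := IsAlgClosed.exists_pow_nat_eq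
      ((B 1 1 - B 0 0) ^ 2 + 4 * B 1 0 * B 0 1) (n := 2) (by norm_num)
    have key : ∀ t : ℂ, B 1 0 * t ^ 2 + (B 1 1 - B 0 0) * t - B 0 1 = 0 →
        B *ᵥ ![t, 1] = (B 1 0 * t + B 1 1) • ![t, 1] := fun t ht => by
      rw [mv]; simp; linear_combination -ht
    refine ⟨![(-(B 1 1 - B 0 0) + s) / (2 * B 1 0), 1], ![(-(B 1 1 - B 0 0) - s) / (2 * B 1 0), 1],
      fun h => by simpa using congrFun h 1, fun h => by simpa using congrFun h 1,
      ⟨_, key _ ?_⟩, ⟨_, key _ ?_⟩, ?_⟩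
    · field_simp; linear_combination hs
    · field_simp; linear_combination hs
    · rintro φ ⟨μ, hμ⟩
      rw [mv] at hμ
      have h1 : (2 * B 1 0 * φ 0 - (-(B 1 1 - B 0 0) + s) * φ 1) *
          (2 * B 1 0 * φ 0 - (-(B 1 1 - B 0 0) - s) * φ 1) = 0 := by
        linear_combination (4 * B 1 0 * φ 0) * hμ.2 - (4 * B 1 0 * φ 1) * hμ.1 - φ 1 ^ 2 * hs
      rcases mul_eq_zero.mp h1 with h | h
      · left
        refine ⟨φ 1, ?_⟩
        ext i; fin_cases i <;> simp
        field_simp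
        linear_combination h
      · right
        refine ⟨φ 1, ?_⟩
        ext i; fin_cases i <;> simp
        field_simp
        linear_combination h
end

/-! ### Darboux transforms from eigenvectors of the monodromy -/

noncomputable section

theorem spinorNormSq_eq (φ : Fin 2 → ℂ) : spinorNormSq φ =
    (φ 0).re * (φ 0).re + (φ 0).im * (φ 0).im + ((φ 1).re * (φ 1).re + (φ 1).im * (φ 1).im) := rfl

theorem hopf_apply_zero (φ : Fin 2 → ℂ) :
    hopf φ 0 = 2 * ((φ 1).re * (φ 0).re + (φ 1).im * (φ 0).im) / spinorNormSq φ := by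
  simp [hopf]; ring

theorem hopf_apply_one (φ : Fin 2 → ℂ) :
    hopf φ 1 = 2 * ((φ 1).im * (φ 0).re - (φ 1).re * (φ 0).im) / spinorNormSq φ := by
  simp [hopf]; ring

theorem hopf_apply_two (φ : Fin 2 → ℂ) :
    hopf φ 2 = ((φ 0).re * (φ 0).re + (φ 0).im * (φ 0).im -
      ((φ 1).re * (φ 1).re + (φ 1).im * (φ 1).im)) / spinorNormSq φ := by
  simp [hopf, Complex.normSq_apply]; ring

/-- The equation `φ' = -λ γ' φ` of spinors descends to the equation of Darboux transforms. -/
theorem hasDerivAt_hopf {φ : ℝ → Fin 2 → ℂ} {lam : ℂ} {w : E3} {t : ℝ} (h0 : φ t ≠ 0)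
    (hφ : ∀ i, HasDerivAt (fun s => φ s i) ((-(lam • su2 w) *ᵥ φ t) i) t) :
    HasDerivAt (fun s => hopf (φ s)) (-(2 * lam.re) • cross w (hopf (φ t)) -
      (2 * lam.im) • cross (hopf (φ t)) (cross w (hopf (φ t)))) t := by
  have hN := (spinorNormSq_pos h0).ne'
  have hre : ∀ i, HasDerivAt (fun s => (φ s i).re) ((-(lam • su2 w) *ᵥ φ t) i).re t := fun i =>
    Complex.reCLM.hasFDerivAt.comp_hasDerivAt t (hφ i)
  have him : ∀ i, HasDerivAt (fun s => (φ s i).im) ((-(lam • su2 w) *ᵥ φ t) i).im t := fun i =>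
    Complex.imCLM.hasFDerivAt.comp_hasDerivAt t (hφ i)
  have a0 := hre 0
  have b0 := him 0
  have a1 := hre 1
  have b1 := him 1
  have hn := ((a0.fun_mul a0).fun_add (b0.fun_mul b0)).fun_add
    ((a1.fun_mul a1).fun_add (b1.fun_mul b1))
  rw [hasDerivAt_E3]
  simp only [hopf_apply_zero, hopf_apply_one, hopf_apply_two, spinorNormSq_eq, PiLp.sub_apply,
    PiLp.smul_apply, cross_apply_zero, cross_apply_one, cross_apply_two, smul_eq_mul] at hN ⊢
  refine ⟨((((a1.fun_mul a0).fun_add (b1.fun_mul b0)).const_mul 2).fun_div hn hN).congr_deriv ?_,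
    ((((b1.fun_mul a0).fun_sub (a1.fun_mul b0)).const_mul 2).fun_div hn hN).congr_deriv ?_,
    ((((a0.fun_mul a0).fun_add (b0.fun_mul b0)).fun_sub
      ((a1.fun_mul a1).fun_add (b1.fun_mul b1))).fun_div hn hN).congr_deriv ?_⟩ <;>
  · simp [Matrix.mulVec, dotProduct, Fin.sum_univ_two, su2]
    generalize (φ t 0).re = x at *
    generalize (φ t 0).im = x' at *
    generalize (φ t 1).re = y at *
    generalize (φ t 1).im = y' at *
    field_simp
    ring

namespace IsFrame
variable {γ : ℝ → E3} {lam : ℂ} {x₀ : ℝ} {F : ℝ → Matrix (Fin 2) (Fin 2) ℂ}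
  (hF : IsFrame γ lam x₀ F)
include hF

theorem adjugate_mulVec_ne_zero {φ : Fin 2 → ℂ} (hφ : φ ≠ 0) (t : ℝ) :
    (F t).adjugate *ᵥ φ ≠ 0 := mulVec_ne_zero (hF.mul_adjugate t) hφ

theorem hasDerivAt_hopf {φ : Fin 2 → ℂ} (hφ : φ ≠ 0) (t : ℝ) :
    HasDerivAt (fun s => hopf ((F s).adjugate *ᵥ φ))
      (-(2 * lam.re) • cross (deriv γ t) (hopf ((F t).adjugate *ᵥ φ)) -
        (2 * lam.im) • cross (hopf ((F t).adjugate *ᵥ φ))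
          (cross (deriv γ t) (hopf ((F t).adjugate *ᵥ φ)))) t := by
  refine _root_.hasDerivAt_hopf (hF.adjugate_mulVec_ne_zero hφ t) fun i => ?_
  rw [Matrix.mulVec_mulVec]
  simp only [Matrix.mulVec, dotProduct]
  exact HasDerivAt.fun_sum fun j _ => (hF.hasMatrixDerivAt_adjugate t i j).mul_const _

variable {p : ℝ} {h : E3 ≃ᵃⁱ[ℝ] E3} (hγ : γ ∈ curvesWithMonodromy p h)
  {U : Matrix (Fin 2) (Fin 2) ℂ} (hU : IsSpinLift h U)
include hγ hU

/-- An eigenvector of the monodromy gives a field of unit vectors with the monodromy of the curve.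
-/
theorem hopf_add {φ : Fin 2 → ℂ} (hφ : φ ≠ 0)
    (hμ : ∃ μ : ℂ, hypMonodromy p F U x₀ *ᵥ φ = μ • φ) (t : ℝ) :
    hopf ((F (t + p)).adjugate *ᵥ φ) = h.linearIsometryEquiv (hopf ((F t).adjugate *ᵥ φ)) := by
  obtain ⟨μ, hμ⟩ := hμ
  have hφt := hF.adjugate_mulVec_ne_zero hφ t
  have hW := hF.det_hypMonodromy (p := p) hU
  have hWadj : (hypMonodromy p F U x₀).adjugate * hypMonodromy p F U x₀ = 1 := by
    rw [Matrix.adjugate_mul, hW, one_smul]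
  have hμ0 : μ ≠ 0 := fun h0 => mulVec_ne_zero hWadj hφ (by rw [hμ, h0, zero_smul])
  have hUU : U * star U = 1 :=
    Matrix.mem_unitaryGroup_iff.mp (Matrix.mem_specialUnitaryGroup_iff.mp hU.1).1
  have e1 : μ • ((F (t + p)).adjugate *ᵥ φ) = U *ᵥ ((F t).adjugate *ᵥ φ) := by
    have e2 : (F (t + p)).adjugate * hypMonodromy p F U x₀ = U * (F t).adjugate := by
      have e3 := hF.frame_add_mul hγ hU t
      calc (F (t + p)).adjugate * hypMonodromy p F U x₀ =
          (F (t + p)).adjugate * (hypMonodromy p F U x₀ * F t) * (F t).adjugate := by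
            rw [mul_assoc, mul_assoc, hF.mul_adjugate, mul_one]
        _ = U * (F t).adjugate := by rw [← e3, ← mul_assoc, hF.adjugate_mul, one_mul]
    rw [← Matrix.mulVec_smul, ← hμ, Matrix.mulVec_mulVec, e2, Matrix.mulVec_mulVec]
  rw [← hopf_smul hμ0 (hF.adjugate_mulVec_ne_zero hφ _), e1]
  have hUinv : star U * U = 1 := mul_eq_one_comm.mp hUU
  refine eq_hopf_of_rankOne_eq (mulVec_ne_zero hUinv hφt)
    (r := spinorNormSq ((F t).adjugate *ᵥ φ) / 2) ?_
  rw [rankOne_mulVec, rankOne_eq hφt, mul_smul_comm, smul_mul_assoc, lightRay, lightRay, hU.2,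
    mul_add, add_mul, mul_one, ← Matrix.star_eq_conjTranspose, hUU, mul_smul_comm, smul_mul_assoc]

/-- The fixed points at infinity of all monodromies come from the eigenlines of the monodromy with
base point `x₀`, moved by the frame. -/
theorem fixedPointsAtInfinity_eq {φ₁ φ₂ : Fin 2 → ℂ} (h1 : φ₁ ≠ 0) (h2 : φ₂ ≠ 0)
    (e1 : ∃ μ : ℂ, hypMonodromy p F U x₀ *ᵥ φ₁ = μ • φ₁)
    (e2 : ∃ μ : ℂ, hypMonodromy p F U x₀ *ᵥ φ₂ = μ • φ₂)
    (e : ∀ φ : Fin 2 → ℂ, (∃ μ : ℂ, hypMonodromy p F U x₀ *ᵥ φ = μ • φ) →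
        (∃ c : ℂ, φ = c • φ₁) ∨ ∃ c : ℂ, φ = c • φ₂) (t : ℝ) :
    fixedPointsAtInfinity (hypMonodromy p F U t) =
      {hopf ((F t).adjugate *ᵥ φ₁), hopf ((F t).adjugate *ᵥ φ₂)} := by
  have hB := hF.hypMonodromy_eq hγ hU t
  have hdet : (hypMonodromy p F U t).det = 1 := by
    rw [hB, Matrix.det_mul, Matrix.det_mul, hF.det_hypMonodromy hU, hF.det_eq_one,
      Matrix.det_adjugate, hF.det_eq_one]
    simp
  have hadj : (hypMonodromy p F U t).adjugate * hypMonodromy p F U t = 1 := by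
    rw [Matrix.adjugate_mul, hdet, one_smul]
  have hiff : ∀ ψ : Fin 2 → ℂ, (∃ μ : ℂ, hypMonodromy p F U t *ᵥ ψ = μ • ψ) ↔
      ∃ μ : ℂ, hypMonodromy p F U x₀ *ᵥ (F t *ᵥ ψ) = μ • (F t *ᵥ ψ) := fun ψ => by
    refine exists_congr fun μ => ⟨fun hμ => ?_, fun hμ => ?_⟩
    · rw [← Matrix.mulVec_smul, ← hμ, hB, Matrix.mulVec_mulVec, Matrix.mulVec_mulVec, ← mul_assoc,
        ← mul_assoc, hF.mul_adjugate, one_mul]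
    · rw [hB, mul_assoc, ← Matrix.mulVec_mulVec, ← Matrix.mulVec_mulVec, hμ, Matrix.mulVec_smul,
        Matrix.mulVec_mulVec, hF.adjugate_mul, Matrix.one_mulVec]
  have hmem : ∀ φ : Fin 2 → ℂ, φ ≠ 0 → (∃ μ : ℂ, hypMonodromy p F U x₀ *ᵥ φ = μ • φ) →
      hopf ((F t).adjugate *ᵥ φ) ∈ fixedPointsAtInfinity (hypMonodromy p F U t) := fun φ hφ hμ => by
    rw [hopf_mem_fixedPointsAtInfinity_iff hadj (hF.adjugate_mulVec_ne_zero hφ t), hiff,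
      Matrix.mulVec_mulVec φ (F t) (F t).adjugate, hF.mul_adjugate, Matrix.one_mulVec]
    exact hμ
  ext S
  constructor
  · intro hS
    obtain ⟨ψ, hψ, rfl⟩ := exists_hopf_eq hS.1
    rw [hopf_mem_fixedPointsAtInfinity_iff hadj hψ, hiff] at hS
    have key : ∀ φ : Fin 2 → ℂ, φ ≠ 0 → (∃ c : ℂ, F t *ᵥ ψ = c • φ) →
        hopf ψ = hopf ((F t).adjugate *ᵥ φ) := fun φ hφ ⟨c, hc⟩ => by
      have h3 : ψ = c • ((F t).adjugate *ᵥ φ) := by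
        rw [← Matrix.mulVec_smul, ← hc, Matrix.mulVec_mulVec, hF.adjugate_mul, Matrix.one_mulVec]
      have hc0 : c ≠ 0 := fun h0 => hψ (by rw [h3, h0, zero_smul])
      rw [h3, hopf_smul hc0 (hF.adjugate_mulVec_ne_zero hφ t)]
    rcases e _ hS with h | h
    · exact Or.inl (key _ h1 h)
    · exact Or.inr (key _ h2 h)
  · rintro (rfl | rfl)
    · exact hmem _ h1 e1
    · exact hmem _ h2 e2

omit hγ hU in
theorem hopf_adjugate_injective {φ₁ φ₂ : Fin 2 → ℂ} (h1 : φ₁ ≠ 0) (h2 : φ₂ ≠ 0) {s : ℝ}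
    (hs : hopf ((F s).adjugate *ᵥ φ₁) = hopf ((F s).adjugate *ᵥ φ₂)) (t : ℝ) :
    hopf ((F t).adjugate *ᵥ φ₁) = hopf ((F t).adjugate *ᵥ φ₂) := by
  obtain ⟨c, hc0, hc⟩ := exists_smul_eq_of_hopf_eq (hF.adjugate_mulVec_ne_zero h1 s)
    (hF.adjugate_mulVec_ne_zero h2 s) hs
  have h3 : φ₂ = c • φ₁ := by
    have := congrArg (F s *ᵥ ·) hc
    simpa only [Matrix.mulVec_smul, Matrix.mulVec_mulVec, hF.mul_adjugate, Matrix.one_mulVec]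
      using this
  rw [h3, Matrix.mulVec_smul, hopf_smul hc0 (hF.adjugate_mulVec_ne_zero h1 t)]

end IsFrame

/-- On a connected space, a continuous selection from two continuous functions that agree everywhere
or nowhere is one of the two. -/
theorem eq_or_eq_of_continuous_selection {X Y : Type*} [TopologicalSpace X] [PreconnectedSpace X]
    [TopologicalSpace Y] [T2Space Y] {f g₁ g₂ : X → Y} (hf : Continuous f) (h1 : Continuous g₁)
    (h2 : Continuous g₂) (hfg : ∀ x, f x = g₁ x ∨ f x = g₂ x)
    (hne : ∀ x y, g₁ x = g₂ x → g₁ y = g₂ y) : f = g₁ ∨ f = g₂ := by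
  by_cases h : ∃ x, g₁ x = g₂ x
  · obtain ⟨x, hx⟩ := h
    exact Or.inl (funext fun y => (hfg y).elim id fun h => h.trans (hne x y hx).symm)
  · push Not at h
    have hc : IsClopen {x | f x = g₁ x} := by
      refine ⟨isClosed_eq hf h1, ?_⟩
      have : {x | f x = g₁ x} = {x | f x = g₂ x}ᶜ := by
        ext x
        refine ⟨fun hx hx' => h x (hx.symm.trans hx'), fun hx => (hfg x).resolve_right hx⟩
      rw [this]
      exact (isClosed_eq hf h2).isOpen_compl
    rcases isClopen_iff.mp hc with h0 | h0
    · exact Or.inr (funext fun x => (hfg x).resolve_left fun hx => by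
        have : x ∈ ({x | f x = g₁ x} : Set X) := hx
        rw [h0] at this; exact this)
    · exact Or.inl (funext fun x => by
        have : x ∈ ({x | f x = g₁ x} : Set X) := by rw [h0]; trivial
        exact this)
end

/-! ### Darboux transforms preserve the monodromy and all Hamiltonians -/

theorem mainTheorem8 (p : ℝ) (hp : 0 < p) (h : E3 ≃ᵃⁱ[ℝ] E3) (hor : IsOrientationPreserving h)
    (γ : ℝ → E3) (hγ : γ ∈ curvesWithMonodromy p h)
    (lam : ℂ) (hlam : lam.im ≠ 0) (x₀ : ℝ)
    (F : ℝ → Matrix (Fin 2) (Fin 2) ℂ) (hF : IsFrame γ lam x₀ F)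
    (U : Matrix (Fin 2) (Fin 2) ℂ) (hU : IsSpinLift h U)
    (hnt : hypMonodromy p F U x₀ ≠ 1 ∧ hypMonodromy p F U x₀ ≠ -1) :
    (∃ Sp Sm : ℝ → E3, Continuous Sp ∧ Continuous Sm ∧
      ∀ x, fixedPointsAtInfinity (hypMonodromy p F U x) = {Sp x, Sm x}) ∧
    ∀ Sp Sm : ℝ → E3, Continuous Sp → Continuous Sm →
      (∀ x, fixedPointsAtInfinity (hypMonodromy p F U x) = {Sp x, Sm x}) →
      ∀ S : ℝ → E3, S = Sp ∨ S = Sm →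
      ∀ η : ℝ → E3, (∀ x, η x = γ x + (lam.im / ‖lam‖ ^ 2) • S x) →
        IsDarbouxTransform lam γ η ∧
        η ∈ curvesWithMonodromy p h ∧
        (∀ x, dist (η x) (γ x) = |lam.im| / ‖lam‖ ^ 2) ∧
        (∀ x, ‖deriv η x‖ = ‖deriv γ x‖) ∧
        (∀ o v : E3, IsAxis h o v →
          volumeFunctional p x₀ o v η = volumeFunctional p x₀ o v γ ∧
          areaFunctional p x₀ o v η = areaFunctional p x₀ o v γ) ∧
        lengthFunctional p x₀ η = lengthFunctional p x₀ γ ∧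
        totalTorsion p x₀ h η = totalTorsion p x₀ h γ ∧
        ∀ k : ℕ, 3 ≤ k → higherHamiltonian p x₀ k η = higherHamiltonian p x₀ k γ := by
  have hB : ∀ c : ℂ, hypMonodromy p F U x₀ ≠ c • 1 := fun c hc => by
    have hdet := hF.det_hypMonodromy (p := p) hU
    rw [hc, Matrix.det_smul, Matrix.det_one, mul_one, Fintype.card_fin, sq_eq_one_iff] at hdet
    rcases hdet with h1 | h1
    · exact hnt.1 (by rw [hc, h1, one_smul])
    · exact hnt.2 (by rw [hc, h1, neg_one_smul])
  obtain ⟨φ₁, φ₂, h1, h2, e1, e2, e⟩ := exists_eigenvector_lines hB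
  have hfix := hF.fixedPointsAtInfinity_eq hγ hU h1 h2 e1 e2 e
  have hcont : ∀ φ : Fin 2 → ℂ, φ ≠ 0 → Continuous fun t => hopf ((F t).adjugate *ᵥ φ) :=
    fun φ hφ => continuous_iff_continuousAt.mpr fun t => (hF.hasDerivAt_hopf hφ t).continuousAt
  refine ⟨⟨_, _, hcont _ h1, hcont _ h2, hfix⟩, ?_⟩
  intro Sp Sm hSp hSm hSpm S hS η hη
  have hScont : Continuous S := by rcases hS with rfl | rfl <;> assumption
  have hmem : ∀ x, S x = hopf ((F x).adjugate *ᵥ φ₁) ∨ S x = hopf ((F x).adjugate *ᵥ φ₂) :=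
    fun x => by
      have h3 : S x ∈ fixedPointsAtInfinity (hypMonodromy p F U x) := by
        rw [hSpm]
        rcases hS with rfl | rfl
        · exact Or.inl rfl
        · exact Or.inr rfl
      rwa [hfix] at h3
  obtain ⟨φ, hφ, hμ, rfl⟩ : ∃ φ : Fin 2 → ℂ, φ ≠ 0 ∧
      (∃ μ : ℂ, hypMonodromy p F U x₀ *ᵥ φ = μ • φ) ∧
      S = fun t => hopf ((F t).adjugate *ᵥ φ) := by
    rcases eq_or_eq_of_continuous_selection hScont (hcont _ h1) (hcont _ h2) hmem
      (fun x y hx => hF.hopf_adjugate_injective h1 h2 hx y) with h3 | h3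
    · exact ⟨φ₁, h1, e1, h3⟩
    · exact ⟨φ₂, h2, e2, h3⟩
  have hSp' := hF.hopf_add hγ hU hφ hμ
  have hnorm := fun t => norm_hopf (hF.adjugate_mulVec_ne_zero hφ t)
  have hlam2 : ‖lam‖ ^ 2 = lam.re ^ 2 + lam.im ^ 2 := by
    rw [Complex.sq_norm, Complex.normSq_apply, pow_two, pow_two]
  have H : IsDarbouxPair lam.re lam.im γ η fun t => hopf ((F t).adjugate *ᵥ φ) :=
    { contDiff := hγ.1
      deriv_ne_zero := hγ.2.1
      im_ne_zero := hlam
      norm_eq_one := hnorm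
      eq_add_smul := fun t => by rw [hη, hlam2]
      hasDerivAt := hF.hasDerivAt_hopf hφ }
  obtain ⟨u, hu⟩ := hU.exists_isQuatLift
  have hηmem := H.mem_curvesWithMonodromy hγ.2.2 hSp'
  refine ⟨⟨_, hnorm, hη, hF.hasDerivAt_hopf hφ⟩, hηmem, fun x => ?_, H.norm_deriv_η,
    fun o v hov => ⟨H.volumeFunctional_eq hγ.2.2 hSp' hu.map_cross hov,
      H.areaFunctional_eq hγ.2.2 hSp' hu.map_cross hov⟩, H.lengthFunctional_eq p x₀,
    H.totalTorsion_eq hSp' hu.map_cross, fun k _ => H.higherHamiltonian_eq hγ hηmem hSp' hu x₀ k⟩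
  rw [hη, dist_eq_norm, add_sub_cancel_left, norm_smul, hnorm, mul_one, Real.norm_eq_abs, abs_div,
    abs_of_nonneg (sq_nonneg ‖lam‖)]
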